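/- **Conventions.** All polytopes are convex. A polytopal complex is a finite collection of polytopes in $\mathbb{R}^d$ which contains the empty polytope and all faces of its members, and in which any two members intersect in a common face; its facets are its inclusion-maximal members. It is cubical if each of its non-empty members is a combinatorial cube, i.e. has a face lattice isomorphic to that of $[0,1]^k$ for some $k\ge 0$. A polytopal subdivision of a set $X\subset\mathbb{R}^d$ is a polytopal complex $\mathcal{K}$ whose union $|\mathcal{K}|$ is $X$. If $X$ is convex, a lifting function of $\mathcal{K}$ is a concave function $f:X\to\mathbb{R}$ whose domains of linearity (the maximal convex subsets of $X$ on which $f$ is affine) are exactly the facets of $\mathcal{K}$. For a set $Y$, write $\mathcal{K}\cap Y=\{G\cap Y : G\in\mathcal{K}\}$. A *lifted cubical boundary subdivision* of a $d$-polytope $P\subset\mathbb{R}^d$ is a pair $(\mathcal{S},\psi)$ of a cubical subdivision $\mathcal{S}$ of the boundary $\partial P$ and a piecewise linear function $\psi:\partial P\to\mathbb{R}$ such that, for each facet $F$ of $P$, the restriction $\psi|_F$ is a lifting function of the induced subdivision $\mathcal{S}\cap F$ of $F$. **Theorem (generalized regular Hexhoop).** Let $P$ be a convex $d$-polytope in $\mathbb{R}^d$,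 let $(\mathcal{S},\psi)$ be a lifted cubical boundary subdivision of $P$, and let $H$ be a hyperplane in $\mathbb{R}^d$ such that * $P$ and $(\mathcal{S},\psi)$ are symmetric with respect to $H$: the orthogonal reflection $\sigma$ in $H$ satisfies $\sigma(P)=P$, maps $\mathcal{S}$ to itself, and $\psi\circ\sigma=\psi$ on $\partial P$; and * $\mathcal{S}\cap H$ is a subcomplex of $\mathcal{S}$. Then $(\mathcal{S},\psi)$ has a lifted cubification $(\mathcal{B},\phi)$. That is, there are a cubical subdivision $\mathcal{B}$ of $P$ and a lifting function $\phi:P\to\mathbb{R}$ of $\mathcal{B}$ (so $\mathcal{B}$ is a regular cubical $d$-ball) such that the boundary complex $\{G\in\mathcal{B} : G\subseteq\partial P\}$ of $\mathcal{B}$ equals $\mathcal{S}$ and $\phi|_{\partial P}=\psi$. -/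

import Mathlib

/-! Convex polytopes, polytopal and cubical complexes, lifting functions, lifted boundary
subdivisions and lifted cubifications. -/

namespace LiftedCubification

section Basic

variable {E : Type*} [AddCommGroup E] [Module ℝ E] [TopologicalSpace E]

/-- A convex polytope: the convex hull of a finite set of points. The empty polytope is allowed. -/
def IsPolytope (P : Set E) : Prop :=
  ∃ V : Finset E, P = convexHull ℝ (V : Set E)

/-- `F` is a face of the polytope `P`: the set of maximizers over `P` of a linear functional, or
the empty set. In particular `∅` and `P` are faces of `P`. -/
def IsFace (P F : Set E) : Prop :=
  IsExposed ℝ P F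

/-- A facet of a polytope: a maximal proper face. -/
def IsFacet (P F : Set E) : Prop :=
  Maximal (fun G => IsFace P G ∧ G ≠ P) F

/-- Two polytopes are combinatorially isomorphic if their face lattices, ordered by inclusion,
are isomorphic. -/
def CombinatoriallyIsomorphic {E' : Type*} [AddCommGroup E'] [Module ℝ E'] [TopologicalSpace E']
    (P : Set E) (Q : Set E') : Prop :=
  Nonempty ({F : Set E // IsFace P F} ≃o {F : Set E' // IsFace Q F})

/-- A combinatorial cube: a polytope combinatorially isomorphic to `[0,1]^k` for some `k`. -/
def IsCombinatorialCube (C : Set E) : Prop :=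
  IsPolytope C ∧ ∃ k : ℕ, CombinatoriallyIsomorphic C (Set.Icc (0 : Fin k → ℝ) 1)

/-- A (finite, geometric) polytopal complex: a finite collection of polytopes that contains the
empty polytope and all the faces of its members, and in which any two members intersect in a
common face. -/
structure IsPolytopalComplex (K : Set (Set E)) : Prop where
  finite : K.Finite
  isPolytope : ∀ C ∈ K, IsPolytope C
  empty_mem : ∅ ∈ K
  face_mem : ∀ C ∈ K, ∀ F, IsFace C F → F ∈ K
  inter_face : ∀ C ∈ K, ∀ D ∈ K, IsFace C (C ∩ D) ∧ IsFace D (C ∩ D)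

/-- A complex is cubical if all its (non-empty) cells are combinatorial cubes. -/
def IsCubical (K : Set (Set E)) : Prop :=
  ∀ C ∈ K, C.Nonempty → IsCombinatorialCube C

/-- A subcomplex of `K`: a subset of `K` that is itself a polytopal complex. -/
def IsSubcomplex (L K : Set (Set E)) : Prop :=
  L ⊆ K ∧ IsPolytopalComplex L

/-- The support (underlying set) of a complex: the union of its cells. -/
def support (K : Set (Set E)) : Set E :=
  ⋃₀ K

/-- A facet of a complex: an inclusion-maximal cell. -/
def IsFacetOfComplex (K : Set (Set E)) (C : Set E) : Prop :=
  Maximal (fun D => D ∈ K) C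

/-- The restriction `K ∩ X = {C ∩ X | C ∈ K}` of a complex to a set (a hyperplane or a
polytope). -/
def restrict (K : Set (Set E)) (X : Set E) : Set (Set E) :=
  {D | ∃ C ∈ K, D = C ∩ X}

/-- `K` is a polytopal subdivision of the set `X`. -/
structure IsSubdivision (X : Set E) (K : Set (Set E)) : Prop where
  complex : IsPolytopalComplex K
  support_eq : support K = X

/-- `C` is a domain of linearity of `f` on `X`: a maximal convex subset of `X` on which `f` agrees
with an affine function. -/
def IsDomainOfLinearity (X : Set E) (f : E → ℝ) (C : Set E) : Prop :=
  Maximal (fun D => D ⊆ X ∧ Convex ℝ D ∧ ∃ g : E →ᵃ[ℝ] ℝ, Set.EqOn f g D) C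

/-- `f` is a lifting function of the subdivision `K`: it is concave on the support of `K`, and its
domains of linearity are exactly the facets of `K`. Only the values of `f` on the support of `K`
matter. -/
structure IsLiftingFunction (K : Set (Set E)) (f : E → ℝ) : Prop where
  concaveOn : ConcaveOn ℝ (support K) f
  domains : ∀ C : Set E, IsDomainOfLinearity (support K) f C ↔ IsFacetOfComplex K C

/-- A full-dimensional polytope in the ambient space. -/
structure IsFullDimPolytope (P : Set E) : Prop where
  isPolytope : IsPolytope P
  interior_nonempty : (interior P).Nonempty

/-- `(S, ψ)` is a lifted cubical boundary subdivision of `P`: `S` is a cubical subdivision of the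
boundary of `P`, and on every facet `F` of `P` the function `ψ` restricts to a lifting function of
the induced subdivision `S ∩ F`. (In particular `ψ` is piecewise linear on the boundary, being
affine on every cell of `S`.) -/
structure IsLiftedCubicalBoundarySubdivision (P : Set E) (S : Set (Set E)) (ψ : E → ℝ) :
    Prop where
  subdivision : IsSubdivision (frontier P) S
  cubical : IsCubical S
  lifting : ∀ F : Set E, IsFacet P F → IsLiftingFunction (restrict S F) ψ

/-- The boundary complex of a subdivision of a full-dimensional polytope: the subcomplex of all
cells that lie in the boundary of the support. -/
def boundaryComplex (B : Set (Set E)) : Set (Set E) :=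
  {C | C ∈ B ∧ C ⊆ frontier (support B)}

/-- `(B, φ)` is a lifted cubification of the lifted cubical boundary subdivision `(S, ψ)` of the
full-dimensional polytope `P`: `B` is a cubical subdivision of `P` with lifting function `φ`, the
boundary complex of `B` is `S`, and `φ` restricts to `ψ` on the boundary of `P`. -/
structure IsLiftedCubification (P : Set E) (S : Set (Set E)) (ψ : E → ℝ)
    (B : Set (Set E)) (φ : E → ℝ) : Prop where
  subdivision : IsSubdivision P B
  cubical : IsCubical B
  lifting : IsLiftingFunction B φ
  boundary_eq : boundaryComplex B = S
  eqOn_boundary : Set.EqOn φ ψ (frontier P)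

end Basic

end LiftedCubification

/-!
The cubification is the regular subdivision of `P` induced by the minimum `φ` of finitely many
affine functions; its cells are the regions on which one of these functions is minimal. A minimum
of affine functions is a lifting function of this subdivision (`isLiftingFunction_lowerEnvelope`),
so the work lies in choosing the functions such that the regions are cubes and nothing but `(S, ψ)`
is seen on the boundary.

Let `u` be an affine function that vanishes on the mirror `H`, let `m` be an interior point of `P`
on `H`, and let `e` be a short vector orthogonal to `H` with `u (m + e) = 1`. Since `H` cuts the
cells of `S` in cells of `S`, every cell lies on one side of `H` (`IsMirror.nonneg_of_pos`). For a
large number `h` there are the following affine functions, each of which is at least `ψ` on the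
boundary with equality exactly on one cell (`IsMirror.exists_height`):

* for each maximal cell `F` of `S` on the positive side, one with the value `h` at `m + e`;
* for each such `F`, another one with the value `h` at `m - e`; a constant is added to it so as to
  bring the point at which it takes the value `h` to `m - (1/2) e`;
* for each maximal cell `G` of `S` in `H`, one with the value `h` at `m` that is constant in the
  direction of `e`. Where a facet of `P` is perpendicular to `H`, such a function dominates `ψ`
  because `ψ` is concave and symmetric on the facet.

Together with their mirror images these are the functions of which `φ` is the minimum. On the
positive side of `H` the mirror images play no role, because the functions are nonincreasing in the
direction of `e` (`IsMirror.linear_neg`).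

In order to find the minimum at a point `x` with `0 ≤ u x`, write `x = m + a (y - m) + b e` with `y`
in the boundary of `P` on the nonnegative side. The three kinds of functions exceed
`a ψ(y) + (1 - a) h` at `x` by nonnegative terms which vanish if and only if `y` lies in the given
cell and, for the first two kinds, `a + b = 1` or `b = a - 1/2`, respectively; this requires the
inequalities `a + b ≤ 1` and `b ≤ a - 1/2` (`Heights.base_chart`). A presentation of `x` that
satisfies these inequalities, and for which one of the functions attains the bound, always exists
(`IsMirror.exists_chart`): project from `m + e` in a collar along the boundary, from `m - (1/2) e`
in a core, and from `m`, in the plane of `y`, `m` and `e`, between the two. Hence the cells are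

* the truncated cone `3/4 ≤ a ≤ 1` over `F` with apex `m + e`,
* the part of the cone over `F` with apex `m - (1/2) e` between `a = 3/4` and `H`, and
* a family of squares `|b| ≤ min (1 - a, a - 1/2)` over `G`,

and the mirror images of the first two. Each of them is mapped to `F` or `G` by a projective map
whose fibres are segments or squares, so that its face lattice is that of `F` or `G` times a segment
or a square (`hasCubeCoordinates_of_projective`). A boundary point is presented with `a = 1` and
`b = 0`; therefore `φ = ψ` on the boundary, and the boundary cells are the cells of `S`.

Two facts about polytopes are needed on the way. Convex extreme subsets of polytopes are exposed
(`IsPolytope.isFace_iff`), so faces can be handled through segments alone; and two polytopes are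
combinatorially isomorphic as soon as a map between them respects the preorder "`x` lies in the
smallest face that contains `y`" (`combinatoriallyIsomorphic_of_prec`).
-/

namespace LiftedCubification

/-! ### Precedence and smallest faces of convex sets -/

section Prec

variable {E : Type*} [AddCommGroup E] [Module ℝ E]

/-- `x` precedes `y` in the convex set `R`: the segment from `x` to `y` can be prolonged within `R`
beyond `y`. For `x` and `y` in `R` this says that `x` lies in the smallest face of `R` that
contains `y`. -/
def Prec (R : Set E) (x y : E) : Prop :=
  ∃ ε : ℝ, 0 < ε ∧ y + ε • (y - x) ∈ R

/-- The smallest face of the convex set `R` that contains the point `y` of `R`. -/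
def minFace (R : Set E) (y : E) : Set E :=
  {x | x ∈ R ∧ Prec R x y}

theorem prec_refl {R : Set E} {x : E} (hx : x ∈ R) : Prec R x x :=
  ⟨1, one_pos, by simpa using hx⟩

theorem Prec.mono {R R' : Set E} (h : R ⊆ R') {x y : E} (hxy : Prec R x y) : Prec R' x y := by
  obtain ⟨ε, h0, h1⟩ := hxy
  exact ⟨ε, h0, h h1⟩

theorem mem_openSegment_prolong (x y : E) {ε : ℝ} (hε : 0 < ε) :
    y ∈ openSegment ℝ x (y + ε • (y - x)) := by
  refine ⟨ε / (1 + ε), 1 / (1 + ε), by positivity, by positivity, by field_simp; ring, ?_⟩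
  have h : (1 + ε) ≠ 0 := by positivity
  rw [smul_add, smul_smul, smul_sub]
  have e1 : ε / (1 + ε) = 1 - 1 / (1 + ε) := by field_simp; ring
  have e2 : 1 / (1 + ε) * ε = 1 - 1 / (1 + ε) := by field_simp; ring
  rw [e1, e2]
  module

theorem prec_of_mem_openSegment {R : Set E} {x y z : E} (hz : z ∈ R)
    (h : y ∈ openSegment ℝ x z) : Prec R x y := by
  obtain ⟨a, b, ha, hb, hab, rfl⟩ := h
  refine ⟨a / b, by positivity, ?_⟩
  convert hz using 1
  obtain rfl : a = 1 - b := by linarith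
  have hb' : b ≠ 0 := hb.ne'
  have e : ((1 - b) • x + b • z + ((1 - b) / b) • ((1 - b) • x + b • z - x))
    = ((1 - b) - ((1 - b) / b) * b) • x + (b + ((1 - b) / b) * b) • z := by module
  rw [e, div_mul_cancel₀ _ hb']
  module

theorem prec_iff_openSegment {R : Set E} {x y : E} :
    Prec R x y ↔ ∃ z ∈ R, y ∈ openSegment ℝ x z := by
  constructor
  · rintro ⟨ε, h0, h1⟩
    exact ⟨_, h1, mem_openSegment_prolong x y h0⟩
  · rintro ⟨z, hz, h⟩
    exact prec_of_mem_openSegment hz h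

/-- If the prolongation by `ε` stays in a convex set, then so do all shorter ones. -/
theorem prolong_mem_of_le {R : Set E} (hR : Convex ℝ R) {x y : E} (hy : y ∈ R) {ε δ : ℝ}
    (h : y + ε • (y - x) ∈ R) (hδ : 0 ≤ δ) (hδε : δ ≤ ε) : y + δ • (y - x) ∈ R := by
  rcases hδ.eq_or_lt with rfl | hδ
  · simpa using hy
  have hε : 0 < ε := hδ.trans_le hδε
  have := hR hy h (a := 1 - δ / ε) (b := δ / ε) (by
    rw [sub_nonneg, div_le_one hε]; exact hδε) (by positivity) (by ring)
  convert this using 1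
  rw [smul_add, smul_smul, div_mul_cancel₀ _ hε.ne']
  module

theorem Prec.trans {R : Set E} (hR : Convex ℝ R) {x y z : E}
    (hxy : Prec R x y) (hyz : Prec R y z) : Prec R x z := by
  obtain ⟨p, hp, a, b, ha, hb, hab, rfl⟩ := prec_iff_openSegment.1 hxy
  obtain ⟨q, hq, c, d, hc, hd, hcd, rfl⟩ := prec_iff_openSegment.1 hyz
  have hs : 0 < c * b + d := by positivity
  refine prec_iff_openSegment.2 ⟨(c * b / (c * b + d)) • p + (d / (c * b + d)) • q,
    hR hp hq (by positivity) (by positivity) (by field_simp), c * a, c * b + d, by positivity, hs,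
    by linear_combination c * hab + hcd, ?_⟩
  rw [smul_add (c * b + d), smul_smul, smul_smul, mul_div_cancel₀ _ hs.ne',
    mul_div_cancel₀ _ hs.ne']
  module

theorem convex_minFace {R : Set E} (hR : Convex ℝ R) {y : E} (hy : y ∈ R) :
    Convex ℝ (minFace R y) := by
  intro x hx x' hx' a b ha hb hab
  refine ⟨hR hx.1 hx'.1 ha hb hab, ?_⟩
  obtain ⟨ε, hε, h⟩ := hx.2
  obtain ⟨ε', hε', h'⟩ := hx'.2
  refine ⟨min ε ε', lt_min hε hε', ?_⟩
  have h1 := prolong_mem_of_le hR hy h (lt_min hε hε').le (min_le_left _ _)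
  have h2 := prolong_mem_of_le hR hy h' (lt_min hε hε').le (min_le_right _ _)
  have := hR h1 h2 ha hb hab
  convert this using 1
  obtain rfl : a = 1 - b := by linarith
  module

theorem isExtreme_minFace {R : Set E} (hR : Convex ℝ R) {y : E} :
    IsExtreme ℝ R (minFace R y) := by
  refine ⟨fun x hx => hx.1, fun x hx z hz w hw h => ⟨hx, ?_⟩⟩
  exact (prec_of_mem_openSegment hz h).trans hR hw.2

theorem mem_of_isExtreme_of_prec {R A : Set E} (hA : IsExtreme ℝ R A) {x y : E} (hx : x ∈ R)
    (hy : y ∈ A) (h : Prec R x y) : x ∈ A := by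
  obtain ⟨z, hz, h⟩ := prec_iff_openSegment.1 h
  exact hA.left_mem_of_mem_openSegment hx hz hy h

theorem minFace_subset_of_isExtreme {R A : Set E} (hA : IsExtreme ℝ R A) {y : E} (hy : y ∈ A) :
    minFace R y ⊆ A :=
  fun _ hx => mem_of_isExtreme_of_prec hA hx.1 hy hx.2

theorem self_mem_minFace {R : Set E} {y : E} (hy : y ∈ R) : y ∈ minFace R y :=
  ⟨hy, prec_refl hy⟩

/-- On an extreme subset the precedence relations of the subset and of the whole set agree. -/
theorem prec_iff_of_isExtreme {R A : Set E} (hA : IsExtreme ℝ R A) {x y : E} (hx : x ∈ A)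
    (hy : y ∈ A) : Prec A x y ↔ Prec R x y := by
  refine ⟨Prec.mono hA.subset, fun h => ?_⟩
  obtain ⟨ε, h0, h1⟩ := h
  exact ⟨ε, h0, hA.right_mem_of_mem_openSegment (hA.subset hx) h1 hy
    (mem_openSegment_prolong x y h0)⟩

theorem minFace_subset_minFace_iff {R : Set E} (hR : Convex ℝ R) {x y : E} (hx : x ∈ R) :
    minFace R x ⊆ minFace R y ↔ Prec R x y :=
  ⟨fun h => (h (self_mem_minFace hx)).2, fun h _ hz => ⟨hz.1, hz.2.trans hR h⟩⟩

/-- A finite set of points of a convex set is preceded by a common point. -/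
theorem exists_forall_prec {R : Set E} (hR : Convex ℝ R) {V : Finset E} (hV : V.Nonempty)
    (hVR : (V : Set E) ⊆ R) : ∃ c ∈ R, ∀ v ∈ V, Prec R v c := by
  classical
  induction hV using Finset.Nonempty.cons_induction with
  | singleton a => exact ⟨a, hVR (by simp), by simpa using prec_refl (hVR (by simp))⟩
  | cons a s ha hs ih =>
    obtain ⟨c, hc, h⟩ := ih (fun x hx => hVR (by simp [Finset.mem_coe.1 hx]))
    have haR : a ∈ R := hVR (by simp)
    have hm : midpoint ℝ a c ∈ openSegment ℝ a c := midpoint_mem_openSegment a c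
    refine ⟨midpoint ℝ a c, hR.openSegment_subset haR hc hm, ?_⟩
    intro v hv
    rw [Finset.mem_cons] at hv
    rcases hv with rfl | hv
    · exact prec_of_mem_openSegment hc hm
    · rw [openSegment_symm] at hm
      exact (h v hv).trans hR (prec_of_mem_openSegment haR hm)

theorem exists_forall_prec_convexHull {V : Finset E} (hV : V.Nonempty) :
    ∃ c ∈ convexHull ℝ (V : Set E), ∀ x ∈ convexHull ℝ (V : Set E),
      Prec (convexHull ℝ (V : Set E)) x c := by
  obtain ⟨c, hc, h⟩ := exists_forall_prec (convex_convexHull ℝ (V : Set E)) hV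
    (subset_convexHull ℝ _)
  refine ⟨c, hc, fun x hx => ?_⟩
  have hV' : (V : Set E) ⊆ minFace (convexHull ℝ (V : Set E)) c :=
    fun v hv => ⟨subset_convexHull ℝ _ hv, h v hv⟩
  exact (convexHull_min hV' (convex_minFace (convex_convexHull ℝ _) hc) hx).2

/-- A point of a polytope is a convex combination of vertices of its smallest face. -/
theorem mem_convexHull_prec {V : Finset E} {x : E} (hx : x ∈ convexHull ℝ (V : Set E)) :
    x ∈ convexHull ℝ {v | v ∈ V ∧ Prec (convexHull ℝ (V : Set E)) v x} := by
  set R := convexHull ℝ (V : Set E) with hRdef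
  have hR : Convex ℝ R := convex_convexHull ℝ _
  suffices h : R ⊆ {x | x ∈ R ∧ x ∈ convexHull ℝ {v | v ∈ V ∧ Prec R v x}} from (h hx).2
  refine convexHull_min (fun v hv => ⟨subset_convexHull ℝ _ hv, ?_⟩) ?_
  · exact subset_convexHull ℝ _ ⟨hv, prec_refl (subset_convexHull ℝ _ hv)⟩
  · rw [convex_iff_openSegment_subset]
    intro p hp q hq z hz
    have hpz : Prec R p z := prec_of_mem_openSegment hq.1 hz
    have hqz : Prec R q z := by
      rw [openSegment_symm] at hz
      exact prec_of_mem_openSegment hp.1 hz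
    refine ⟨hR.openSegment_subset hp.1 hq.1 hz, ?_⟩
    refine (convex_convexHull ℝ _).openSegment_subset ?_ ?_ hz
    · refine convexHull_mono ?_ hp.2
      exact fun v hv => ⟨hv.1, hv.2.trans hR hpz⟩
    · refine convexHull_mono ?_ hq.2
      exact fun v hv => ⟨hv.1, hv.2.trans hR hqz⟩

/-- A convex extreme subset of a polytope is spanned by the vertices it contains. -/
theorem eq_convexHull_of_isExtreme {V : Finset E} {A : Set E} (hA : Convex ℝ A)
    (hAe : IsExtreme ℝ (convexHull ℝ (V : Set E)) A) :
    A = convexHull ℝ ((V : Set E) ∩ A) := by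
  refine subset_antisymm (fun x hx => ?_) (convexHull_min Set.inter_subset_right hA)
  refine convexHull_mono ?_ (mem_convexHull_prec (hAe.subset hx))
  exact fun v hv => ⟨hv.1, mem_of_isExtreme_of_prec hAe (subset_convexHull ℝ _ hv.1) hx hv.2⟩

theorem combo_apply (a : E →ᵃ[ℝ] ℝ) (p q : E) {s t : ℝ} (hst : s + t = 1) :
    a (s • p + t • q) = s * a p + t * a q := by
  rw [Convex.combo_affine_apply hst]; simp

/-- An affine function that is nonnegative on `V`, with its zeros on `V` in a convex set `F`, is
nonnegative on the convex hull of `V`, with its zeros in `F`. -/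
theorem nonneg_and_zero_mem_of_convexHull {V F : Set E} (hF : Convex ℝ F) (δ : E →ᵃ[ℝ] ℝ)
    (h : ∀ v ∈ V, 0 ≤ δ v ∧ (δ v = 0 → v ∈ F)) :
    ∀ x ∈ convexHull ℝ V, 0 ≤ δ x ∧ (δ x = 0 → x ∈ F) := by
  suffices hc : Convex ℝ {x | 0 ≤ δ x ∧ (δ x = 0 → x ∈ F)} from fun x hx => convexHull_min h hc hx
  rw [convex_iff_openSegment_subset]
  rintro p hp q hq z ⟨a, b, ha, hb, hab, rfl⟩
  have e := combo_apply δ p q hab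
  have h1 := mul_nonneg ha.le hp.1
  have h2 := mul_nonneg hb.le hq.1
  refine ⟨by rw [e]; positivity, fun h0 => ?_⟩
  rw [e] at h0
  have h3 : a * δ p = 0 := by linarith
  have h4 : b * δ q = 0 := by linarith
  exact hF (hp.2 (by simpa [ha.ne'] using h3)) (hq.2 (by simpa [hb.ne'] using h4)) ha.le hb.le hab

end Prec

/-! ### Faces of polytopes -/

section Faces

variable {E : Type*} [NormedAddCommGroup E] [NormedSpace ℝ E]

theorem IsPolytope.convex {P : Set E} (hP : IsPolytope P) : Convex ℝ P := by
  obtain ⟨V, rfl⟩ := hP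
  exact convex_convexHull ℝ _

theorem IsPolytope.isCompact {P : Set E} (hP : IsPolytope P) : IsCompact P := by
  obtain ⟨V, rfl⟩ := hP
  exact V.finite_toSet.isCompact_convexHull (𝕜 := ℝ)

theorem IsPolytope.exists_generic {P : Set E} (hP : IsPolytope P) (hne : P.Nonempty) :
    ∃ c ∈ P, ∀ x ∈ P, Prec P x c := by
  obtain ⟨V, rfl⟩ := hP
  exact exists_forall_prec_convexHull (by simpa using convexHull_nonempty_iff.1 hne)

theorem IsPolytope.finite_extreme {P : Set E} (hP : IsPolytope P) :
    {A : Set E | Convex ℝ A ∧ IsExtreme ℝ P A}.Finite := by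
  obtain ⟨V, rfl⟩ := hP
  refine (V.finite_toSet.finite_subsets.image (fun W => convexHull ℝ W)).subset ?_
  rintro A ⟨hA, hAe⟩
  exact ⟨(V : Set E) ∩ A, Set.inter_subset_left, (eq_convexHull_of_isExtreme hA hAe).symm⟩

/-- A nonempty convex extreme subset of a polytope is the smallest face of one of its points. -/
theorem IsPolytope.exists_eq_minFace {P A : Set E} (hP : IsPolytope P) (hA : Convex ℝ A)
    (hAe : IsExtreme ℝ P A) (hne : A.Nonempty) : ∃ x ∈ A, A = minFace P x := by
  have hApoly : IsPolytope A := by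
    obtain ⟨V, rfl⟩ := hP
    classical
    exact ⟨V.filter (· ∈ A), by
      rw [Finset.coe_filter]; exact eq_convexHull_of_isExtreme hA hAe⟩
  obtain ⟨x, hx, h⟩ := hApoly.exists_generic hne
  exact ⟨x, hx, subset_antisymm (fun y hy => ⟨hAe.subset hy, (h y hy).mono hAe.subset⟩)
    (minFace_subset_of_isExtreme hAe hx)⟩

end Faces

section FiniteDimensionalFaces

variable {E : Type*} [NormedAddCommGroup E] [NormedSpace ℝ E] [FiniteDimensional ℝ E]

/-- A convex set is supported at each point `x` that is not in its relative interior, by a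
functional that is not constant: this functional separates `x` from a relatively interior `c`. -/
theorem exists_support_of_not_prec {P : Set E} (hP : Convex ℝ P) {c x : E} (hc : c ∈ P)
    (hgen : ∀ y ∈ P, Prec P y c) (hx : x ∈ P) (hcx : ¬ Prec P c x) :
    ∃ l : E →L[ℝ] ℝ, (∀ y ∈ P, l y ≤ l x) ∧ l c < l x := by
  -- thicken `P` by a complement of its direction to reach a set with interior
  set D : Submodule ℝ E := Submodule.span ℝ ((fun y => y - c) '' P) with hD
  obtain ⟨D', hDD'⟩ := D.exists_isCompl
  have hPD : ∀ y ∈ P, y - c ∈ D := fun y hy => Submodule.subset_span ⟨y, hy, rfl⟩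
  set Q : Set E := {z | ∃ y ∈ P, ∃ d ∈ D', z = y + d} with hQ
  have hQconv : Convex ℝ Q := by
    rintro _ ⟨y, hy, d, hd, rfl⟩ _ ⟨y', hy', d', hd', rfl⟩ a b ha hb hab
    refine ⟨a • y + b • y', hP hy hy' ha hb hab, a • d + b • d',
      D'.add_mem (D'.smul_mem _ hd) (D'.smul_mem _ hd'), by module⟩
  have hPQ : P ⊆ Q := fun y hy => ⟨y, hy, 0, D'.zero_mem, by simp⟩
  have hQint : (interior Q).Nonempty := by
    rw [hQconv.interior_nonempty_iff_affineSpan_eq_top]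
    have hcQ : c ∈ affineSpan ℝ Q := subset_affineSpan ℝ Q (hPQ hc)
    rw [← AffineSubspace.direction_eq_top_iff_of_nonempty ⟨c, hcQ⟩, eq_top_iff,
      ← hDD'.sup_eq_top, sup_le_iff]
    constructor
    · rw [hD, Submodule.span_le]
      rintro _ ⟨y, hy, rfl⟩
      exact AffineSubspace.vsub_mem_direction (subset_affineSpan ℝ Q (hPQ hy)) hcQ
    · intro d hd
      have h1 : c + d ∈ affineSpan ℝ Q := subset_affineSpan ℝ Q ⟨c, hc, d, hd, rfl⟩
      simpa using AffineSubspace.vsub_mem_direction h1 hcQ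
  have hxQ : x ∉ interior Q := by
    intro hxi
    have hcont : Filter.Tendsto (fun ε : ℝ => x + ε • (x - c)) (nhdsWithin 0 (Set.Ioi 0))
        (nhds x) := by
      have : Continuous (fun ε : ℝ => x + ε • (x - c)) := by fun_prop
      simpa using (this.tendsto 0).mono_left nhdsWithin_le_nhds
    have hev := hcont.eventually (mem_interior_iff_mem_nhds.1 hxi)
    obtain ⟨ε, hε, hε0⟩ := (hev.and self_mem_nhdsWithin).exists
    obtain ⟨y, hy, d, hd, he⟩ := hε
    have hdD : d ∈ D := by
      have : d = (1 + ε) • (x - c) - (y - c) := by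
        have : d = x + ε • (x - c) - y := by rw [he]; abel
        rw [this]; module
      rw [this]
      exact D.sub_mem (D.smul_mem _ (hPD x hx)) (hPD y hy)
    have hd0 : d = 0 := by
      have := hDD'.disjoint.le_bot ⟨hdD, hd⟩
      simpa using this
    exact hcx ⟨ε, hε0, by rw [he, hd0, add_zero]; exact hy⟩
  obtain ⟨f, hf0, hf⟩ := geometric_hahn_banach_of_nonempty_interior_point hQconv hxQ hQint
  refine ⟨f, fun y hy => hf y (hPQ hy), (hf c (hPQ hc)).lt_of_ne fun hcx' => hf0 ?_⟩
  have hD'0 : ∀ d ∈ D', f d = 0 := by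
    intro d hd
    have h1 : ∀ t : ℝ, t * f d ≤ 0 := by
      intro t
      have := hf (x + t • d) ⟨x, hx, t • d, D'.smul_mem _ hd, rfl⟩
      simpa using this
    have h2 := h1 (f d)
    nlinarith
  have hD0 : ∀ d ∈ D, f d = 0 := by
    intro d hd
    have : D ≤ LinearMap.ker (f : E →ₗ[ℝ] ℝ) := by
      rw [hD, Submodule.span_le]
      rintro _ ⟨y, hy, rfl⟩
      obtain ⟨ε, hε, hm⟩ := hgen y hy
      have h1 := hf _ (hPQ hm)
      have h2 := hf _ (hPQ hy)
      simp only [map_add, map_smul, map_sub, smul_eq_mul, hcx'] at h1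
      have h3 : f y = f x := by
        refine le_antisymm h2 ?_
        by_contra hlt
        push Not at hlt
        nlinarith
      simp [h3, hcx']
    exact this hd
  ext z
  obtain ⟨d, hd, d', hd', rfl⟩ := Submodule.mem_sup.1
    (show z ∈ D ⊔ D' by rw [hDD'.sup_eq_top]; trivial)
  simp [hD0 d hd, hD'0 d' hd']

/-- At each point `x` of a polytope there is a functional, maximal at `x`, whose other maximizers
among the vertices are those of the smallest face of `x`. The functionals found on successively
smaller faces are combined with dominant weights on the earlier ones. -/
theorem exists_functional_exposing (n : ℕ) : ∀ (V : Finset E), V.card ≤ n →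
    ∀ x ∈ convexHull ℝ (V : Set E), ∃ l : E →L[ℝ] ℝ, ∀ v ∈ V,
      l v ≤ l x ∧ (l v = l x → Prec (convexHull ℝ (V : Set E)) v x) := by
  classical
  induction n with
  | zero =>
    intro V hV x hx
    have : V = ∅ := by simpa using hV
    subst this
    simp at hx
  | succ n ih =>
    intro V hV x hx
    by_cases hall : ∀ v ∈ V, Prec (convexHull ℝ (V : Set E)) v x
    · exact ⟨0, fun v hv => ⟨by simp, fun _ => hall v hv⟩⟩
    push Not at hall
    obtain ⟨v₀, hv₀, hv₀x⟩ := hall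
    obtain ⟨c, hc, hgen⟩ := exists_forall_prec_convexHull ⟨v₀, hv₀⟩
    have hconv := convex_convexHull ℝ (V : Set E)
    obtain ⟨l, hl, hlc⟩ := exists_support_of_not_prec hconv hc hgen hx
      (fun h => hv₀x ((hgen v₀ (subset_convexHull ℝ (V : Set E) hv₀)).trans hconv h))
    set W := V.filter (fun v => l v = l x) with hW
    have hWV : (W : Set E) ⊆ V := Finset.coe_subset.2 (Finset.filter_subset _ _)
    have hxW : x ∈ convexHull ℝ (W : Set E) := by
      have hF : Convex ℝ (convexHull ℝ (W : Set E)) := convex_convexHull ℝ _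
      have := nonneg_and_zero_mem_of_convexHull (V := V) hF
        (AffineMap.const ℝ E (l x) - (l : E →ₗ[ℝ] ℝ).toAffineMap) (fun v hv => by
          refine ⟨?_, fun h0 => ?_⟩
          · simpa using hl v (subset_convexHull ℝ (V : Set E) hv)
          · refine subset_convexHull ℝ (W : Set E) ?_
            have h1 : l v = l x := by
              have : l x - l v = 0 := by simpa using h0
              linarith
            simpa [hW, h1] using hv) x hx
      exact this.2 (by simp)
    have hlt : W.card < V.card := by
      refine Finset.card_lt_card (Finset.filter_ssubset.2 ?_)
      by_contra hcon
      push Not at hcon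
      have : c ∈ {y | l y = l x} := by
        refine convexHull_min (fun v hv => hcon v hv) ?_ hc
        exact convex_hyperplane (l : E →ₗ[ℝ] ℝ).isLinear _
      exact hlc.ne this
    obtain ⟨l', hl'⟩ := ih W (by omega) x hxW
    have hN : ∀ᶠ N : ℝ in Filter.atTop, ∀ v ∈ V, l v < l x →
        0 < N * (l x - l v) + (l' x - l' v) := by
      rw [Filter.eventually_all_finset]
      intro v _
      by_cases hv : l v < l x
      · have : Filter.Tendsto (fun N : ℝ => N * (l x - l v) + (l' x - l' v)) Filter.atTop
            Filter.atTop := Filter.tendsto_atTop_add_const_right _ _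
              (Filter.tendsto_id.atTop_mul_const (sub_pos.2 hv))
        filter_upwards [this.eventually_gt_atTop 0] with N hN _ using hN
      · exact Filter.Eventually.of_forall fun N h => absurd h hv
    obtain ⟨N, hN⟩ := hN.exists
    refine ⟨N • l + l', fun v hv => ?_⟩
    have e : ∀ z, (N • l + l') z = N * l z + l' z := fun z => by simp
    rw [e, e]
    rcases (hl v (subset_convexHull ℝ (V : Set E) hv)).lt_or_eq with h | h
    · have := hN v hv h
      exact ⟨by linarith, fun h' => by exfalso; linarith⟩
    · have hvW : v ∈ W := by simp [hW, hv, h]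
      have := hl' v hvW
      rw [h]
      exact ⟨by linarith, fun h' => (this.2 (by linarith)).mono (convexHull_mono hWV)⟩

theorem IsPolytope.isFace_minFace {P : Set E} (hP : IsPolytope P) {x : E} (hx : x ∈ P) :
    IsFace P (minFace P x) := by
  have hconv := hP.convex
  obtain ⟨V, hV⟩ := hP
  obtain ⟨l, hl⟩ := exists_functional_exposing V.card V le_rfl x (hV ▸ hx)
  rw [← hV] at hl
  have key := nonneg_and_zero_mem_of_convexHull (V := V) (convex_minFace hconv hx)
    (AffineMap.const ℝ E (l x) - (l : E →ₗ[ℝ] ℝ).toAffineMap) (fun v hv => by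
      refine ⟨by simpa using (hl v hv).1, fun h0 => ?_⟩
      have h1 : l x - l v = 0 := by simpa using h0
      refine ⟨?_, (hl v hv).2 (by linarith)⟩
      rw [hV]
      exact subset_convexHull ℝ (V : Set E) hv)
  rw [← hV] at key
  simp only [AffineMap.coe_sub, Pi.sub_apply, AffineMap.const_apply, LinearMap.coe_toAffineMap,
    ContinuousLinearMap.coe_coe] at key
  refine fun _ => ⟨l, Set.Subset.antisymm ?_ ?_⟩
  · rintro y ⟨hy, ε, hε, hm⟩
    refine ⟨hy, fun z hz => ?_⟩
    have h1 := (key _ hm).1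
    have h2 := (key _ hy).1
    have h3 := (key _ hz).1
    simp only [map_add, map_smul, map_sub, smul_eq_mul] at h1
    have : l x ≤ l y := by
      by_contra hlt
      push Not at hlt
      nlinarith
    linarith
  · rintro y ⟨hy, hmax⟩
    exact (key y hy).2 (by linarith [hmax x hx, (key y hy).1])

/-- The (exposed) faces of a polytope are its convex extreme subsets. -/
theorem IsPolytope.isFace_iff {P A : Set E} (hP : IsPolytope P) :
    IsFace P A ↔ Convex ℝ A ∧ IsExtreme ℝ P A := by
  refine ⟨fun h => ⟨IsExposed.convex h hP.convex, IsExposed.isExtreme h⟩, fun ⟨h1, h2⟩ => ?_⟩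
  rcases A.eq_empty_or_nonempty with rfl | hne
  · exact isExposed_empty
  · obtain ⟨x, hx, rfl⟩ := hP.exists_eq_minFace h1 h2 hne
    exact hP.isFace_minFace (h2.subset hx)

theorem IsPolytope.isFace_iff_minFace {P A : Set E} (hP : IsPolytope P) :
    IsFace P A ↔ A = ∅ ∨ ∃ x ∈ P, A = minFace P x := by
  constructor
  · intro h
    rcases A.eq_empty_or_nonempty with h0 | hne
    · exact Or.inl h0
    · have h' := hP.isFace_iff.1 h
      obtain ⟨x, hx, h2⟩ := hP.exists_eq_minFace h'.1 h'.2 hne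
      exact Or.inr ⟨x, h'.2.subset hx, h2⟩
  · rintro (rfl | ⟨x, hx, rfl⟩)
    · exact isExposed_empty
    · exact hP.isFace_minFace hx

theorem IsPolytope.face {P A : Set E} (hP : IsPolytope P) (hA : IsFace P A) : IsPolytope A := by
  obtain ⟨h1, h2⟩ := hP.isFace_iff.1 hA
  obtain ⟨V, rfl⟩ := hP
  classical
  exact ⟨V.filter (· ∈ A), by rw [Finset.coe_filter]; exact eq_convexHull_of_isExtreme h1 h2⟩

theorem IsPolytope.face_trans {P A B : Set E} (hP : IsPolytope P) (hA : IsFace P A)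
    (hB : IsFace A B) : IsFace P B := by
  have hB' := (hP.face hA).isFace_iff.1 hB
  exact hP.isFace_iff.2 ⟨hB'.1, (hP.isFace_iff.1 hA).2.trans hB'.2⟩

/-- The part of a polytope on which finitely many affine functions are nonnegative is a polytope:
its extreme points are told apart by their smallest face in `P` and the inequalities active
there. -/
theorem IsPolytope.inter_halfspaces {P : Set E} (hP : IsPolytope P) {ι : Type*} [Finite ι]
    (a : ι → E →ᵃ[ℝ] ℝ) : IsPolytope {x | x ∈ P ∧ ∀ i, 0 ≤ a i x} := by
  set R := {x | x ∈ P ∧ ∀ i, 0 ≤ a i x} with hRdef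
  have ha : ∀ i, Continuous (a i) := fun i => (a i).continuous_of_finiteDimensional
  have hRc : IsCompact R := by
    have : R = P ∩ ⋂ i, {x | 0 ≤ a i x} := by ext x; simp [hRdef]
    rw [this]
    exact hP.isCompact.inter_right (isClosed_iInter fun i => isClosed_le continuous_const (ha i))
  have hRconv : Convex ℝ R := by
    intro p hp q hq s t hs ht hst
    refine ⟨hP.convex hp.1 hq.1 hs ht hst, fun i => ?_⟩
    rw [combo_apply (a i) p q hst]
    have := mul_nonneg hs (hp.2 i)
    have := mul_nonneg ht (hq.2 i)
    positivity
  have hfin : (R.extremePoints ℝ).Finite := by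
    refine Set.Finite.of_finite_image (f := fun x => (minFace P x, {i | a i x = 0})) ?_ ?_
    · refine Set.Finite.subset (hP.finite_extreme.prod (Set.finite_univ (α := Set ι))) ?_
      rintro _ ⟨x, hx, rfl⟩
      exact ⟨⟨convex_minFace hP.convex hx.1.1, isExtreme_minFace hP.convex⟩, Set.mem_univ _⟩
    · intro x hx y hy hxy
      simp only [Prod.mk.injEq] at hxy
      have hxR := hx.1
      have hyR := hy.1
      have hpre : Prec P y x := by
        have : y ∈ minFace P x := hxy.1 ▸ self_mem_minFace hyR.1
        exact this.2
      obtain ⟨ε, hε, hm⟩ := hpre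
      have hev : ∀ᶠ δ : ℝ in nhdsWithin 0 (Set.Ioi 0), ∀ i, 0 ≤ a i (x + δ • (x - y)) := by
        rw [Filter.eventually_all]
        intro i
        rcases (hxR.2 i).eq_or_lt with h0 | h0
        · have h0' : a i y = 0 := by
            have : i ∈ {i | a i y = 0} := by rw [← hxy.2]; exact h0.symm
            exact this
          refine Filter.Eventually.of_forall fun δ => ?_
          have : x + δ • (x - y) = (1 + δ) • x + (-δ) • y := by module
          rw [this, combo_apply (a i) _ _ (by ring), h0', ← h0]
          simp
        · have hc : Continuous (fun δ : ℝ => a i (x + δ • (x - y))) := by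
            have := ha i
            fun_prop
          have := (hc.tendsto 0).mono_left (nhdsWithin_le_nhds (s := Set.Ioi 0))
          simp only [zero_smul, add_zero] at this
          exact (this.eventually (lt_mem_nhds h0)).mono fun _ h => h.le
      obtain ⟨δ, hδ, hδ0, hδε⟩ := (hev.and (Filter.inter_mem self_mem_nhdsWithin
        (mem_nhdsWithin_of_mem_nhds (Iic_mem_nhds hε)))).exists
      have hz : x + δ • (x - y) ∈ R :=
        ⟨prolong_mem_of_le hP.convex hxR.1 hm (le_of_lt hδ0) hδε, hδ⟩
      exact (hx.2 hyR hz (mem_openSegment_prolong y x hδ0)).symm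
  refine ⟨hfin.toFinset, ?_⟩
  rw [Set.Finite.coe_toFinset, ← (hfin.isClosed_convexHull (𝕜 := ℝ)).closure_eq]
  exact (closure_convexHull_extremePoints hRc hRconv).symm

end FiniteDimensionalFaces

/-! ### Cube coordinates and fibred cells -/

section Cubes

variable {E E' : Type*} [NormedAddCommGroup E] [NormedSpace ℝ E] [FiniteDimensional ℝ E]
  [NormedAddCommGroup E'] [NormedSpace ℝ E'] [FiniteDimensional ℝ E']

/-- A map between polytopes that preserves and reflects precedence, and that meets the relative
interior of every face, induces an isomorphism of face lattices. -/
theorem combinatoriallyIsomorphic_of_prec {P : Set E} {Q : Set E'} (hP : IsPolytope P)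
    (hQ : IsPolytope Q) (f : E → E') (hf : ∀ x ∈ P, f x ∈ Q)
    (hprec : ∀ x ∈ P, ∀ y ∈ P, Prec P x y ↔ Prec Q (f x) (f y))
    (hsurj : ∀ y ∈ Q, ∃ x ∈ P, Prec Q y (f x) ∧ Prec Q (f x) y) :
    CombinatoriallyIsomorphic P Q := by
  have himg : ∀ x ∈ P, {t | t ∈ Q ∧ ∃ z ∈ minFace P x, Prec Q t (f z)} = minFace Q (f x) := by
    intro x hx
    ext t
    constructor
    · rintro ⟨ht, z, hz, h⟩
      exact ⟨ht, h.trans hQ.convex ((hprec z hz.1 x hx).1 hz.2)⟩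
    · rintro ⟨ht, h⟩
      exact ⟨ht, x, self_mem_minFace hx, h⟩
  have hface : ∀ A, IsFace P A → IsFace Q {t | t ∈ Q ∧ ∃ z ∈ A, Prec Q t (f z)} := by
    intro A hA
    rcases hP.isFace_iff_minFace.1 hA with rfl | ⟨x, hx, rfl⟩
    · have h0 : {t | t ∈ Q ∧ ∃ z ∈ (∅ : Set E), Prec Q t (f z)} = ∅ := by simp
      rw [h0]
      exact isExposed_empty
    · rw [himg x hx]
      exact hQ.isFace_minFace (hf x hx)
  let g : {F : Set E // IsFace P F} → {F : Set E' // IsFace Q F} :=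
    fun A => ⟨_, hface A.1 A.2⟩
  have hg : ∀ A B, g A ≤ g B ↔ A ≤ B := by
    intro A B
    constructor
    · intro h x hx
      have hxP : x ∈ P := (hP.isFace_iff.1 A.2).2.subset hx
      obtain ⟨-, z, hz, hxz⟩ := h (show f x ∈ (g A).1 from
        ⟨hf x hxP, x, hx, prec_refl (hf x hxP)⟩)
      have hB := (hP.isFace_iff.1 B.2).2
      exact mem_of_isExtreme_of_prec hB hxP hz ((hprec x hxP z (hB.subset hz)).2 hxz)
    · rintro h t ⟨ht, z, hz, hp⟩
      exact ⟨ht, z, h hz, hp⟩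
  refine ⟨RelIso.ofSurjective (OrderEmbedding.ofMapLEIff g hg) ?_⟩
  rintro ⟨B, hB⟩
  rcases hQ.isFace_iff_minFace.1 hB with rfl | ⟨y, hy, rfl⟩
  · refine ⟨⟨∅, isExposed_empty⟩, Subtype.ext ?_⟩
    change {t | t ∈ Q ∧ ∃ z ∈ (∅ : Set E), Prec Q t (f z)} = ∅
    simp
  · obtain ⟨x, hx, h1, h2⟩ := hsurj y hy
    refine ⟨⟨minFace P x, hP.isFace_minFace hx⟩, Subtype.ext ?_⟩
    change {t | t ∈ Q ∧ ∃ z ∈ minFace P x, Prec Q t (f z)} = _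
    rw [himg x hx]
    exact subset_antisymm (fun t ht => ⟨ht.1, ht.2.trans hQ.convex h2⟩)
      (fun t ht => ⟨ht.1, ht.2.trans hQ.convex h1⟩)

/-- An isomorphism of face lattices comes from a map that preserves and reflects precedence: send
each point to a relatively interior point of the face that corresponds to its smallest face. -/
theorem CombinatoriallyIsomorphic.exists_prec {P : Set E} {Q : Set E'}
    (hP : IsPolytope P) (hQ : IsPolytope Q) (h : CombinatoriallyIsomorphic P Q) :
    ∃ f : E → E', (∀ x ∈ P, f x ∈ Q) ∧
      (∀ x ∈ P, ∀ y ∈ P, Prec P x y ↔ Prec Q (f x) (f y)) ∧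
      ∀ y ∈ Q, ∃ x ∈ P, Prec Q y (f x) ∧ Prec Q (f x) y := by
  classical
  obtain ⟨Ψ⟩ := h
  have hempty : ∀ A (hA : IsFace P A), (Ψ ⟨A, hA⟩).1 = ∅ → A = ∅ := by
    intro A hA h0
    have h1 : Ψ ⟨A, hA⟩ ≤ Ψ ⟨∅, isExposed_empty⟩ := by
      change (Ψ ⟨A, hA⟩).1 ⊆ _
      rw [h0]; exact Set.empty_subset _
    have h2 : A ⊆ ∅ := Ψ.le_iff_le.1 h1
    exact Set.subset_empty_iff.1 h2
  have key : ∀ x, ∃ z, ∀ hx : x ∈ P, z ∈ Q ∧ (Ψ ⟨minFace P x, hP.isFace_minFace hx⟩).1 =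
      minFace Q z := by
    intro x
    by_cases hx : x ∈ P
    · rcases hQ.isFace_iff_minFace.1 (Ψ ⟨minFace P x, hP.isFace_minFace hx⟩).2 with h0 | ⟨z, hz, h⟩
      · have := hempty _ _ h0
        exact absurd (this ▸ self_mem_minFace hx) (Set.notMem_empty x)
      · exact ⟨z, fun _ => ⟨hz, h⟩⟩
    · exact ⟨0, fun h => absurd h hx⟩
  choose f hf using key
  refine ⟨f, fun x hx => (hf x hx).1, ?_, ?_⟩
  · intro x hx y hy
    rw [← minFace_subset_minFace_iff hP.convex hx,
      ← minFace_subset_minFace_iff hQ.convex (hf x hx).1, ← (hf x hx).2, ← (hf y hy).2]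
    exact (Ψ.le_iff_le (x := ⟨minFace P x, hP.isFace_minFace hx⟩)
      (y := ⟨minFace P y, hP.isFace_minFace hy⟩)).symm
  · intro y hy
    obtain ⟨⟨A, hA⟩, hΨ⟩ := Ψ.surjective ⟨minFace Q y, hQ.isFace_minFace hy⟩
    rcases hP.isFace_iff_minFace.1 hA with rfl | ⟨x, hx, rfl⟩
    · have hΨ2 : Ψ ⟨∅, hA⟩ ≤ ⟨∅, isExposed_empty⟩ := by
        have : (⟨∅, hA⟩ : {F : Set E // IsFace P F}) ≤ Ψ.symm ⟨∅, isExposed_empty⟩ :=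
          Set.empty_subset _
        exact (OrderIso.le_symm_apply _).1 this
      rw [hΨ] at hΨ2
      exact absurd (hΨ2 (self_mem_minFace hy)) (Set.notMem_empty y)
    · have h2 := (hf x hx).2
      rw [hΨ] at h2
      change minFace Q y = _ at h2
      refine ⟨x, hx, ?_, ?_⟩
      · exact (minFace_subset_minFace_iff hQ.convex hy).1 h2.subset
      · exact (minFace_subset_minFace_iff hQ.convex (hf x hx).1).1 h2.superset

/-- Cube coordinates on a convex set `C`: a map `f` to `[0,1]^ι`, not assumed continuous, that
turns precedence in `C` into the coordinatewise relation "if the second coordinate is `0` or `1`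
then so is the first", and that attains every pattern of coordinates in `{0}`, `{1}`, `(0,1)`.
Only the pattern of `f x` matters. -/
def HasCubeCoordinates (C : Set E) : Prop :=
  ∃ (ι : Type) (_ : Fintype ι) (f : E → ι → ℝ),
    (∀ x ∈ C, ∀ i, f x i ∈ Set.Icc (0 : ℝ) 1) ∧
    (∀ x ∈ C, ∀ y ∈ C, Prec C x y ↔ ∀ i, (f y i = 0 → f x i = 0) ∧ (f y i = 1 → f x i = 1)) ∧
    ∀ t : ι → ℝ, (∀ i, t i ∈ Set.Icc (0 : ℝ) 1) →
      ∃ x ∈ C, ∀ i, (f x i = 0 ↔ t i = 0) ∧ (f x i = 1 ↔ t i = 1)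

theorem isPolytope_Icc (k : ℕ) : IsPolytope (Set.Icc (0 : Fin k → ℝ) 1) := by
  classical
  have h : Set.Icc (0 : Fin k → ℝ) 1 =
      convexHull ℝ (Set.univ.pi fun _ : Fin k => ({0, 1} : Set ℝ)) := by
    rw [convexHull_pi, ← Set.pi_univ_Icc]
    simp [convexHull_pair, segment_eq_Icc]
  have hfin : (Set.univ.pi fun _ : Fin k => ({0, 1} : Set ℝ)).Finite :=
    Set.Finite.pi fun _ => Set.toFinite _
  exact ⟨hfin.toFinset, by rw [Set.Finite.coe_toFinset, h]⟩

theorem prec_Icc_iff {k : ℕ} {s t : Fin k → ℝ} (hs : s ∈ Set.Icc (0 : Fin k → ℝ) 1)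
    (ht : t ∈ Set.Icc (0 : Fin k → ℝ) 1) :
    Prec (Set.Icc (0 : Fin k → ℝ) 1) s t ↔ ∀ i, (t i = 0 → s i = 0) ∧ (t i = 1 → s i = 1) := by
  constructor
  · rintro ⟨ε, hε, h0, h1⟩ i
    have h0i : 0 ≤ t i + ε * (t i - s i) := by simpa using h0 i
    have h1i : t i + ε * (t i - s i) ≤ 1 := by simpa using h1 i
    have hs0 : 0 ≤ s i := hs.1 i
    have hs1 : s i ≤ 1 := hs.2 i
    constructor
    · intro h
      rw [h] at h0i
      nlinarith
    · intro h
      rw [h] at h1i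
      nlinarith
  · intro h
    have hev : ∀ᶠ ε : ℝ in nhdsWithin 0 (Set.Ioi 0), ∀ i,
        0 ≤ t i + ε * (t i - s i) ∧ t i + ε * (t i - s i) ≤ 1 := by
      rw [Filter.eventually_all]
      intro i
      have hc : Continuous (fun ε : ℝ => t i + ε * (t i - s i)) := by fun_prop
      have hl := (hc.tendsto 0).mono_left (nhdsWithin_le_nhds (s := Set.Ioi 0))
      simp only [zero_mul, add_zero] at hl
      have hs0 : 0 ≤ s i := hs.1 i
      have hs1 : s i ≤ 1 := hs.2 i
      refine Filter.Eventually.and ?_ ?_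
      · rcases (show 0 ≤ t i from ht.1 i).eq_or_lt with h0 | h0
        · refine Filter.Eventually.of_forall fun ε => ?_
          rw [← h0, (h i).1 h0.symm]; simp
        · exact (hl.eventually (lt_mem_nhds h0)).mono fun _ h => h.le
      · rcases (show t i ≤ 1 from ht.2 i).eq_or_lt with h0 | h0
        · refine Filter.Eventually.of_forall fun ε => ?_
          rw [h0, (h i).2 h0]; simp
        · exact (hl.eventually (gt_mem_nhds h0)).mono fun _ h => h.le
    obtain ⟨ε, hε, hε0⟩ := (hev.and self_mem_nhdsWithin).exists
    exact ⟨ε, hε0, fun i => by simpa using (hε i).1, fun i => by simpa using (hε i).2⟩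

theorem IsCombinatorialCube.hasCubeCoordinates {C : Set E} (hC : IsCombinatorialCube C) :
    HasCubeCoordinates C := by
  obtain ⟨hP, k, hk⟩ := hC
  obtain ⟨f, hf, hprec, hsurj⟩ := hk.exists_prec hP (isPolytope_Icc k)
  refine ⟨Fin k, inferInstance, f, fun x hx i => ⟨(hf x hx).1 i, (hf x hx).2 i⟩, ?_, ?_⟩
  · intro x hx y hy
    rw [hprec x hx y hy, prec_Icc_iff (hf x hx) (hf y hy)]
  · intro t ht
    have htI : t ∈ Set.Icc (0 : Fin k → ℝ) 1 := ⟨fun i => (ht i).1, fun i => (ht i).2⟩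
    obtain ⟨x, hx, h1, h2⟩ := hsurj t htI
    rw [prec_Icc_iff htI (hf x hx)] at h1
    rw [prec_Icc_iff (hf x hx) htI] at h2
    exact ⟨x, hx, fun i => ⟨⟨(h1 i).1, (h2 i).1⟩, ⟨(h1 i).2, (h2 i).2⟩⟩⟩

theorem HasCubeCoordinates.isCombinatorialCube {C : Set E} (hP : IsPolytope C)
    (hC : HasCubeCoordinates C) : IsCombinatorialCube C := by
  obtain ⟨ι, _, f, hf, hprec, hsurj⟩ := hC
  let e := Fintype.equivFin ι
  have hf' : ∀ x ∈ C, (fun j => f x (e.symm j)) ∈ Set.Icc (0 : Fin (Fintype.card ι) → ℝ) 1 :=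
    fun x hx => ⟨fun j => (hf x hx _).1, fun j => (hf x hx _).2⟩
  refine ⟨hP, Fintype.card ι, combinatoriallyIsomorphic_of_prec hP (isPolytope_Icc _)
    (fun x j => f x (e.symm j)) hf' ?_ ?_⟩
  · intro x hx y hy
    rw [hprec x hx y hy, prec_Icc_iff (hf' x hx) (hf' y hy)]
    exact (e.symm.forall_congr_right
      (q := fun i => (f y i = 0 → f x i = 0) ∧ (f y i = 1 → f x i = 1))).symm
  · intro t ht
    obtain ⟨x, hx, h⟩ := hsurj (fun i => t (e i)) (fun i => ⟨ht.1 _, ht.2 _⟩)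
    refine ⟨x, hx, (prec_Icc_iff ht (hf' x hx)).2 fun j => ?_,
      (prec_Icc_iff (hf' x hx) ht).2 fun j => ?_⟩
    · have := h (e.symm j)
      simp only [Equiv.apply_symm_apply] at this
      exact ⟨this.1.1, this.2.1⟩
    · have := h (e.symm j)
      simp only [Equiv.apply_symm_apply] at this
      exact ⟨this.1.2, this.2.2⟩

/-- A face of a cube is a cube: its coordinates are those that are not constantly `0` or `1` on
it. -/
theorem IsCombinatorialCube.face {C A : Set E} (hC : IsCombinatorialCube C) (hA : IsFace C A)
    (hne : A.Nonempty) : IsCombinatorialCube A := by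
  classical
  have hAe := hC.1.isFace_iff.1 hA
  obtain ⟨x₀, hx₀, hAx⟩ := hC.1.exists_eq_minFace hAe.1 hAe.2 hne
  have hx₀C := hAe.2.subset hx₀
  obtain ⟨ι, _, f, hf, hprec, hsurj⟩ := hC.hasCubeCoordinates
  refine HasCubeCoordinates.isCombinatorialCube (hC.1.face hA)
    ⟨{i : ι // f x₀ i ≠ 0 ∧ f x₀ i ≠ 1}, inferInstance, fun x i => f x i,
      fun x hx i => hf x (hAe.2.subset hx) i, ?_, ?_⟩
  · intro x hx y hy
    rw [prec_iff_of_isExtreme hAe.2 hx hy, hprec x (hAe.2.subset hx) y (hAe.2.subset hy)]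
    refine ⟨fun h i => h i, fun h i => ?_⟩
    by_cases hi : f x₀ i ≠ 0 ∧ f x₀ i ≠ 1
    · exact h ⟨i, hi⟩
    · have hx' := (hprec x (hAe.2.subset hx) x₀ hx₀C).1 (hAx ▸ hx : x ∈ minFace C x₀).2 i
      have hy' := (hprec y (hAe.2.subset hy) x₀ hx₀C).1 (hAx ▸ hy : y ∈ minFace C x₀).2 i
      by_cases h0 : f x₀ i = 0
      · rw [hx'.1 h0, hy'.1 h0]; simp
      · have h1 : f x₀ i = 1 := by by_contra h1; exact hi ⟨h0, h1⟩
        rw [hx'.2 h1, hy'.2 h1]; simp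
  · intro t ht
    obtain ⟨x, hx, h⟩ := hsurj
      (fun i => if hi : f x₀ i ≠ 0 ∧ f x₀ i ≠ 1 then t ⟨i, hi⟩ else f x₀ i) (fun i => by
        split_ifs
        · exact ht _
        · exact hf x₀ hx₀C i)
    refine ⟨x, ?_, fun i => by simpa [i.2.1, i.2.2] using h i⟩
    rw [hAx]
    refine ⟨hx, (hprec x hx x₀ hx₀C).2 fun i => ?_⟩
    have hi := h i
    constructor
    · intro h0
      rw [hi.1]; simp [h0]
    · intro h1
      rw [hi.2]; simp [h1]

/-- Combinatorial type of a fibred cell. The projective map `x ↦ (w x)⁻¹ • A x` sends `R` onto the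
cube `C`, and each pair `α j`, `β j` of inequalities adds a pair of opposite facets. The ratios
`α j / (α j + β j)` are the new cube coordinates. -/
theorem hasCubeCoordinates_of_projective {C R : Set E} (hCconv : Convex ℝ C)
    (hC : HasCubeCoordinates C) {n : ℕ} (w : E →ᵃ[ℝ] ℝ) (A : E →ᵃ[ℝ] E)
    (α β : Fin n → E →ᵃ[ℝ] ℝ)
    (hR : ∀ x, x ∈ R ↔ 0 < w x ∧ (w x)⁻¹ • A x ∈ C ∧ ∀ j, 0 ≤ α j x ∧ 0 ≤ β j x)
    (hpos : ∀ x ∈ R, ∀ j, 0 < α j x + β j x)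
    (hsurj : ∀ y ∈ C, ∀ t : Fin n → ℝ, (∀ j, t j ∈ Set.Icc (0 : ℝ) 1) →
      ∃ x ∈ R, (w x)⁻¹ • A x = y ∧ ∀ j, (α j x = 0 ↔ t j = 0) ∧ (β j x = 0 ↔ t j = 1)) :
    HasCubeCoordinates R := by
  obtain ⟨ι, _, f, hf, hprec, hs⟩ := hC
  have hline : ∀ (a : E →ᵃ[ℝ] ℝ) (x y : E) (ε : ℝ),
      a (y + ε • (y - x)) = (1 + ε) * a y - ε * a x := by
    intro a x y ε
    have e : y + ε • (y - x) = (1 + ε) • y + (-ε) • x := by module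
    rw [e, Convex.combo_affine_apply (by ring)]
    simp only [smul_eq_mul]; ring
  have hlineA : ∀ (x y : E) (ε : ℝ), A (y + ε • (y - x)) = (1 + ε) • A y - ε • A x := by
    intro x y ε
    have e : y + ε • (y - x) = (1 + ε) • y + (-ε) • x := by module
    rw [e, Convex.combo_affine_apply (by ring)]
    module
  -- the image of a prolonged segment is a prolonged segment
  have hproj : ∀ (x y : E) (ε : ℝ), 0 < w x → 0 < w y → 0 < w (y + ε • (y - x)) →
      (w (y + ε • (y - x)))⁻¹ • A (y + ε • (y - x)) = (w y)⁻¹ • A y +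
        (ε * w x / w (y + ε • (y - x))) • ((w y)⁻¹ • A y - (w x)⁻¹ • A x) := by
    intro x y ε hx hy hz
    rw [hline] at hz
    rw [hlineA, hline]
    have hx' := hx.ne'
    have hy' := hy.ne'
    have hz' := hz.ne'
    have e1 : ((1 + ε) * w y - ε * w x)⁻¹ * (1 + ε)
        = (w y)⁻¹ + ε * w x / ((1 + ε) * w y - ε * w x) * (w y)⁻¹ := by
      field_simp; ring
    have e2 : ((1 + ε) * w y - ε * w x)⁻¹ * ε
        = ε * w x / ((1 + ε) * w y - ε * w x) * (w x)⁻¹ := by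
      field_simp
    rw [smul_sub, smul_smul, smul_smul, e1, e2]
    module
  have hprecR : ∀ x ∈ R, ∀ y ∈ R, Prec R x y ↔
      Prec C ((w x)⁻¹ • A x) ((w y)⁻¹ • A y) ∧
        ∀ j, (α j y = 0 → α j x = 0) ∧ (β j y = 0 → β j x = 0) := by
    intro x hx y hy
    have hx' := (hR x).1 hx
    have hy' := (hR y).1 hy
    constructor
    · rintro ⟨ε, hε, hz⟩
      have hz' := (hR _).1 hz
      refine ⟨⟨ε * w x / w (y + ε • (y - x)), ?_, ?_⟩, fun j => ?_⟩
      · have := hx'.1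
        have := hz'.1
        positivity
      · rw [← hproj x y ε hx'.1 hy'.1 hz'.1]; exact hz'.2.1
      · have h1 := hz'.2.2 j
        rw [hline, hline] at h1
        have h2 := hx'.2.2 j
        constructor
        · intro h0
          rw [h0] at h1
          nlinarith [h1.1, h2.1]
        · intro h0
          rw [h0] at h1
          nlinarith [h1.2, h2.2]
    · rintro ⟨⟨δ, hδ, hm⟩, hj⟩
      have hcont : ∀ a : E →ᵃ[ℝ] ℝ, Filter.Tendsto (fun ε : ℝ => a (y + ε • (y - x)))
          (nhdsWithin 0 (Set.Ioi 0)) (nhds (a y)) := by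
        intro a
        have hc : Continuous (fun ε : ℝ => a (y + ε • (y - x))) := by
          have := a.continuous_of_finiteDimensional
          fun_prop
        simpa using (hc.tendsto 0).mono_left (nhdsWithin_le_nhds (s := Set.Ioi 0))
      have hnn : ∀ a : E →ᵃ[ℝ] ℝ, 0 ≤ a y → (a y = 0 → a x = 0) →
          ∀ᶠ ε : ℝ in nhdsWithin 0 (Set.Ioi 0), 0 ≤ a (y + ε • (y - x)) := by
        intro a h0 h1
        rcases h0.eq_or_lt with h | h
        · refine Filter.Eventually.of_forall fun ε => ?_
          rw [hline, ← h, h1 h.symm]; simp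
        · exact ((hcont a).eventually (lt_mem_nhds h)).mono fun _ h => h.le
      have hε1 : ∀ᶠ ε : ℝ in nhdsWithin 0 (Set.Ioi 0), 0 < w (y + ε • (y - x)) :=
        (hcont w).eventually (lt_mem_nhds hy'.1)
      have hε2 : ∀ᶠ ε : ℝ in nhdsWithin 0 (Set.Ioi 0),
          ε * w x / w (y + ε • (y - x)) < δ := by
        have h1 : Filter.Tendsto (fun ε : ℝ => ε * w x) (nhdsWithin 0 (Set.Ioi 0)) (nhds 0) := by
          have hc : Continuous (fun ε : ℝ => ε * w x) := by fun_prop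
          simpa using (hc.tendsto 0).mono_left (nhdsWithin_le_nhds (s := Set.Ioi 0))
        have := h1.div (hcont w) hy'.1.ne'
        rw [zero_div] at this
        exact this.eventually (gt_mem_nhds hδ)
      have hε3 : ∀ᶠ ε : ℝ in nhdsWithin 0 (Set.Ioi 0), ∀ j,
          0 ≤ α j (y + ε • (y - x)) ∧ 0 ≤ β j (y + ε • (y - x)) := by
        rw [Filter.eventually_all]
        exact fun j => (hnn _ (hy'.2.2 j).1 (hj j).1).and (hnn _ (hy'.2.2 j).2 (hj j).2)
      obtain ⟨ε, ⟨⟨h1, h2⟩, h3⟩, hε0⟩ :=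
        (((hε1.and hε2).and hε3).and self_mem_nhdsWithin).exists
      have hε0' : (0 : ℝ) < ε := hε0
      refine ⟨ε, hε0, (hR _).2 ⟨h1, ?_, h3⟩⟩
      rw [hproj x y ε hx'.1 hy'.1 h1]
      exact prolong_mem_of_le hCconv hy'.2.1 hm
        (div_nonneg (mul_nonneg hε0'.le hx'.1.le) h1.le) h2.le
  have hα : ∀ x ∈ R, ∀ j, α j x / (α j x + β j x) = 0 ↔ α j x = 0 := by
    intro x hx j
    rw [div_eq_zero_iff]
    simp [(hpos x hx j).ne']
  have hβ : ∀ x ∈ R, ∀ j, α j x / (α j x + β j x) = 1 ↔ β j x = 0 := by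
    intro x hx j
    rw [div_eq_one_iff_eq (hpos x hx j).ne']
    constructor <;> intro h <;> linarith
  refine ⟨ι ⊕ Fin n, inferInstance, fun x => Sum.elim (f ((w x)⁻¹ • A x))
    (fun j => α j x / (α j x + β j x)), ?_, ?_, ?_⟩
  · rintro x hx (i | j)
    · exact hf _ ((hR x).1 hx).2.1 i
    · have h1 := ((hR x).1 hx).2.2 j
      have h2 := hpos x hx j
      exact ⟨div_nonneg h1.1 h2.le, (div_le_one h2).2 (by linarith [h1.2])⟩
  · intro x hx y hy
    rw [hprecR x hx y hy, hprec _ ((hR x).1 hx).2.1 _ ((hR y).1 hy).2.1, Sum.forall]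
    refine and_congr Iff.rfl (forall_congr' fun j => ?_)
    simp only [Sum.elim_inr]
    rw [hα x hx, hα y hy, hβ x hx, hβ y hy]
  · intro t ht
    obtain ⟨y, hy, h⟩ := hs (fun i => t (Sum.inl i)) (fun i => ht _)
    obtain ⟨x, hx, hxy, h'⟩ := hsurj y hy (fun j => t (Sum.inr j)) (fun j => ht _)
    refine ⟨x, hx, ?_⟩
    rintro (i | j)
    · simp only [Sum.elim_inl]
      rw [hxy]; exact h i
    · simp only [Sum.elim_inr]
      rw [hα x hx, hβ x hx]; exact h' j

end Cubes

section AffineImage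

variable {E : Type*} [NormedAddCommGroup E] [NormedSpace ℝ E]

/-- An affine bijection preserves cubes. -/
theorem HasCubeCoordinates.image {C : Set E} (hC : HasCubeCoordinates C) (g : E ≃ᵃ[ℝ] E) :
    HasCubeCoordinates (g '' C) := by
  obtain ⟨ι, _, f, hf, hprec, hs⟩ := hC
  have hg : ∀ x y, Prec (g '' C) (g x) (g y) ↔ Prec C x y := by
    intro x y
    have e : ∀ ε : ℝ, g y + ε • (g y - g x) = g (y + ε • (y - x)) := by
      intro ε
      have e : y + ε • (y - x) = (1 + ε) • y + (-ε) • x := by module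
      rw [e, ← AffineEquiv.coe_toAffineMap, Convex.combo_affine_apply (by ring)]
      module
    simp only [Prec, e, g.injective.mem_set_image]
  refine ⟨ι, inferInstance, fun x => f (g.symm x), ?_, ?_, ?_⟩
  · rintro _ ⟨x, hx, rfl⟩ i
    simpa using hf x hx i
  · rintro _ ⟨x, hx, rfl⟩ _ ⟨y, hy, rfl⟩
    simpa [hg] using hprec x hx y hy
  · intro t ht
    obtain ⟨x, hx, h⟩ := hs t ht
    exact ⟨g x, ⟨x, hx, rfl⟩, by simpa using h⟩

end AffineImage

/-! ### Regular subdivisions from minima of affine functions -/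

section Regular

variable {E : Type*} [NormedAddCommGroup E] [NormedSpace ℝ E] {ι : Type*}

/-- The part of `P` on which the affine function `A i` is minimal in the family `A`. -/
def region (P : Set E) (A : ι → E →ᵃ[ℝ] ℝ) (i : ι) : Set E :=
  {x | x ∈ P ∧ ∀ j, A i x ≤ A j x}

/-- All faces of the regions of minimality of a family of affine functions. -/
def regionComplex (P : Set E) (A : ι → E →ᵃ[ℝ] ℝ) : Set (Set E) :=
  {C | ∃ i, IsFace (region P A i) C}

/-- The pointwise minimum of a finite family of affine functions. -/
noncomputable def lowerEnvelope (A : ι → E →ᵃ[ℝ] ℝ) (x : E) : ℝ :=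
  ⨅ i, A i x

variable {P : Set E} {A : ι → E →ᵃ[ℝ] ℝ}

theorem lowerEnvelope_le [Finite ι] (i : ι) (x : E) : lowerEnvelope A x ≤ A i x :=
  ciInf_le (Set.finite_range fun i => A i x).bddBelow i

theorem lowerEnvelope_eq [Finite ι] {i : ι} {x : E} (hx : ∀ j, A i x ≤ A j x) :
    lowerEnvelope A x = A i x :=
  haveI : Nonempty ι := ⟨i⟩
  le_antisymm (lowerEnvelope_le i x) (le_ciInf hx)

theorem exists_lowerEnvelope_eq [Finite ι] [Nonempty ι] (x : E) :
    ∃ i, A i x = lowerEnvelope A x :=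
  exists_eq_ciInf_of_finite

theorem exists_mem_region [Finite ι] [Nonempty ι] {x : E} (hx : x ∈ P) :
    ∃ i, x ∈ region P A i := by
  obtain ⟨i, hi⟩ := exists_lowerEnvelope_eq (A := A) x
  exact ⟨i, hx, fun j => hi ▸ lowerEnvelope_le j x⟩

theorem isExtreme_zero {R : Set E} (a : E →ᵃ[ℝ] ℝ) (h : ∀ x ∈ R, 0 ≤ a x) :
    IsExtreme ℝ R {x | x ∈ R ∧ a x = 0} := by
  refine ⟨fun x hx => hx.1, ?_⟩
  rintro x hx y hy z ⟨-, hz⟩ ⟨s, t, hs, ht, hst, rfl⟩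
  refine ⟨hx, ?_⟩
  rw [combo_apply a x y hst] at hz
  have h1 := h x hx
  have h2 := mul_nonneg ht.le (h y hy)
  have h3 := mul_nonneg hs.le h1
  have h4 : s * a x = 0 := by linarith
  simpa [hs.ne'] using h4

theorem isExtreme_region_inter (i j : ι) :
    IsExtreme ℝ (region P A i) (region P A i ∩ region P A j) := by
  have h := isExtreme_zero (R := region P A i) (A j - A i) (fun x hx => by
    simpa using hx.2 j)
  convert h using 1
  ext x
  constructor
  · rintro ⟨h1, h2⟩
    exact ⟨h1, by simpa [sub_eq_zero] using le_antisymm (h2.2 i) (h1.2 j)⟩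
  · rintro ⟨h1, h2⟩
    have h3 : A j x = A i x := by simpa [sub_eq_zero] using h2
    exact ⟨h1, h1.1, fun k => h3 ▸ h1.2 k⟩

theorem concaveOn_lowerEnvelope [Finite ι] [Nonempty ι] (hP : Convex ℝ P) :
    ConcaveOn ℝ P (lowerEnvelope A) := by
  refine ⟨hP, fun x _ y _ a b ha hb hab => ?_⟩
  refine le_ciInf fun i => ?_
  rw [combo_apply _ _ _ hab]
  have h1 := mul_le_mul_of_nonneg_left (lowerEnvelope_le (A := A) i x) ha
  have h2 := mul_le_mul_of_nonneg_left (lowerEnvelope_le (A := A) i y) hb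
  simpa using add_le_add h1 h2

/-- A convex set on which the minimum of finitely many affine functions is affine lies in a single
region: a point with the fewest active functions exists, and whatever is active there is active
everywhere. -/
theorem exists_subset_region [Finite ι] [Nonempty ι] {D : Set E} (hDP : D ⊆ P)
    (hD : Convex ℝ D) (g : E →ᵃ[ℝ] ℝ) (hg : Set.EqOn (lowerEnvelope A) g D) :
    ∃ i, D ⊆ region P A i := by
  rcases D.eq_empty_or_nonempty with rfl | hne
  · exact ⟨Classical.arbitrary ι, Set.empty_subset _⟩
  let act : E → Set ι := fun x => {i | A i x = lowerEnvelope A x}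
  obtain ⟨m, ⟨x, hx, rfl⟩, hmin⟩ := (Set.toFinite (act '' D)).exists_minimal (hne.image act)
  obtain ⟨i, hi⟩ := exists_lowerEnvelope_eq (A := A) x
  refine ⟨i, fun y hy => ⟨hDP hy, fun j => ?_⟩⟩
  have hz : (1 / 2 : ℝ) • x + (1 / 2 : ℝ) • y ∈ D :=
    hD hx hy (by norm_num) (by norm_num) (by norm_num)
  have hact : ∀ k, k ∈ act ((1 / 2 : ℝ) • x + (1 / 2 : ℝ) • y) → k ∈ act x ∧ k ∈ act y := by
    intro k hk
    have hk' : A k ((1 / 2 : ℝ) • x + (1 / 2 : ℝ) • y) = _ := hk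
    rw [hg hz, combo_apply _ _ _ (by norm_num), combo_apply _ _ _ (by norm_num), ← hg hx,
      ← hg hy] at hk'
    have h1 := lowerEnvelope_le (A := A) k x
    have h2 := lowerEnvelope_le (A := A) k y
    exact ⟨by change A k x = _; linarith, by change A k y = _; linarith⟩
  have h1 := hmin ⟨_, hz, rfl⟩ (fun k hk => (hact k hk).1)
  have h2 : A i y = lowerEnvelope A y := (hact i (h1 hi)).2
  rw [h2]
  exact lowerEnvelope_le j y

variable [FiniteDimensional ℝ E]

theorem isPolytope_region [Finite ι] (hP : IsPolytope P) (i : ι) : IsPolytope (region P A i) := by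
  have := hP.inter_halfspaces (fun j => A j - A i)
  convert this using 1
  ext x
  simp [region]

/-- The regions of minimality of finitely many affine functions form a polytopal subdivision. -/
theorem isSubdivision_regionComplex [Finite ι] [Nonempty ι] (hP : IsPolytope P) :
    IsSubdivision P (regionComplex P A) where
  complex :=
    { finite := by
        have : regionComplex P A = ⋃ i, {C | IsFace (region P A i) C} := by
          ext C; simp [regionComplex]
        rw [this]
        refine Set.finite_iUnion fun i => ?_
        exact (isPolytope_region hP i).finite_extreme.subset
          fun C hC => (isPolytope_region hP i).isFace_iff.1 hC
      isPolytope := fun C ⟨i, hi⟩ => (isPolytope_region hP i).face hi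
      empty_mem := ⟨Classical.arbitrary ι, isExposed_empty⟩
      face_mem := fun C ⟨i, hi⟩ F hF => ⟨i, (isPolytope_region hP i).face_trans hi hF⟩
      inter_face := by
        have key : ∀ C ∈ regionComplex P A, ∀ D ∈ regionComplex P A, IsFace C (C ∩ D) := by
          rintro C ⟨i, hi⟩ D ⟨j, hj⟩
          have hCp := (isPolytope_region hP i).face hi
          have hC := (isPolytope_region hP i).isFace_iff.1 hi
          have hD := (isPolytope_region hP j).isFace_iff.1 hj
          refine hCp.isFace_iff.2 ⟨hC.1.inter hD.1, Set.inter_subset_left, ?_⟩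
          intro x hx y hy z hz hzxy
          refine ⟨hx, ?_⟩
          have hij := isExtreme_region_inter (P := P) (A := A) i j
          have hzij : z ∈ region P A i ∩ region P A j := ⟨hC.2.subset hz.1, hD.2.subset hz.2⟩
          have hx' := hij.left_mem_of_mem_openSegment (hC.2.subset hx) (hC.2.subset hy) hzij hzxy
          have hy' := hij.right_mem_of_mem_openSegment (hC.2.subset hx) (hC.2.subset hy) hzij hzxy
          exact hD.2.left_mem_of_mem_openSegment hx'.2 hy'.2 hz.2 hzxy
        intro C hC D hD
        exact ⟨key C hC D hD, Set.inter_comm D C ▸ key D hD C hC⟩ }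
  support_eq := by
    refine subset_antisymm ?_ ?_
    · rintro x ⟨C, ⟨i, hi⟩, hx⟩
      exact (((isPolytope_region hP i).isFace_iff.1 hi).2.subset hx).1
    · intro x hx
      obtain ⟨i, hi⟩ := exists_mem_region (A := A) hx
      exact ⟨_, ⟨i, IsExposed.refl _⟩, hi⟩

theorem isLiftingFunction_lowerEnvelope [Finite ι] [Nonempty ι] (hP : IsPolytope P) :
    IsLiftingFunction (regionComplex P A) (lowerEnvelope A) := by
  have hsupp := (isSubdivision_regionComplex (A := A) hP).support_eq
  refine ⟨by rw [hsupp]; exact concaveOn_lowerEnvelope hP.convex, fun C => ?_⟩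
  rw [hsupp]
  have hvalid : ∀ i, region P A i ⊆ P ∧ Convex ℝ (region P A i) ∧
      ∃ g : E →ᵃ[ℝ] ℝ, Set.EqOn (lowerEnvelope A) g (region P A i) := fun i =>
    ⟨fun x hx => hx.1, (isPolytope_region hP i).convex, A i, fun x hx => lowerEnvelope_eq hx.2⟩
  have hmem : ∀ i, region P A i ∈ regionComplex P A := fun i => ⟨i, IsExposed.refl _⟩
  have hsub : ∀ D ∈ regionComplex P A, ∃ i, D ⊆ region P A i := fun D ⟨i, hi⟩ =>
    ⟨i, ((isPolytope_region hP i).isFace_iff.1 hi).2.subset⟩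
  constructor
  · rintro ⟨⟨h1, h2, g, hg⟩, hmax⟩
    obtain ⟨i, hi⟩ := exists_subset_region h1 h2 g hg
    have hC : C = region P A i := subset_antisymm hi (hmax (hvalid i) hi)
    refine ⟨hC ▸ hmem i, fun D hD hCD => ?_⟩
    obtain ⟨j, hj⟩ := hsub D hD
    exact hj.trans (hmax (hvalid j) (hCD.trans hj))
  · rintro ⟨h1, hmax⟩
    obtain ⟨i, hi⟩ := hsub C h1
    have hC : C = region P A i := subset_antisymm hi (hmax (hmem i) hi)
    refine ⟨hC ▸ hvalid i, ?_⟩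
    rintro D ⟨h2, h3, g, hg⟩ hCD
    obtain ⟨j, hj⟩ := exists_subset_region h2 h3 g hg
    exact hj.trans (hmax (hmem j) (hCD.trans hj))

end Regular

/-! ### Facets, full cells and dominating affine functions -/

section Boundary

variable {E : Type*} [NormedAddCommGroup E] [NormedSpace ℝ E]

theorem prec_of_mem_interior {P : Set E} {a : E} (ha : a ∈ interior P) (x : E) : Prec P x a := by
  have hc : Continuous (fun ε : ℝ => a + ε • (a - x)) := by fun_prop
  have hl := (hc.tendsto 0).mono_left (nhdsWithin_le_nhds (s := Set.Ioi 0))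
  simp only [zero_smul, add_zero] at hl
  obtain ⟨ε, h, hε⟩ := ((hl.eventually (mem_interior_iff_mem_nhds.1 ha)).and
    self_mem_nhdsWithin).exists
  exact ⟨ε, hε, h⟩

/-- A facet is the zero set of an affine function that is nonnegative on the polytope and positive
in its interior. -/
theorem IsFacet.exists_slack {P Φ : Set E} (hΦ : IsFacet P Φ) (hne : Φ.Nonempty) :
    ∃ τ : E →ᵃ[ℝ] ℝ, (∀ x ∈ P, 0 ≤ τ x) ∧ (∀ x ∈ P, τ x = 0 ↔ x ∈ Φ) ∧
      ∀ x ∈ interior P, 0 < τ x := by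
  obtain ⟨l, hl⟩ := hΦ.1.1 hne
  obtain ⟨x₀, hx₀⟩ := hne
  have hx₀' := hx₀
  rw [hl] at hx₀'
  set τ : E →ᵃ[ℝ] ℝ := AffineMap.const ℝ E (l x₀) - (l : E →ₗ[ℝ] ℝ).toAffineMap with hτ
  have e : ∀ x, τ x = l x₀ - l x := fun x => by simp [hτ]
  have h0 : ∀ x ∈ P, 0 ≤ τ x := fun x hx => by rw [e]; linarith [hx₀'.2 x hx]
  have h1 : ∀ x ∈ P, τ x = 0 ↔ x ∈ Φ := by
    intro x hx
    rw [e, hl]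
    constructor
    · intro h
      exact ⟨hx, fun y hy => by linarith [hx₀'.2 y hy]⟩
    · intro h
      linarith [h.2 x₀ hx₀'.1, hx₀'.2 x hx]
  refine ⟨τ, h0, h1, fun x hx => (h0 x (interior_subset hx)).lt_of_ne' fun hx0 => hΦ.1.2 ?_⟩
  refine subset_antisymm (IsExposed.subset hΦ.1.1) fun y hy => (h1 y hy).1 ?_
  exact (mem_of_isExtreme_of_prec (isExtreme_zero τ h0) hy ⟨interior_subset hx, hx0⟩
    (prec_of_mem_interior hx y)).2

theorem IsFacet.subset_frontier {P Φ : Set E} (hΦ : IsFacet P Φ) : Φ ⊆ frontier P := by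
  intro x hx
  obtain ⟨τ, -, h1, h2⟩ := hΦ.exists_slack ⟨x, hx⟩
  have hxP := IsExposed.subset hΦ.1.1 hx
  refine ⟨subset_closure hxP, fun hi => ?_⟩
  exact (h2 x hi).ne' ((h1 x hxP).2 hx)

/-- A full cell of a collection `S` in a convex set `T`: a member of `S` inside `T` that contains a
neighbourhood, relative to `T`, of one of its points. It is encoded by prolonging the segments from
all points of `T` to this point within the cell. -/
def IsFullCell (S : Set (Set E)) (T F : Set E) : Prop :=
  F ∈ S ∧ F ⊆ T ∧ ∃ y ∈ F, ∀ x ∈ T, Prec F x y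

/-- By the Baire category theorem, if finitely many closed sets cover a convex set, then already
the full ones do. -/
theorem exists_isFullCell [CompleteSpace E] {S : Set (Set E)} {T : Set E} (hS : S.Finite)
    (hclosed : ∀ C ∈ S, IsClosed C) (hT : IsClosed T) (hTc : Convex ℝ T)
    (hgen : ∃ c ∈ T, ∀ x ∈ T, Prec T x c) (hcover : ∀ x ∈ T, ∃ C ∈ S, C ⊆ T ∧ x ∈ C)
    {x : E} (hx : x ∈ T) : ∃ F, IsFullCell S T F ∧ x ∈ F := by
  have : CompleteSpace T := hT.completeSpace_coe
  let J := {C : Set E // C ∈ S ∧ C ⊆ T}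
  have : Finite J := (hS.subset (fun C (h : C ∈ S ∧ C ⊆ T) => h.1)).to_subtype
  let f : J → Set T := fun C => Subtype.val ⁻¹' C.1
  have hfc : ∀ C, IsClosed (f C) := fun C => (hclosed C.1 C.2.1).preimage continuous_subtype_val
  have hU : ⋃ C, f C = Set.univ := by
    refine Set.eq_univ_of_forall fun z => ?_
    obtain ⟨C, hC, hCT, hz⟩ := hcover z.1 z.2
    exact Set.mem_iUnion.2 ⟨⟨C, hC, hCT⟩, hz⟩
  have hd := dense_iUnion_interior_of_closed hfc hU
  have hxc : (⟨x, hx⟩ : T) ∈ closure (⋃ C, interior (f C)) := hd _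
  rw [closure_iUnion_of_finite] at hxc
  obtain ⟨C, hC⟩ := Set.mem_iUnion.1 hxc
  have hxC : x ∈ C.1 := (hfc C).closure_subset_iff.2 interior_subset hC
  obtain ⟨y, hy⟩ := closure_nonempty_iff.1 ⟨_, hC⟩
  obtain ⟨V, hV, hyV⟩ := mem_interior.1 hy
  obtain ⟨U, hUo, rfl⟩ := isOpen_induced_iff.1 hyV.1
  have hUC : ∀ z ∈ T, z ∈ U → z ∈ C.1 := fun z hz hzU => hV (show (⟨z, hz⟩ : T) ∈ _ from hzU)
  obtain ⟨c, hc, hcgen⟩ := hgen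
  -- move from `y` towards a relatively interior point of `T`
  have hc1 : Continuous (fun δ : ℝ => (1 - δ) • y.1 + δ • c) := by fun_prop
  have hl := (hc1.tendsto 0).mono_left (nhdsWithin_le_nhds (s := Set.Ioi 0))
  simp only [sub_zero, one_smul, zero_smul, add_zero] at hl
  obtain ⟨δ, hδU, hδ0, hδ1⟩ := ((hl.eventually (hUo.mem_nhds hyV.2)).and
    (Filter.inter_mem self_mem_nhdsWithin
      (mem_nhdsWithin_of_mem_nhds (Iio_mem_nhds (zero_lt_one' ℝ))))).exists
  have hδ0' : (0 : ℝ) < δ := hδ0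
  have hδ1' : δ < 1 := hδ1
  set y' := (1 - δ) • y.1 + δ • c with hy'
  have hy'T : y' ∈ T := hTc y.2 hc (by linarith) hδ0'.le (by ring)
  have hcy' : Prec T c y' := prec_of_mem_openSegment y.2
    ⟨δ, 1 - δ, hδ0', by linarith, by ring, by rw [hy']; abel⟩
  refine ⟨C.1, ⟨C.2.1, C.2.2, y', hUC _ hy'T hδU, fun z hz => ?_⟩, hxC⟩
  obtain ⟨ε, hε, hm⟩ := (hcgen z hz).trans hTc hcy'
  have hc2 : Continuous (fun η : ℝ => y' + η • (y' - z)) := by fun_prop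
  have hl2 := (hc2.tendsto 0).mono_left (nhdsWithin_le_nhds (s := Set.Ioi 0))
  simp only [zero_smul, add_zero] at hl2
  obtain ⟨η, hηU, hη0, hηε⟩ := ((hl2.eventually (hUo.mem_nhds hδU)).and
    (Filter.inter_mem self_mem_nhdsWithin (mem_nhdsWithin_of_mem_nhds (Iic_mem_nhds hε)))).exists
  exact ⟨η, hη0, hUC _ (prolong_mem_of_le hTc hy'T hm (le_of_lt hη0) hηε) hηU⟩

/-- A concave function lies below the affine function that it agrees with on a full cell. -/
theorem le_of_isFullCell {S : Set (Set E)} {T F : Set E} {ψ : E → ℝ} {g : E →ᵃ[ℝ] ℝ}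
    (hF : IsFullCell S T F) (hψ : ConcaveOn ℝ T ψ) (hg : Set.EqOn ψ g F) {x : E} (hx : x ∈ T) :
    ψ x ≤ g x := by
  obtain ⟨-, hFT, y, hy, hgen⟩ := hF
  obtain ⟨z, hz, s, t, hs, ht, hst, rfl⟩ := prec_iff_openSegment.1 (hgen x hx)
  have h1 := hψ.2 hx (hFT hz) hs.le ht.le hst
  rw [hg hy, hg hz, combo_apply g x z hst] at h1
  simp only [smul_eq_mul] at h1
  have : s * ψ x ≤ s * g x := by linarith
  exact le_of_mul_le_mul_left this hs

variable {P : Set E} {S : Set (Set E)} {ψ : E → ℝ}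

namespace IsLiftedCubicalBoundarySubdivision

theorem exists_mem (hS : IsLiftedCubicalBoundarySubdivision P S ψ) {x : E}
    (hx : x ∈ frontier P) : ∃ C ∈ S, x ∈ C := by
  rw [← hS.subdivision.support_eq] at hx
  obtain ⟨C, hC, h⟩ := hx
  exact ⟨C, hC, h⟩

theorem subset_frontier (hS : IsLiftedCubicalBoundarySubdivision P S ψ) {C : Set E} (hC : C ∈ S) :
    C ⊆ frontier P := by
  rw [← hS.subdivision.support_eq]
  exact Set.subset_sUnion_of_mem hC

theorem subset_polytope (hP : IsFullDimPolytope P)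
    (hS : IsLiftedCubicalBoundarySubdivision P S ψ) {C : Set E} (hC : C ∈ S) : C ⊆ P :=
  (hS.subset_frontier hC).trans hP.isPolytope.isCompact.isClosed.frontier_subset

theorem isPolytope (hS : IsLiftedCubicalBoundarySubdivision P S ψ) {C : Set E} (hC : C ∈ S) :
    IsPolytope C :=
  hS.subdivision.complex.isPolytope C hC

theorem support_restrict (hS : IsLiftedCubicalBoundarySubdivision P S ψ) {Φ : Set E}
    (hΦ : IsFacet P Φ) : support (restrict S Φ) = Φ := by
  ext x
  constructor
  · rintro ⟨_, ⟨C, -, rfl⟩, hx⟩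
    exact hx.2
  · intro hx
    obtain ⟨C, hC, h⟩ := hS.exists_mem (hΦ.subset_frontier hx)
    exact ⟨_, ⟨C, hC, rfl⟩, h, hx⟩

theorem concaveOn (hS : IsLiftedCubicalBoundarySubdivision P S ψ) {Φ : Set E}
    (hΦ : IsFacet P Φ) : ConcaveOn ℝ Φ ψ := by
  have := (hS.lifting Φ hΦ).concaveOn
  rwa [hS.support_restrict hΦ] at this

end IsLiftedCubicalBoundarySubdivision

variable [FiniteDimensional ℝ E]

/-- Every boundary point of a full-dimensional polytope lies in a facet. -/
theorem IsFullDimPolytope.exists_isFacet {P : Set E} (hP : IsFullDimPolytope P) {x : E}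
    (hx : x ∈ frontier P) : ∃ Φ, IsFacet P Φ ∧ x ∈ Φ := by
  have hconv := hP.isPolytope.convex
  have hxP : x ∈ P := hP.isPolytope.isCompact.isClosed.frontier_subset hx
  have hfin : {G : Set E | IsFace P G ∧ G ≠ P}.Finite :=
    hP.isPolytope.finite_extreme.subset fun G hG => hP.isPolytope.isFace_iff.1 hG.1
  have hmin : minFace P x ∈ {G : Set E | IsFace P G ∧ G ≠ P} := by
    refine ⟨hP.isPolytope.isFace_minFace hxP, fun h => ?_⟩
    obtain ⟨a, ha⟩ := hP.interior_nonempty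
    have hax : Prec P a x := by
      have : a ∈ minFace P x := by rw [h]; exact interior_subset ha
      exact this.2
    obtain ⟨z, hz, h1⟩ := prec_iff_openSegment.1 hax
    exact hx.2 (hconv.openSegment_interior_self_subset_interior ha hz h1)
  obtain ⟨Φ, hle, hmax⟩ := hfin.exists_le_maximal hmin
  exact ⟨Φ, hmax, hle (self_mem_minFace hxP)⟩

namespace IsLiftedCubicalBoundarySubdivision

theorem inter_facet_mem (hP : IsFullDimPolytope P)
    (hS : IsLiftedCubicalBoundarySubdivision P S ψ) {Φ C : Set E} (hΦ : IsFacet P Φ)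
    (hC : C ∈ S) : C ∩ Φ ∈ S := by
  refine hS.subdivision.complex.face_mem C hC _ ?_
  have hΦ' := hP.isPolytope.isFace_iff.1 hΦ.1.1
  refine (hS.isPolytope hC).isFace_iff.2 ⟨(hS.isPolytope hC).convex.inter hΦ'.1,
    Set.inter_subset_left, fun x hx y hy z hz h => ⟨hx, ?_⟩⟩
  exact hΦ'.2.left_mem_of_mem_openSegment (hS.subset_polytope hP hC hx)
    (hS.subset_polytope hP hC hy) hz.2 h

/-- A cell lies in every cell that contains one of its relatively interior points. -/
theorem subset_of_generic (hS : IsLiftedCubicalBoundarySubdivision P S ψ) {C F : Set E}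
    (hC : C ∈ S) (hF : F ∈ S) {c : E} (hc : c ∈ C) (hcF : c ∈ F) (hgen : ∀ x ∈ C, Prec C x c) :
    C ⊆ F := by
  have h := ((hS.isPolytope hC).isFace_iff.1 (hS.subdivision.complex.inter_face C hC F hF).1).2
  exact fun x hx => (mem_of_isExtreme_of_prec h hx ⟨hc, hcF⟩ (hgen x hx)).2

theorem exists_fullCell (hP : IsFullDimPolytope P)
    (hS : IsLiftedCubicalBoundarySubdivision P S ψ) {Φ : Set E} (hΦ : IsFacet P Φ) {x : E}
    (hx : x ∈ Φ) : ∃ F, IsFullCell S Φ F ∧ x ∈ F := by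
  have hΦp := hP.isPolytope.face hΦ.1.1
  refine exists_isFullCell hS.subdivision.complex.finite
    (fun C hC => (hS.isPolytope hC).isCompact.isClosed) hΦp.isCompact.isClosed hΦp.convex
    (hΦp.exists_generic ⟨x, hx⟩) (fun z hz => ?_) hx
  obtain ⟨C, hC, h⟩ := hS.exists_mem (hΦ.subset_frontier hz)
  exact ⟨C ∩ Φ, hS.inter_facet_mem hP hΦ hC, Set.inter_subset_right, h, hz⟩

/-- On the facet `Φ` the function `ψ` lies below the affine function it agrees with on a full cell,
with equality exactly on that cell. -/
theorem exists_affine_of_fullCell (hP : IsFullDimPolytope P)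
    (hS : IsLiftedCubicalBoundarySubdivision P S ψ) {Φ F : Set E} (hΦ : IsFacet P Φ)
    (hF : IsFullCell S Φ F) :
    ∃ g : E →ᵃ[ℝ] ℝ, ∀ x ∈ Φ, ψ x ≤ g x ∧ (ψ x = g x ↔ x ∈ F) := by
  have hdom : IsDomainOfLinearity Φ ψ F := by
    have h := (hS.lifting Φ hΦ).domains F
    rw [hS.support_restrict hΦ] at h
    refine h.2 ⟨⟨F, hF.1, (Set.inter_eq_left.2 hF.2.1).symm⟩, ?_⟩
    rintro _ ⟨C, hC, rfl⟩ hFC x hx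
    have hD := hS.inter_facet_mem hP hΦ hC
    have hext := ((hS.isPolytope hD).isFace_iff.1
      (hS.subdivision.complex.inter_face _ hD F hF.1).1).2
    obtain ⟨y, hy, hgen⟩ := hF.2.2
    exact (mem_of_isExtreme_of_prec hext hx ⟨hFC hy, hy⟩ ((hgen x hx.2).mono hFC)).2
  obtain ⟨⟨hFΦ, hFc, g, hg⟩, hmax⟩ := hdom
  have hψ := hS.concaveOn hΦ
  have hle : ∀ x ∈ Φ, ψ x ≤ g x := fun x hx => le_of_isFullCell hF hψ hg hx
  refine ⟨g, fun x hx => ⟨hle x hx, fun h => ?_, fun h => hg h⟩⟩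
  refine hmax (y := {x | x ∈ Φ ∧ ψ x = g x}) ⟨fun z hz => hz.1, ?_, g, fun z hz => hz.2⟩
    (fun z hz => ⟨hFΦ hz, hg hz⟩) ⟨hx, h⟩
  intro p hp q hq s t hs ht hst
  have hm := hψ.1 hp.1 hq.1 hs ht hst
  refine ⟨hm, le_antisymm (hle _ hm) ?_⟩
  have := hψ.2 hp.1 hq.1 hs ht hst
  rwa [hp.2, hq.2, smul_eq_mul, smul_eq_mul, ← combo_apply g p q hst] at this

/-- If `ψ` is affine along a segment in a facet, then both ends lie in a common cell. -/
theorem exists_cell_of_segment (hP : IsFullDimPolytope P)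
    (hS : IsLiftedCubicalBoundarySubdivision P S ψ) {Φ : Set E} (hΦ : IsFacet P Φ) {x z : E}
    (hx : x ∈ Φ) (hz : z ∈ Φ) {s t : ℝ} (hs : 0 < s) (ht : 0 < t) (hst : s + t = 1)
    (h : ψ (s • x + t • z) ≤ s * ψ x + t * ψ z) : ∃ C ∈ S, x ∈ C ∧ z ∈ C := by
  have hΦc := (hP.isPolytope.isFace_iff.1 hΦ.1.1).1
  obtain ⟨F, hF, hyF⟩ := hS.exists_fullCell hP hΦ (hΦc hx hz hs.le ht.le hst)
  obtain ⟨g, hg⟩ := hS.exists_affine_of_fullCell hP hΦ hF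
  have h1 := ((hg _ (hF.2.1 hyF)).2).2 hyF
  rw [h1, combo_apply g x z hst] at h
  have h2 := mul_le_mul_of_nonneg_left (hg x hx).1 hs.le
  have h3 := mul_le_mul_of_nonneg_left (hg z hz).1 ht.le
  have h4 : s * ψ x = s * g x := by linarith
  have h5 : t * ψ z = t * g z := by linarith
  exact ⟨F, hF.1, (hg x hx).2.1 (mul_left_cancel₀ hs.ne' h4),
    (hg z hz).2.1 (mul_left_cancel₀ ht.ne' h5)⟩

theorem exists_fullCell_superset (hP : IsFullDimPolytope P)
    (hS : IsLiftedCubicalBoundarySubdivision P S ψ) {C : Set E} (hC : C ∈ S) (hne : C.Nonempty) :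
    ∃ Φ F, IsFacet P Φ ∧ IsFullCell S Φ F ∧ C ⊆ F := by
  obtain ⟨c, hc, hgen⟩ := (hS.isPolytope hC).exists_generic hne
  obtain ⟨Φ, hΦ, hcΦ⟩ := hP.exists_isFacet (hS.subset_frontier hC hc)
  obtain ⟨F, hF, hcF⟩ := hS.exists_fullCell hP hΦ hcΦ
  exact ⟨Φ, F, hΦ, hF, hS.subset_of_generic hC hF.1 hc hcF hgen⟩

/-- There are finitely many points of the boundary, the vertices of the cells, at which it can be
checked that an affine function dominates `ψ`. -/
theorem exists_vertices (hP : IsFullDimPolytope P)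
    (hS : IsLiftedCubicalBoundarySubdivision P S ψ) :
    ∃ W : Set E, W.Finite ∧ W ⊆ frontier P ∧ ∀ (g : E →ᵃ[ℝ] ℝ) (F : Set E), Convex ℝ F →
      (∀ w ∈ W, ψ w ≤ g w ∧ (ψ w = g w → w ∈ F)) →
      ∀ x ∈ frontier P, ψ x ≤ g x ∧ (ψ x = g x → x ∈ F) := by
  classical
  have hV : ∀ C : Set E, ∃ V : Finset E, C ∈ S → C = convexHull ℝ (V : Set E) := by
    intro C
    by_cases hC : C ∈ S
    · obtain ⟨V, hV⟩ := hS.isPolytope hC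
      exact ⟨V, fun _ => hV⟩
    · exact ⟨∅, fun h => absurd h hC⟩
  choose V hV using hV
  refine ⟨⋃ C ∈ S, (V C : Set E), hS.subdivision.complex.finite.biUnion
    fun C _ => (V C).finite_toSet, ?_, ?_⟩
  · refine Set.iUnion₂_subset fun C hC v hv => hS.subset_frontier hC ?_
    rw [hV C hC]
    exact subset_convexHull ℝ _ hv
  · intro g F hF h x hx
    obtain ⟨C, hC, hxC⟩ := hS.exists_mem hx
    obtain ⟨Φ, F', hΦ, hF', hCF'⟩ := hS.exists_fullCell_superset hP hC ⟨x, hxC⟩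
    obtain ⟨g', hg'⟩ := hS.exists_affine_of_fullCell hP hΦ hF'
    have heq : ∀ y ∈ C, ψ y = g' y := fun y hy => (hg' y (hF'.2.1 (hCF' hy))).2.2 (hCF' hy)
    have hVC : ∀ v ∈ V C, v ∈ C := fun v hv => by
      have := subset_convexHull ℝ (V C : Set E) hv
      rwa [← hV C hC] at this
    have key := nonneg_and_zero_mem_of_convexHull (V := V C) hF (g - g') (fun v hv => by
      have h1 := h v (Set.mem_biUnion hC hv)
      rw [heq v (hVC v hv)] at h1
      refine ⟨by simpa using h1.1, fun h0 => h1.2 ?_⟩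
      have : g v - g' v = 0 := by simpa using h0
      linarith) x (hV C hC ▸ hxC)
    rw [heq x hxC]
    refine ⟨by simpa using key.1, fun h0 => key.2 ?_⟩
    simp [h0]

/-- Raising the value at an interior point `a` far enough makes the affine extension of `ψ` from a
full cell of a facet dominate `ψ` on the whole boundary, strictly outside the cell. -/
theorem eventually_exists_dominating (hP : IsFullDimPolytope P)
    (hS : IsLiftedCubicalBoundarySubdivision P S ψ) {Φ F : Set E} (hΦ : IsFacet P Φ)
    (hF : IsFullCell S Φ F) {a : E} (ha : a ∈ interior P) :
    ∀ᶠ h : ℝ in Filter.atTop, ∃ g : E →ᵃ[ℝ] ℝ, g a = h ∧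
      ∀ x ∈ frontier P, ψ x ≤ g x ∧ (ψ x = g x ↔ x ∈ F) := by
  obtain ⟨W, hWfin, hWf, hW⟩ := hS.exists_vertices hP
  obtain ⟨g₀, hg₀⟩ := hS.exists_affine_of_fullCell hP hΦ hF
  obtain ⟨y, hy, -⟩ := hF.2.2
  obtain ⟨τ, hτ0, hτΦ, hτpos⟩ := hΦ.exists_slack ⟨y, hF.2.1 hy⟩
  have hτa := hτpos a ha
  have hfP := hP.isPolytope.isCompact.isClosed.frontier_subset
  have hev : ∀ᶠ h : ℝ in Filter.atTop, ∀ w ∈ W, 0 < τ w →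
      ψ w < g₀ w + (h - g₀ a) / τ a * τ w := by
    rw [Filter.eventually_all_finite hWfin]
    intro w _
    by_cases hw : 0 < τ w
    · have h1 : Filter.Tendsto (fun h : ℝ => g₀ w + (h - g₀ a) / τ a * τ w) Filter.atTop
          Filter.atTop := by
        refine Filter.tendsto_atTop_add_const_left _ _ (Filter.Tendsto.atTop_mul_const hw ?_)
        refine Filter.Tendsto.atTop_div_const hτa ?_
        exact Filter.tendsto_atTop_add_const_right _ _ Filter.tendsto_id
      filter_upwards [h1.eventually_gt_atTop (ψ w)] with h hh _ using hh
    · exact Filter.Eventually.of_forall fun _ h => absurd h hw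
  filter_upwards [hev] with h hh
  set g : E →ᵃ[ℝ] ℝ := g₀ + ((h - g₀ a) / τ a) • τ with hg
  have hgx : ∀ x, g x = g₀ x + (h - g₀ a) / τ a * τ x := fun x => by simp [hg]
  refine ⟨g, by rw [hgx]; field_simp; ring, fun x hx => ?_⟩
  have key := hW g F (hS.isPolytope hF.1).convex (fun w hw => ?_) x hx
  · refine ⟨key.1, key.2, fun hxF => ?_⟩
    rw [hgx, (hτΦ x (hfP hx)).2 (hF.2.1 hxF), mul_zero, add_zero]
    exact (hg₀ x (hF.2.1 hxF)).2.2 hxF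
  · rcases (hτ0 w (hfP (hWf hw))).eq_or_lt with h0 | h0
    · have hwΦ := (hτΦ w (hfP (hWf hw))).1 h0.symm
      rw [hgx, ← h0, mul_zero, add_zero]
      exact ⟨(hg₀ w hwΦ).1, (hg₀ w hwΦ).2.1⟩
    · have := hh w hw h0
      rw [hgx]
      exact ⟨this.le, fun h1 => absurd h1 this.ne⟩

end IsLiftedCubicalBoundarySubdivision

end Boundary

/-! ### Mirror symmetry -/

section Mirror

variable {E : Type*} [NormedAddCommGroup E] [NormedSpace ℝ E]

/-- The data of a mirror-symmetric lifted boundary subdivision: the affine reflection `σ` in the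
hyperplane `{u = 0}`, a point `m` on that hyperplane, and a vector `e` in the direction of the
reflection with `u`-height `1`, so short that `m + e` and `m - e` are interior points of `P`. -/
structure IsMirror (P : Set E) (S : Set (Set E)) (ψ : E → ℝ) (σ : E ≃ᵃ[ℝ] E) (u : E →ᵃ[ℝ] ℝ)
    (m e : E) : Prop where
  apply_center : u m = 0
  linear_apply : u.linear e = 1
  reflection_apply : ∀ x, σ x = x - (2 * u x) • e
  top_mem : m + e ∈ interior P
  bot_mem : m - e ∈ interior P
  reflection_mem : ∀ x ∈ P, σ x ∈ P
  lift_reflection : ∀ x ∈ frontier P, ψ (σ x) = ψ x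
  inter_mem : ∀ C ∈ S, C ∩ {x | u x = 0} ∈ S
  image_mem : ∀ C ∈ S, σ '' C ∈ S

/-- A full cell of the subdivision that the hyperplane `{u = 0}` cuts out of a facet. -/
def IsMirrorCell (P : Set E) (S : Set (Set E)) (u : E →ᵃ[ℝ] ℝ) (G : Set E) : Prop :=
  ∃ Φ, IsFacet P Φ ∧ IsFullCell S (Φ ∩ {x | u x = 0}) G

/-- A full cell of a facet that lies on the positive side of the hyperplane `{u = 0}`. -/
def IsPlusCell (P : Set E) (S : Set (Set E)) (u : E →ᵃ[ℝ] ℝ) (F : Set E) : Prop :=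
  (∃ Φ, IsFacet P Φ ∧ IsFullCell S Φ F) ∧ (∀ x ∈ F, 0 ≤ u x) ∧ ∃ x ∈ F, 0 < u x

theorem map_add_smul (g : E →ᵃ[ℝ] ℝ) (x v : E) (t : ℝ) :
    g (x + t • v) = g x + t * g.linear v := by
  rw [add_comm x, ← vadd_eq_add, g.map_vadd]
  simp [add_comm]

variable {P : Set E} {S : Set (Set E)} {ψ : E → ℝ} {σ : E ≃ᵃ[ℝ] E} {u : E →ᵃ[ℝ] ℝ} {m e : E}

namespace IsMirror

theorem u_reflection (hM : IsMirror P S ψ σ u m e) (x : E) : u (σ x) = -u x := by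
  rw [hM.reflection_apply, sub_eq_add_neg, ← neg_smul, map_add_smul, hM.linear_apply]
  ring

theorem reflection_reflection (hM : IsMirror P S ψ σ u m e) (x : E) : σ (σ x) = x := by
  rw [hM.reflection_apply (σ x), hM.u_reflection, hM.reflection_apply]
  module

theorem map_reflection (hM : IsMirror P S ψ σ u m e) (g : E →ᵃ[ℝ] ℝ) (x : E) :
    g (σ x) = g x - 2 * u x * g.linear e := by
  rw [hM.reflection_apply, sub_eq_add_neg, ← neg_smul, map_add_smul]
  ring

theorem reflection_eq_self (hM : IsMirror P S ψ σ u m e) {x : E} (hx : u x = 0) : σ x = x := by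
  rw [hM.reflection_apply, hx]; simp

theorem proj_eq (hM : IsMirror P S ψ σ u m e) (x : E) :
    x - u x • e = (1 / 2 : ℝ) • x + (1 / 2 : ℝ) • σ x := by
  rw [hM.reflection_apply]; module

theorem u_proj (hM : IsMirror P S ψ σ u m e) (x : E) : u (x - u x • e) = 0 := by
  rw [sub_eq_add_neg, ← neg_smul, map_add_smul, hM.linear_apply]; ring

theorem proj_mem (hM : IsMirror P S ψ σ u m e) (hP : Convex ℝ P) {x : E} (hx : x ∈ P) :
    x - u x • e ∈ P := by
  rw [hM.proj_eq]
  exact hP hx (hM.reflection_mem x hx) (by norm_num) (by norm_num) (by norm_num)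

theorem center_mem (hM : IsMirror P S ψ σ u m e) (hP : Convex ℝ P) : m ∈ interior P := by
  have := hP.interior hM.top_mem hM.bot_mem (a := 1 / 2) (b := 1 / 2) (by norm_num)
    (by norm_num) (by norm_num)
  convert this using 1
  module

end IsMirror

/-- In terms of the gauge of `P` centred at an interior point `a`, the boundary is the unit
sphere. -/
theorem add_mem_frontier_iff (hP : Convex ℝ P) {a : E} (ha : a ∈ interior P) (v : E) :
    a + v ∈ frontier P ↔ gauge ((fun w => a + w) ⁻¹' P) v = 1 := by
  have hs : (fun w => a + w) ⁻¹' P ∈ nhds (0 : E) := by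
    have hc : Continuous fun w : E => a + w := by fun_prop
    exact (hc.tendsto 0) (by simpa using mem_interior_iff_mem_nhds.1 ha)
  rw [gauge_eq_one_iff_mem_frontier (hP.translate_preimage_right a) hs]
  have := (Homeomorph.addLeft a).preimage_frontier P
  simp only [Homeomorph.coe_addLeft] at this
  rw [← this]
  rfl

/-- A boundary point on the mirror is a limit of boundary points on its positive side: push it off
the mirror and project back to the boundary from the centre. -/
theorem IsMirror.mem_closure_pos (hM : IsMirror P S ψ σ u m e) (hP : Convex ℝ P) {x : E}
    (hx : x ∈ frontier P) (hux : u x = 0) : x ∈ closure {y | y ∈ frontier P ∧ 0 < u y} := by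
  have hm := hM.center_mem hP
  set s := (fun w => m + w) ⁻¹' P with hsdef
  have hs : s ∈ nhds (0 : E) := by
    have hc : Continuous fun w : E => m + w := by fun_prop
    exact (hc.tendsto 0) (by simpa using mem_interior_iff_mem_nhds.1 hm)
  have hsc : Convex ℝ s := hP.translate_preimage_right m
  have hgc : Continuous (gauge s) := continuous_gauge hsc hs
  have hgx : gauge s (x - m) = 1 := by
    rw [← add_mem_frontier_iff hP hm]; simpa using hx
  let v : ℝ → E := fun δ => x - m + δ • e
  have hvc : Continuous v := by fun_prop
  have hg1 : Filter.Tendsto (fun δ => gauge s (v δ)) (nhdsWithin 0 (Set.Ioi 0)) (nhds 1) := by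
    have := ((hgc.comp hvc).tendsto 0).mono_left (nhdsWithin_le_nhds (s := Set.Ioi 0))
    simpa [v, hgx, Function.comp_def] using this
  have hlim : Filter.Tendsto (fun δ => m + (gauge s (v δ))⁻¹ • v δ) (nhdsWithin 0 (Set.Ioi 0))
      (nhds x) := by
    have h1 := (hg1.inv₀ one_ne_zero).smul
      ((hvc.tendsto 0).mono_left (nhdsWithin_le_nhds (s := Set.Ioi 0)))
    have h2 := h1.const_add m
    simpa [v] using h2
  refine mem_closure_of_tendsto hlim ?_
  filter_upwards [hg1.eventually (lt_mem_nhds zero_lt_one), self_mem_nhdsWithin] with δ hδ hδ0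
  have hδ0' : (0 : ℝ) < δ := hδ0
  refine ⟨?_, ?_⟩
  · rw [add_mem_frontier_iff hP hm, gauge_smul_of_nonneg (inv_nonneg.2 hδ.le), smul_eq_mul,
      inv_mul_cancel₀ hδ.ne']
  · have hux' : u.linear (x - m) = 0 := by
      have := u.linearMap_vsub x m
      rw [vsub_eq_sub, vsub_eq_sub, hux, hM.apply_center, sub_zero] at this
      exact this
    rw [map_add_smul, hM.apply_center, zero_add]
    simp only [v, map_add, map_smul, hux', hM.linear_apply, zero_add, smul_eq_mul, mul_one]
    positivity

variable [FiniteDimensional ℝ E]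

namespace IsMirror

theorem reflection_mem_frontier (hM : IsMirror P S ψ σ u m e) (hP : IsPolytope P) {x : E}
    (hx : x ∈ frontier P) : σ x ∈ frontier P := by
  have hcl := hP.isCompact.isClosed
  refine ⟨subset_closure (hM.reflection_mem x (hcl.frontier_subset hx)), fun hi => hx.2 ?_⟩
  have hc : Continuous σ := (σ : E →ᵃ[ℝ] E).continuous_of_finiteDimensional
  refine mem_interior.2 ⟨σ ⁻¹' interior P, fun y hy => ?_, isOpen_interior.preimage hc, hi⟩
  rw [← hM.reflection_reflection y]
  exact hM.reflection_mem _ (interior_subset hy)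

/-- Cells lie on one side of the mirror, since the mirror cuts them in a face. -/
theorem nonneg_of_pos (hM : IsMirror P S ψ σ u m e)
    (hS : IsLiftedCubicalBoundarySubdivision P S ψ) {F : Set E} (hF : F ∈ S) {x y : E}
    (hx : x ∈ F) (hux : 0 < u x) (hy : y ∈ F) : 0 ≤ u y := by
  by_contra hneg
  push Not at hneg
  have hext := ((hS.isPolytope hF).isFace_iff.1
    (hS.subdivision.complex.inter_face F hF _ (hM.inter_mem F hF)).1).2
  have hd : 0 < u x - u y := by linarith
  set s := -u y / (u x - u y) with hs
  set t := u x / (u x - u y) with ht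
  have hs0 : 0 < s := div_pos (by linarith) hd
  have ht0 : 0 < t := div_pos hux hd
  have hst : s + t = 1 := by rw [hs, ht]; field_simp; ring
  have hz : s • x + t • y ∈ F := (hS.isPolytope hF).convex hx hy hs0.le ht0.le hst
  have huz : u (s • x + t • y) = 0 := by
    rw [combo_apply u x y hst, hs, ht]; field_simp; ring
  have := hext.left_mem_of_mem_openSegment hx hy ⟨hz, hz, huz⟩ ⟨s, t, hs0, ht0, hst, rfl⟩
  exact hux.ne' this.2.2

theorem exists_plusCell (hM : IsMirror P S ψ σ u m e) (hP : IsFullDimPolytope P)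
    (hS : IsLiftedCubicalBoundarySubdivision P S ψ) {x : E} (hx : x ∈ frontier P)
    (hux : 0 ≤ u x) : ∃ F, IsPlusCell P S u F ∧ x ∈ F := by
  have hpos : ∀ y, y ∈ frontier P ∧ 0 < u y → ∃ F, IsPlusCell P S u F ∧ y ∈ F := by
    rintro y ⟨hy, huy⟩
    obtain ⟨Φ, hΦ, hyΦ⟩ := hP.exists_isFacet hy
    obtain ⟨F, hF, hyF⟩ := hS.exists_fullCell hP hΦ hyΦ
    exact ⟨F, ⟨⟨Φ, hΦ, hF⟩, fun z hz => hM.nonneg_of_pos hS hF.1 hyF huy hz, y, hyF, huy⟩, hyF⟩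
  rcases hux.eq_or_lt with h0 | h0
  · have hcl : IsClosed (⋃₀ {F | IsPlusCell P S u F}) := by
      have hfin : {F | IsPlusCell P S u F}.Finite :=
        hS.subdivision.complex.finite.subset fun F ⟨⟨_, _, hF⟩, _⟩ => hF.1
      rw [Set.sUnion_eq_biUnion]
      refine hfin.isClosed_biUnion fun F ⟨⟨_, _, hF⟩, _⟩ => ?_
      exact (hS.isPolytope hF.1).isCompact.isClosed
    have hsub : {y | y ∈ frontier P ∧ 0 < u y} ⊆ ⋃₀ {F | IsPlusCell P S u F} := by
      intro y hy
      obtain ⟨F, hF, h⟩ := hpos y hy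
      exact ⟨F, hF, h⟩
    obtain ⟨F, hF, h⟩ := hcl.closure_subset_iff.2 hsub
      (hM.mem_closure_pos hP.isPolytope.convex hx h0.symm)
    exact ⟨F, hF, h⟩
  · exact hpos x ⟨hx, h0⟩

/-- An affine function that dominates `ψ` with equality on a cell of the positive side decreases
in the direction of `e`, as its value at the mirror image of a point of the cell is too large. -/
theorem linear_neg (hM : IsMirror P S ψ σ u m e) (hP : IsPolytope P)
    (hS : IsLiftedCubicalBoundarySubdivision P S ψ) {F : Set E} (hF : IsPlusCell P S u F)
    {g : E →ᵃ[ℝ] ℝ} (hg : ∀ x ∈ frontier P, ψ x ≤ g x ∧ (ψ x = g x ↔ x ∈ F)) :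
    g.linear e < 0 := by
  obtain ⟨⟨Φ, hΦ, hFf⟩, hnn, y, hy, huy⟩ := hF
  have hyf := hS.subset_frontier hFf.1 hy
  have hσy := hM.reflection_mem_frontier hP hyf
  have hσF : σ y ∉ F := fun h => by
    have := hnn _ h
    rw [hM.u_reflection] at this
    linarith
  have hlt : ψ (σ y) < g (σ y) := (hg _ hσy).1.lt_of_ne fun h => hσF ((hg _ hσy).2.1 h)
  rw [hM.lift_reflection y hyf, (hg y hyf).2.2 hy, hM.map_reflection] at hlt
  by_contra hcon
  push Not at hcon
  have := mul_nonneg huy.le hcon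
  linarith

theorem exists_mirrorCell (hM : IsMirror P S ψ σ u m e) (hP : IsFullDimPolytope P)
    (hS : IsLiftedCubicalBoundarySubdivision P S ψ) {x : E} (hx : x ∈ frontier P)
    (hux : u x = 0) : ∃ G, IsMirrorCell P S u G ∧ x ∈ G := by
  obtain ⟨Φ, hΦ, hxΦ⟩ := hP.exists_isFacet hx
  have hΦp := hP.isPolytope.face hΦ.1.1
  have hT : IsPolytope (Φ ∩ {x | u x = 0}) := by
    have := hΦp.inter_halfspaces (ι := Bool) (fun b => if b then u else -u)
    convert this using 1
    ext z
    simp only [Set.mem_inter_iff, Set.mem_ofPred_eq, Bool.forall_bool]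
    refine and_congr Iff.rfl ⟨fun h => by simp [h], fun h => ?_⟩
    exact le_antisymm (by simpa using h.1) (by simpa using h.2)
  obtain ⟨G, hG, hxG⟩ := exists_isFullCell hS.subdivision.complex.finite
    (fun C hC => (hS.isPolytope hC).isCompact.isClosed) hT.isCompact.isClosed hT.convex
    (hT.exists_generic ⟨x, hxΦ, hux⟩) (fun z hz => by
      obtain ⟨C, hC, h⟩ := hS.exists_mem (hΦ.subset_frontier hz.1)
      exact ⟨C ∩ Φ ∩ {x | u x = 0}, hM.inter_mem _ (hS.inter_facet_mem hP hΦ hC),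
        fun y hy => ⟨hy.1.2, hy.2⟩, ⟨h, hz.1⟩, hz.2⟩) (show x ∈ Φ ∩ {x | u x = 0} from ⟨hxΦ, hux⟩)
  exact ⟨G, ⟨Φ, hΦ, hG⟩, hxG⟩

/-- On the intersection of a facet with the mirror, `ψ` lies below the affine function it agrees
with on a full cell, with equality exactly on that cell. -/
theorem exists_affine_of_mirrorCell (hM : IsMirror P S ψ σ u m e) (hP : IsFullDimPolytope P)
    (hS : IsLiftedCubicalBoundarySubdivision P S ψ) {Φ G : Set E} (hΦ : IsFacet P Φ)
    (hG : IsFullCell S (Φ ∩ {x | u x = 0}) G) :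
    ∃ g : E →ᵃ[ℝ] ℝ, ∀ x ∈ Φ, u x = 0 → ψ x ≤ g x ∧ (ψ x = g x ↔ x ∈ G) := by
  obtain ⟨y, hy, hgen⟩ := hG.2.2
  obtain ⟨F, hF, hyF⟩ := hS.exists_fullCell hP hΦ (hG.2.1 hy).1
  have hGF : G ⊆ F := hS.subset_of_generic hG.1 hF.1 hy hyF fun x hx => hgen x (hG.2.1 hx)
  obtain ⟨g, hg⟩ := hS.exists_affine_of_fullCell hP hΦ hF
  refine ⟨g, fun x hx hux => ⟨(hg x hx).1, fun h => ?_, fun h => (hg x hx).2.2 (hGF h)⟩⟩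
  obtain ⟨z, hz, s, t, hs, ht, hst, hxyz⟩ := prec_iff_openSegment.1 (hgen x ⟨hx, hux⟩)
  have hzΦ := (hG.2.1 hz).1
  obtain ⟨C, hC, hxC, hzC⟩ := hS.exists_cell_of_segment hP hΦ hx hzΦ hs ht hst (by
    rw [hxyz, h, (hg z hzΦ).2.2 (hGF hz), (hg y (hG.2.1 hy).1).2.2 hyF, ← combo_apply g x z hst,
      hxyz])
  have hD := hM.inter_mem C hC
  have hext := ((hS.isPolytope hD).isFace_iff.1
    (hS.subdivision.complex.inter_face _ hD G hG.1).1).2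
  have hyD : y ∈ C ∩ {x | u x = 0} := by
    rw [← hxyz]
    exact (hS.isPolytope hD).convex ⟨hxC, hux⟩ ⟨hzC, (hG.2.1 hz).2⟩ hs.le ht.le hst
  exact (hext.left_mem_of_mem_openSegment ⟨hxC, hux⟩ ⟨hzC, (hG.2.1 hz).2⟩ ⟨hyD, hy⟩
    ⟨s, t, hs, ht, hst, hxyz⟩).2

/-- Raising the value at the centre far enough makes the mirror-symmetric affine extension of `ψ`
from a mirror cell dominate `ψ` on the whole boundary, strictly outside the cell. On a facet
perpendicular to the mirror this is due to the concavity and the symmetry of `ψ`. -/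
theorem eventually_exists_dominating (hM : IsMirror P S ψ σ u m e) (hP : IsFullDimPolytope P)
    (hS : IsLiftedCubicalBoundarySubdivision P S ψ) {G : Set E} (hG : IsMirrorCell P S u G) :
    ∀ᶠ h : ℝ in Filter.atTop, ∃ k : E →ᵃ[ℝ] ℝ, k m = h ∧ k.linear e = 0 ∧
      ∀ x ∈ frontier P, ψ x ≤ k x ∧ (ψ x = k x ↔ x ∈ G) := by
  obtain ⟨Φ, hΦ, hG⟩ := hG
  obtain ⟨W, hWfin, hWf, hW⟩ := hS.exists_vertices hP
  obtain ⟨g₀, hg₀⟩ := hM.exists_affine_of_mirrorCell hP hS hΦ hG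
  obtain ⟨y, hy, -⟩ := hG.2.2
  obtain ⟨τ, hτ0, hτΦ, hτpos⟩ := hΦ.exists_slack ⟨y, (hG.2.1 hy).1⟩
  have hτm := hτpos m (hM.center_mem hP.isPolytope.convex)
  have hfP := hP.isPolytope.isCompact.isClosed.frontier_subset
  let p : E →ᵃ[ℝ] E := AffineMap.id ℝ E - (LinearMap.toSpanSingleton ℝ E e).toAffineMap.comp u
  have hp : ∀ x, p x = x - u x • e := fun x => by simp [p]
  have hpP : ∀ x ∈ P, p x ∈ P := fun x hx => by rw [hp]; exact hM.proj_mem hP.isPolytope.convex hx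
  have hpu : ∀ x, u (p x) = 0 := fun x => by rw [hp]; exact hM.u_proj x
  have hpid : ∀ x, u x = 0 → p x = x := fun x hx => by rw [hp, hx]; simp
  have hple : p.linear e = 0 := by
    have h1 := p.linearMap_vsub (m + e) m
    have h2 : u (m + e) = 1 := by
      have := map_add_smul u m e 1
      rwa [one_smul, hM.apply_center, hM.linear_apply, zero_add, one_mul] at this
    rw [vsub_eq_sub, vsub_eq_sub, add_sub_cancel_left, hp, hp, h2, hM.apply_center] at h1
    rw [h1]; simp
  have hev : ∀ᶠ h : ℝ in Filter.atTop, ∀ w ∈ W, 0 < τ (p w) →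
      ψ w < g₀ (p w) + (h - g₀ m) / τ m * τ (p w) := by
    rw [Filter.eventually_all_finite hWfin]
    intro w _
    by_cases hw : 0 < τ (p w)
    · have h1 : Filter.Tendsto (fun h : ℝ => g₀ (p w) + (h - g₀ m) / τ m * τ (p w)) Filter.atTop
          Filter.atTop := by
        refine Filter.tendsto_atTop_add_const_left _ _ (Filter.Tendsto.atTop_mul_const hw ?_)
        refine Filter.Tendsto.atTop_div_const hτm ?_
        exact Filter.tendsto_atTop_add_const_right _ _ Filter.tendsto_id
      filter_upwards [h1.eventually_gt_atTop (ψ w)] with h hh _ using hh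
    · exact Filter.Eventually.of_forall fun _ h => absurd h hw
  filter_upwards [hev] with h hh
  set k : E →ᵃ[ℝ] ℝ := (g₀ + ((h - g₀ m) / τ m) • τ).comp p with hk
  have hkx : ∀ x, k x = g₀ (p x) + (h - g₀ m) / τ m * τ (p x) := fun x => by simp [hk]
  refine ⟨k, by rw [hkx, hpid m hM.apply_center]; field_simp; ring, by
    rw [hk, AffineMap.comp_linear, LinearMap.comp_apply, hple, map_zero], fun x hx => ?_⟩
  have key := hW k G (hS.isPolytope hG.1).convex (fun w hw => ?_) x hx
  · refine ⟨key.1, key.2, fun hxG => ?_⟩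
    have hxT := hG.2.1 hxG
    rw [hkx, hpid x hxT.2, (hτΦ x (hfP hx)).2 hxT.1, mul_zero, add_zero]
    exact (hg₀ x hxT.1 hxT.2).2.2 hxG
  · have hwP := hfP (hWf hw)
    rcases (hτ0 (p w) (hpP w hwP)).eq_or_lt with h0 | h0
    · -- the projection of `w` lies in the facet, hence so do `w` and its mirror image
      have hpΦ := (hτΦ _ (hpP w hwP)).1 h0.symm
      have hΦ' := hP.isPolytope.isFace_iff.1 hΦ.1.1
      have hpw : p w = (1 / 2 : ℝ) • w + (1 / 2 : ℝ) • σ w := by rw [hp]; exact hM.proj_eq w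
      have hmid : p w ∈ openSegment ℝ w (σ w) :=
        ⟨1 / 2, 1 / 2, by norm_num, by norm_num, by norm_num, hpw.symm⟩
      have hσP := hM.reflection_mem w hwP
      have hwΦ := hΦ'.2.left_mem_of_mem_openSegment hwP hσP hpΦ hmid
      have hσΦ := hΦ'.2.right_mem_of_mem_openSegment hwP hσP hpΦ hmid
      have h1 := (hS.concaveOn hΦ).2 hwΦ hσΦ (show (0 : ℝ) ≤ 1 / 2 by norm_num)
        (show (0 : ℝ) ≤ 1 / 2 by norm_num) (by norm_num)
      rw [← hpw, hM.lift_reflection w (hWf hw)] at h1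
      simp only [smul_eq_mul] at h1
      have h2 := hg₀ (p w) hpΦ (hpu w)
      rw [hkx, ← h0, mul_zero, add_zero]
      refine ⟨by linarith [h2.1], fun heq => ?_⟩
      have h3 : ψ (p w) = g₀ (p w) := le_antisymm h2.1 (by linarith)
      obtain ⟨C, hC, hwC, hσC⟩ := hS.exists_cell_of_segment hP hΦ hwΦ hσΦ (s := 1 / 2)
        (t := 1 / 2) (by norm_num) (by norm_num) (by norm_num) (by
          rw [← hpw, hM.lift_reflection w (hWf hw)]; linarith)
      have huw : u w = 0 := by
        rcases lt_trichotomy (u w) 0 with hn | hz | hn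
        · have := hM.nonneg_of_pos hS hC hσC (by rw [hM.u_reflection]; linarith) hwC
          linarith
        · exact hz
        · have := hM.nonneg_of_pos hS hC hwC hn hσC
          rw [hM.u_reflection] at this
          linarith
      rw [hpid w huw] at h3
      exact (hg₀ w hwΦ huw).2.1 h3
    · have := hh w hw h0
      rw [hkx]
      exact ⟨this.le, fun h1 => absurd h1 this.ne⟩

/-- A common height `h` at which all the dominating affine functions exist. -/
theorem exists_height (hM : IsMirror P S ψ σ u m e) (hP : IsFullDimPolytope P)
    (hS : IsLiftedCubicalBoundarySubdivision P S ψ) :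
    ∃ h : ℝ,
      (∀ F, IsPlusCell P S u F → ∃ g : E →ᵃ[ℝ] ℝ, g (m + e) = h ∧
        ∀ x ∈ frontier P, ψ x ≤ g x ∧ (ψ x = g x ↔ x ∈ F)) ∧
      (∀ F, IsPlusCell P S u F → ∃ g : E →ᵃ[ℝ] ℝ, g (m - e) = h ∧
        ∀ x ∈ frontier P, ψ x ≤ g x ∧ (ψ x = g x ↔ x ∈ F)) ∧
      ∀ G, IsMirrorCell P S u G → ∃ k : E →ᵃ[ℝ] ℝ, k m = h ∧ k.linear e = 0 ∧
        ∀ x ∈ frontier P, ψ x ≤ k x ∧ (ψ x = k x ↔ x ∈ G) := by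
  have hfin := hS.subdivision.complex.finite
  have hF : {F | IsPlusCell P S u F}.Finite := hfin.subset fun F ⟨⟨_, _, hF⟩, _⟩ => hF.1
  have hG : {G | IsMirrorCell P S u G}.Finite := hfin.subset fun G ⟨_, _, hG⟩ => hG.1
  refine Filter.Eventually.exists (f := Filter.atTop) (Filter.Eventually.and ?_
    (Filter.Eventually.and ?_ ?_))
  · exact (Filter.eventually_all_finite hF).2 fun F ⟨⟨Φ, hΦ, hF⟩, _⟩ =>
      hS.eventually_exists_dominating hP hΦ hF hM.top_mem
  · exact (Filter.eventually_all_finite hF).2 fun F ⟨⟨Φ, hΦ, hF⟩, _⟩ =>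
      hS.eventually_exists_dominating hP hΦ hF hM.bot_mem
  · exact (Filter.eventually_all_finite hG).2 fun G hG =>
      hM.eventually_exists_dominating hP hS hG

end IsMirror

end Mirror

/-! ### Charts of the positive half -/

section Charts

variable {E : Type*} [NormedAddCommGroup E] [NormedSpace ℝ E]

/-- The point with coordinates `a`, `b` in the plane through `m` spanned by `y - m` and `e`. -/
def planePoint (m e : E) (a b : ℝ) (y : E) : E :=
  m + a • (y - m) + b • e

theorem apply_planePoint (g : E →ᵃ[ℝ] ℝ) (m e : E) (a b : ℝ) (y : E) :
    g (planePoint m e a b y) = a * g y + (1 - a) * g m + b * g.linear e := by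
  rw [planePoint, map_add_smul]
  have : m + a • (y - m) = a • y + (1 - a) • m := by module
  rw [this, combo_apply g y m (by ring)]

/-- A presentation of a point `x` on the positive side of the mirror by a boundary point `y` and
coordinates `(a, b)`. The three alternatives in `kind` are the collar along the boundary, which is
a cone with apex `m + e`; the core, which is a cone with apex `m - (1/2) e`; and the square
`|a - 3/4| + |b| ≤ 1/4` over the boundary of the mirror. -/
structure IsChart (P : Set E) (u : E →ᵃ[ℝ] ℝ) (m e x : E) (a b : ℝ) (y : E) : Prop where
  mem_frontier : y ∈ frontier P
  pos : 0 < a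
  le_one : a ≤ 1
  eq : x = planePoint m e a b y
  nonneg : 0 ≤ u x
  collar_le : a + b ≤ 1
  core_le : b ≤ a - 1 / 2
  kind : (a + b = 1 ∧ 0 ≤ u y) ∨ (b = a - 1 / 2 ∧ 0 ≤ u y) ∨ u y = 0

/-- A ray from an interior point leaves a bounded convex set at a boundary point. -/
theorem exists_exit {P : Set E} (hP : Convex ℝ P) (hb : Bornology.IsBounded P) {a : E}
    (ha : a ∈ interior P) {v : E} (hv : v ≠ 0) :
    ∃ c : ℝ, 0 < c ∧ a + c • v ∈ frontier P ∧ ∀ t : ℝ, 0 ≤ t → a + t • v ∈ P → t ≤ c := by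
  set s := (fun w => a + w) ⁻¹' P with hs
  have hs0 : s ∈ nhds (0 : E) := by
    have hc : Continuous fun w : E => a + w := by fun_prop
    exact (hc.tendsto 0) (by simpa using mem_interior_iff_mem_nhds.1 ha)
  have hsb : Bornology.IsBounded s := by
    obtain ⟨r, hr⟩ := hb.subset_closedBall a
    refine (Metric.isBounded_closedBall (x := (0 : E)) (r := r)).subset fun w hw => ?_
    have := hr hw
    simpa [dist_eq_norm] using this
  have hg : 0 < gauge s v :=
    (gauge_pos (absorbent_nhds_zero hs0)
      ((NormedSpace.isVonNBounded_iff ℝ).2 hsb)).2 hv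
  refine ⟨(gauge s v)⁻¹, inv_pos.2 hg, ?_, fun t ht h => ?_⟩
  · rw [add_mem_frontier_iff hP ha, gauge_smul_of_nonneg (inv_nonneg.2 hg.le), smul_eq_mul,
      inv_mul_cancel₀ hg.ne']
  · have h1 : gauge s (t • v) ≤ 1 := gauge_le_one_of_mem h
    rw [gauge_smul_of_nonneg ht, smul_eq_mul] at h1
    rwa [← one_div, le_div_iff₀ hg]

variable {P : Set E} {S : Set (Set E)} {ψ : E → ℝ} {σ : E ≃ᵃ[ℝ] E} {u : E →ᵃ[ℝ] ℝ} {m e : E}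

theorem mem_ray_of_le (hP : Convex ℝ P) {a v : E} {s t : ℝ} (ha : a ∈ P) (h : a + t • v ∈ P)
    (hs : 0 ≤ s) (hst : s ≤ t) : a + s • v ∈ P := by
  rcases hs.eq_or_lt with rfl | hs
  · simpa using ha
  have ht : 0 < t := hs.trans_le hst
  have := hP ha h (a := 1 - s / t) (b := s / t) (sub_nonneg.2 ((div_le_one ht).2 hst))
    (by positivity) (by ring)
  convert this using 1
  rw [smul_add, smul_smul, div_mul_cancel₀ _ ht.ne']
  module

namespace IsMirror

theorem u_planePoint (hM : IsMirror P S ψ σ u m e) (a b : ℝ) (y : E) :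
    u (planePoint m e a b y) = a * u y + b := by
  rw [apply_planePoint, hM.apply_center, hM.linear_apply]; ring

theorem reflection_planePoint (hM : IsMirror P S ψ σ u m e) (a b : ℝ) (y : E) :
    σ (planePoint m e a b y) = planePoint m e a (-b) (σ y) := by
  rw [hM.reflection_apply, hM.u_planePoint, hM.reflection_apply, planePoint, planePoint]
  module

/-- A point lies in the core as soon as the ray from `m - (1/2) e`, translated to `m - e` and
scaled by at least `4 / 3`, is still in the positive half of `P`. -/
theorem exists_core_chart (hM : IsMirror P S ψ σ u m e) (hP : Convex ℝ P)
    (hb : Bornology.IsBounded P) {x : E} (hux : 0 ≤ u x) {c : ℝ} (hc : 4 / 3 ≤ c)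
    (hz : m - e + c • (x - m + (1 / 2 : ℝ) • e) ∈ P) (huz : 1 ≤ c * (u x + 1 / 2)) :
    ∃ a b y, IsChart P u m e x a b y := by
  have hul : ∀ t : ℝ, u (m - e + t • (x - m + (1 / 2 : ℝ) • e)) = -1 + t * (u x + 1 / 2) := by
    intro t
    have h1 : u.linear (x - m) = u x := by
      have := u.linearMap_vsub x m
      rw [vsub_eq_sub, vsub_eq_sub, hM.apply_center, sub_zero] at this
      exact this
    have h2 : u (m - e) = -1 := by
      have := map_add_smul u m e (-1)
      rw [hM.apply_center, hM.linear_apply] at this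
      simpa [sub_eq_add_neg] using this
    rw [map_add_smul, map_add, map_smul, h1, h2, hM.linear_apply]
    simp
  have hv : x - m + (1 / 2 : ℝ) • e ≠ 0 := by
    intro h0
    have := hul 1
    rw [h0, smul_zero, add_zero] at this
    have h2 := hul 0
    rw [zero_smul, add_zero] at h2
    linarith
  obtain ⟨d, hd, hy, hmax⟩ := exists_exit hP hb hM.bot_mem hv
  have hcd : c ≤ d := hmax c (by linarith) hz
  have ha : d⁻¹ ≤ 3 / 4 := by
    rw [inv_le_comm₀ hd (by norm_num)]
    linarith
  refine ⟨d⁻¹, d⁻¹ - 1 / 2, _, hy, inv_pos.2 hd, by linarith, ?_, hux, by linarith, le_rfl,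
    Or.inr (Or.inl ⟨rfl, ?_⟩)⟩
  · rw [planePoint, show m - e + d • (x - m + (1 / 2 : ℝ) • e) - m
      = d • (x - m + (1 / 2 : ℝ) • e) - e by abel, smul_sub, smul_smul, inv_mul_cancel₀ hd.ne']
    module
  · rw [hul]
    have := mul_le_mul_of_nonneg_right hcd (show 0 ≤ u x + 1 / 2 by linarith)
    linarith

/-- Every point of `P` on the positive side of the mirror has a chart. -/
theorem exists_chart (hM : IsMirror P S ψ σ u m e) (hP : Convex ℝ P)
    (hb : Bornology.IsBounded P) (hcl : IsClosed P) {x : E} (hx : x ∈ P) (hux : 0 ≤ u x) :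
    ∃ a b y, IsChart P u m e x a b y := by
  have hm := hM.center_mem hP
  have htop := interior_subset hM.top_mem
  have hutop : u (m + e) = 1 := by
    have := map_add_smul u m e 1
    rwa [one_smul, hM.apply_center, hM.linear_apply, zero_add, one_mul] at this
  -- the point of the ray from `m + e` through `x` at parameter `4 / 3` is a witness for the core
  have hcore : m + e + (4 / 3 : ℝ) • (x - (m + e)) ∈ P → 1 / 4 ≤ u x →
      ∃ a b y, IsChart P u m e x a b y := by
    intro hz huz
    refine hM.exists_core_chart hP hb hux (c := 4 / 3) le_rfl ?_ (by linarith)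
    convert hz using 1
    module
  by_cases hxt : x - (m + e) = 0
  · have hxe : x = m + e := sub_eq_zero.1 hxt
    refine hcore (by rw [hxt, smul_zero, add_zero]; exact htop) ?_
    rw [hxe, hutop]; norm_num
  have hul : u.linear (x - (m + e)) = u x - 1 := by
    have := u.linearMap_vsub x (m + e)
    rwa [vsub_eq_sub, vsub_eq_sub, hutop] at this
  obtain ⟨c, hc, hy, hmax⟩ := exists_exit hP hb hM.top_mem hxt
  have hc1 : 1 ≤ c := hmax 1 zero_le_one (by simpa using hx)
  have huy : u (m + e + c • (x - (m + e))) = 1 + c * (u x - 1) := by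
    rw [map_add_smul, hutop, hul]
  have hyP : m + e + c • (x - (m + e)) ∈ P := hcl.frontier_subset hy
  by_cases huy0 : 0 ≤ 1 + c * (u x - 1)
  · rcases le_total c (4 / 3) with h43 | h43
    · have ha : c⁻¹ ≤ 1 := inv_le_one_of_one_le₀ hc1
      have ha' : 3 / 4 ≤ c⁻¹ := by
        rw [le_inv_comm₀ (by norm_num) hc]
        linarith
      refine ⟨c⁻¹, 1 - c⁻¹, _, hy, inv_pos.2 hc, ha, ?_, hux, by linarith, by linarith,
        Or.inl ⟨by ring, huy ▸ huy0⟩⟩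
      rw [planePoint, show m + e + c • (x - (m + e)) - m = c • (x - (m + e)) + e by abel,
        smul_add, smul_smul, inv_mul_cancel₀ hc.ne']
      module
    · refine hcore (mem_ray_of_le hP htop hyP (by norm_num) h43) ?_
      by_contra hlt
      push Not at hlt
      nlinarith
  push Not at huy0
  have hu1 : u x < 1 := by
    by_contra h
    push Not at h
    nlinarith
  have h1u : 0 < 1 - u x := by linarith
  -- the ray from `m + e` through `x` meets the mirror inside `P`
  have hs : m + e + (1 - u x)⁻¹ • (x - (m + e)) ∈ P := by
    refine mem_ray_of_le hP htop hyP (inv_nonneg.2 h1u.le) ?_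
    rw [inv_le_iff_one_le_mul₀ h1u]
    linarith
  set q := x - u x • e with hq
  have hsq : m + e + (1 - u x)⁻¹ • (x - (m + e)) = m + (1 - u x)⁻¹ • (q - m) := by
    have h1 : x - (m + e) = (q - m) - (1 - u x) • e := by rw [hq]; module
    rw [h1, smul_sub, smul_smul, inv_mul_cancel₀ h1u.ne']
    module
  rcases le_total (1 / 4) (u x) with h14 | h14
  · refine hcore ?_ h14
    have := hP hs htop (a := 4 / 3 * (1 - u x)) (b := (4 * u x - 1) / 3) (by positivity)
      (by linarith) (by ring)
    convert this using 1
    rw [smul_add (4 / 3 * (1 - u x)), smul_smul (4 / 3 * (1 - u x)),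
      mul_assoc, mul_inv_cancel₀ h1u.ne']
    module
  have hcore2 : m + (u x + 1 / 2)⁻¹ • (q - m) ∈ P → ∃ a b y, IsChart P u m e x a b y := by
    intro h
    have h2 : 0 < u x + 1 / 2 := by linarith
    refine hM.exists_core_chart hP hb hux (c := (u x + 1 / 2)⁻¹) ?_ ?_ ?_
    · rw [le_inv_comm₀ (by norm_num) h2]
      linarith
    · convert h using 1
      have h1 : x - m + (1 / 2 : ℝ) • e = (q - m) + (u x + 1 / 2) • e := by rw [hq]; module
      rw [h1, smul_add, smul_smul, inv_mul_cancel₀ h2.ne']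
      module
    · rw [inv_mul_cancel₀ h2.ne']
  by_cases hqm : q - m = 0
  · refine hcore2 ?_
    rw [hqm, smul_zero, add_zero]
    exact interior_subset hm
  obtain ⟨d, hd, hyd, hmaxd⟩ := exists_exit hP hb hm hqm
  have hd1 : (1 - u x)⁻¹ ≤ d := hmaxd _ (inv_nonneg.2 h1u.le) (hsq ▸ hs)
  have hd2 : d⁻¹ ≤ 1 - u x := by
    rwa [inv_le_comm₀ hd h1u]
  by_cases hb' : u x ≤ d⁻¹ - 1 / 2
  · refine ⟨d⁻¹, u x, _, hyd, inv_pos.2 hd, by linarith, ?_, hux, by linarith, hb',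
      Or.inr (Or.inr ?_)⟩
    · rw [planePoint, add_sub_cancel_left, smul_smul, inv_mul_cancel₀ hd.ne', hq]
      module
    · have h1 : u.linear (q - m) = 0 := by
        have := u.linearMap_vsub q m
        rw [vsub_eq_sub, vsub_eq_sub, hM.apply_center, sub_zero] at this
        rw [this]
        exact hM.u_proj x
      rw [map_add_smul, hM.apply_center, h1]; ring
  · push Not at hb'
    refine hcore2 (mem_ray_of_le hP (interior_subset hm) (hcl.frontier_subset hyd)
      (inv_nonneg.2 (by linarith)) ?_)
    rw [inv_le_comm₀ (by linarith) hd]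
    linarith

end IsMirror

end Charts

/-! ### The affine functions of the cubification -/

section Envelope

variable {E : Type*} [NormedAddCommGroup E] [NormedSpace ℝ E]

/-- The affine functions, all with value `h` at their apex, that dominate `ψ` on the boundary with
equality on one cell: for each cell on the positive side one with apex `m + e` and one with apex
`m - e`, and for each mirror cell one that is constant in the direction of `e`. -/
structure Heights (P : Set E) (S : Set (Set E)) (ψ : E → ℝ) (u : E →ᵃ[ℝ] ℝ) (m e : E) where
  h : ℝ
  top : {F // IsPlusCell P S u F} → E →ᵃ[ℝ] ℝ
  bot : {F // IsPlusCell P S u F} → E →ᵃ[ℝ] ℝ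
  mid : {G // IsMirrorCell P S u G} → E →ᵃ[ℝ] ℝ
  top_apply : ∀ F, top F (m + e) = h
  bot_apply : ∀ F, bot F (m - e) = h
  mid_apply : ∀ G, mid G m = h
  mid_linear : ∀ G, (mid G).linear e = 0
  top_dominates : ∀ F, ∀ x ∈ frontier P, ψ x ≤ top F x ∧ (ψ x = top F x ↔ x ∈ F.1)
  bot_dominates : ∀ F, ∀ x ∈ frontier P, ψ x ≤ bot F x ∧ (ψ x = bot F x ↔ x ∈ F.1)
  mid_dominates : ∀ G, ∀ x ∈ frontier P, ψ x ≤ mid G x ∧ (ψ x = mid G x ↔ x ∈ G.1)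

/-- Index set of the cells of the positive half of the cubification: collar cells, core cells and
squares over mirror cells. -/
abbrev CellIndex (P : Set E) (S : Set (Set E)) (u : E →ᵃ[ℝ] ℝ) : Type _ :=
  {F // IsPlusCell P S u F} ⊕ {F // IsPlusCell P S u F} ⊕ {G // IsMirrorCell P S u G}

variable {P : Set E} {S : Set (Set E)} {ψ : E → ℝ} {σ : E ≃ᵃ[ℝ] E} {u : E →ᵃ[ℝ] ℝ} {m e : E}

/-- The boundary cell from which a cell of the cubification is built. -/
def CellIndex.cell : CellIndex P S u → Set E
  | .inl F => F.1
  | .inr (.inl F) => F.1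
  | .inr (.inr G) => G.1

/-- The equation between the chart coordinates that holds on a cell of the cubification. -/
def CellIndex.Tight (a b : ℝ) : CellIndex P S u → Prop
  | .inl _ => a + b = 1
  | .inr (.inl _) => b = a - 1 / 2
  | .inr (.inr _) => True

namespace Heights

/-- The affine functions whose graphs span the lifted positive half. Those of the core cells have
the value `h` at `m - (1/2) e`. -/
noncomputable def base (D : Heights P S ψ u m e) : CellIndex P S u → E →ᵃ[ℝ] ℝ
  | .inl F => D.top F
  | .inr (.inl F) => D.bot F + AffineMap.const ℝ E (-((D.bot F).linear e) / 2)
  | .inr (.inr G) => D.mid G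

/-- The affine functions of the positive half and their mirror images. -/
noncomputable def family (D : Heights P S ψ u m e) (σ : E ≃ᵃ[ℝ] E) :
    CellIndex P S u × Bool → E →ᵃ[ℝ] ℝ
  | (i, false) => D.base i
  | (i, true) => (D.base i).comp (σ : E →ᵃ[ℝ] E)

theorem family_reflection (D : Heights P S ψ u m e) (hM : IsMirror P S ψ σ u m e)
    (i : CellIndex P S u) (b : Bool) (x : E) :
    D.family σ (i, b) (σ x) = D.family σ (i, !b) x := by
  cases b
  · rfl
  · simp [family, hM.reflection_reflection]

theorem lowerEnvelope_reflection (D : Heights P S ψ u m e) (hM : IsMirror P S ψ σ u m e) (x : E) :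
    lowerEnvelope (D.family σ) (σ x) = lowerEnvelope (D.family σ) x :=
  Equiv.iInf_congr ((Equiv.refl _).prodCongr Equiv.boolNot) fun i =>
    (D.family_reflection hM i.1 i.2 x).symm

theorem mem_region_reflection_iff (D : Heights P S ψ u m e) (hM : IsMirror P S ψ σ u m e)
    (i : CellIndex P S u) (b : Bool) {x : E} :
    σ x ∈ region P (D.family σ) (i, b) ↔ x ∈ region P (D.family σ) (i, !b) := by
  have key : ∀ (b : Bool) (x : E), x ∈ region P (D.family σ) (i, !b) →
      σ x ∈ region P (D.family σ) (i, b) := by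
    rintro b x ⟨hx, h⟩
    refine ⟨hM.reflection_mem x hx, fun ⟨j, c⟩ => ?_⟩
    rw [D.family_reflection hM, D.family_reflection hM]
    exact h _
  refine ⟨fun h => ?_, key b x⟩
  have := key (!b) (σ x) (by simpa using h)
  rwa [hM.reflection_reflection] at this

theorem region_true (D : Heights P S ψ u m e) (hM : IsMirror P S ψ σ u m e)
    (i : CellIndex P S u) :
    region P (D.family σ) (i, true) = σ '' region P (D.family σ) (i, false) := by
  ext x
  constructor
  · intro h
    exact ⟨σ x, (D.mem_region_reflection_iff hM i false).2 h, hM.reflection_reflection x⟩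
  · rintro ⟨y, hy, rfl⟩
    exact (D.mem_region_reflection_iff hM i true).2 hy

/-- A region of a strictly decreasing function lies on the positive side of the mirror. -/
theorem nonneg_of_mem_region (D : Heights P S ψ u m e) (hM : IsMirror P S ψ σ u m e)
    {i : CellIndex P S u} (hi : (D.base i).linear e < 0) {x : E}
    (hx : x ∈ region P (D.family σ) (i, false)) :
    0 ≤ u x := by
  have h := hx.2 (i, true)
  change D.base i x ≤ D.base i (σ x) at h
  rw [hM.map_reflection] at h
  nlinarith

end Heights

theorem weighted_sum_eq_zero_iff {a p q r : ℝ} (ha : 0 < a) (hp : 0 ≤ p) (hq : 0 ≤ q)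
    (hr : 0 < r) : a * p + q * r = 0 ↔ p = 0 ∧ q = 0 := by
  rw [add_eq_zero_iff_of_nonneg (by positivity) (by positivity)]
  simp [ha.ne', hr.ne']

variable [FiniteDimensional ℝ E]

namespace Heights

/-- On a chart point every function of the positive half is at least the chart value
`a ψ(y) + (1 - a) h`, with equality exactly for the cells that contain the point. -/
theorem base_chart (D : Heights P S ψ u m e) (hM : IsMirror P S ψ σ u m e) (hP : IsPolytope P)
    (hS : IsLiftedCubicalBoundarySubdivision P S ψ) {x : E} {a b : ℝ} {y : E}
    (hx : IsChart P u m e x a b y) (i : CellIndex P S u) :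
    a * ψ y + (1 - a) * D.h ≤ D.base i x ∧
      (D.base i x = a * ψ y + (1 - a) * D.h ↔ i.Tight a b ∧ y ∈ i.cell) := by
  have hval : ∀ (v : ℝ) (g : E →ᵃ[ℝ] ℝ) (F : Set E) (q r : ℝ), 0 ≤ q → 0 < r →
      (ψ y ≤ g y ∧ (ψ y = g y ↔ y ∈ F)) → v = a * g y + (1 - a) * D.h + q * r →
      a * ψ y + (1 - a) * D.h ≤ v ∧ (v = a * ψ y + (1 - a) * D.h ↔ q = 0 ∧ y ∈ F) := by
    intro v g F q r hq hr hg hv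
    have h0 := hx.pos
    have h1 : 0 ≤ g y - ψ y := by linarith [hg.1]
    have h2 := weighted_sum_eq_zero_iff h0 h1 hq hr
    have e : v - (a * ψ y + (1 - a) * D.h) = a * (g y - ψ y) + q * r := by rw [hv]; ring
    refine ⟨?_, ?_⟩
    · have : 0 ≤ a * (g y - ψ y) + q * r := by positivity
      linarith
    · rw [← sub_eq_zero, e, h2, and_comm, sub_eq_zero, eq_comm (a := g y), hg.2]
  have hy := hx.mem_frontier
  rcases i with F | F | G
  · have hneg := hM.linear_neg hP hS F.2 (D.top_dominates F)
    have happ := D.top_apply F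
    rw [show m + e = m + (1 : ℝ) • e by simp, map_add_smul] at happ
    have := hval (D.base (.inl F) x) (D.top F) F.1 (1 - (a + b)) (-(D.top F).linear e)
      (by linarith [hx.collar_le]) (by linarith) (D.top_dominates F y hy) (by
        simp only [base]
        rw [hx.eq, apply_planePoint]
        linear_combination (1 - a) * happ)
    refine ⟨this.1, this.2.trans (and_congr ?_ Iff.rfl)⟩
    simp only [CellIndex.Tight]
    constructor <;> intro h <;> linarith
  · have hneg := hM.linear_neg hP hS F.2 (D.bot_dominates F)
    have happ := D.bot_apply F
    rw [show m - e = m + (-1 : ℝ) • e by module, map_add_smul] at happ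
    have := hval (D.base (.inr (.inl F)) x) (D.bot F) F.1 (a - 1 / 2 - b) (-(D.bot F).linear e)
      (by linarith [hx.core_le]) (by linarith) (D.bot_dominates F y hy) (by
        simp only [base, AffineMap.coe_add, Pi.add_apply, AffineMap.const_apply]
        rw [hx.eq, apply_planePoint]
        linear_combination (1 - a) * happ)
    refine ⟨this.1, this.2.trans (and_congr ?_ Iff.rfl)⟩
    simp only [CellIndex.Tight]
    constructor <;> intro h <;> linarith
  · have := hval (D.base (.inr (.inr G)) x) (D.mid G) G.1 0 1 le_rfl one_pos
      (D.mid_dominates G y hy) (by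
        simp only [base]
        rw [hx.eq, apply_planePoint, D.mid_apply, D.mid_linear]
        ring)
    refine ⟨this.1, this.2.trans (and_congr ?_ Iff.rfl)⟩
    simp [CellIndex.Tight]

theorem base_linear_nonpos (D : Heights P S ψ u m e) (hM : IsMirror P S ψ σ u m e)
    (hP : IsPolytope P) (hS : IsLiftedCubicalBoundarySubdivision P S ψ) (i : CellIndex P S u) :
    (D.base i).linear e ≤ 0 := by
  rcases i with F | F | G
  · exact (hM.linear_neg hP hS F.2 (D.top_dominates F)).le
  · simpa [base] using (hM.linear_neg hP hS F.2 (D.bot_dominates F)).le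
  · exact (D.mid_linear G).le

/-- On the positive side the mirror images of the functions exceed the functions themselves. -/
theorem family_chart (D : Heights P S ψ u m e) (hM : IsMirror P S ψ σ u m e) (hP : IsPolytope P)
    (hS : IsLiftedCubicalBoundarySubdivision P S ψ) {x : E} {a b : ℝ} {y : E}
    (hx : IsChart P u m e x a b y) (j : CellIndex P S u × Bool) :
    a * ψ y + (1 - a) * D.h ≤ D.family σ j x := by
  obtain ⟨i, c⟩ := j
  have h1 := (D.base_chart hM hP hS hx i).1
  cases c
  · exact h1
  · change _ ≤ D.base i (σ x)
    rw [hM.map_reflection]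
    have := mul_nonneg hx.nonneg (neg_nonneg.2 (D.base_linear_nonpos hM hP hS i))
    linarith

/-- Every chart point lies in some cell of the positive half. -/
theorem exists_base_chart (D : Heights P S ψ u m e) (hM : IsMirror P S ψ σ u m e)
    (hP : IsFullDimPolytope P) (hS : IsLiftedCubicalBoundarySubdivision P S ψ) {x : E} {a b : ℝ}
    {y : E} (hx : IsChart P u m e x a b y) :
    ∃ i : CellIndex P S u, D.base i x = a * ψ y + (1 - a) * D.h := by
  have hy := hx.mem_frontier
  rcases hx.kind with ⟨hab, huy⟩ | ⟨hab, huy⟩ | huy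
  · obtain ⟨F, hF, hyF⟩ := hM.exists_plusCell hP hS hy huy
    exact ⟨.inl ⟨F, hF⟩, (D.base_chart hM hP.isPolytope hS hx _).2.2 ⟨hab, hyF⟩⟩
  · obtain ⟨F, hF, hyF⟩ := hM.exists_plusCell hP hS hy huy
    exact ⟨.inr (.inl ⟨F, hF⟩), (D.base_chart hM hP.isPolytope hS hx _).2.2 ⟨hab, hyF⟩⟩
  · obtain ⟨G, hG, hyG⟩ := hM.exists_mirrorCell hP hS hy huy
    exact ⟨.inr (.inr ⟨G, hG⟩), (D.base_chart hM hP.isPolytope hS hx _).2.2 ⟨trivial, hyG⟩⟩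

theorem mem_region_iff_of_chart (D : Heights P S ψ u m e) (hM : IsMirror P S ψ σ u m e)
    (hP : IsFullDimPolytope P) (hS : IsLiftedCubicalBoundarySubdivision P S ψ) {x : E} {a b : ℝ}
    {y : E} (hx : IsChart P u m e x a b y) (hxP : x ∈ P) (i : CellIndex P S u) :
    x ∈ region P (D.family σ) (i, false) ↔ i.Tight a b ∧ y ∈ i.cell := by
  rw [← (D.base_chart hM hP.isPolytope hS hx i).2]
  constructor
  · intro h
    obtain ⟨j, hj⟩ := D.exists_base_chart hM hP hS hx
    exact le_antisymm (hj ▸ h.2 (j, false)) (D.base_chart hM hP.isPolytope hS hx i).1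
  · intro h
    refine ⟨hxP, fun j => ?_⟩
    change D.base i x ≤ _
    rw [h]
    exact D.family_chart hM hP.isPolytope hS hx j

theorem lowerEnvelope_chart (D : Heights P S ψ u m e) (hM : IsMirror P S ψ σ u m e)
    (hP : IsFullDimPolytope P) (hS : IsLiftedCubicalBoundarySubdivision P S ψ)
    [Finite (CellIndex P S u)] {x : E} {a b : ℝ}
    {y : E} (hx : IsChart P u m e x a b y) :
    lowerEnvelope (D.family σ) x = a * ψ y + (1 - a) * D.h := by
  obtain ⟨j, hj⟩ := D.exists_base_chart hM hP hS hx
  rw [← hj]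
  refine lowerEnvelope_eq (A := D.family σ) (i := (j, false)) fun k => ?_
  change D.base j x ≤ _
  rw [hj]
  exact D.family_chart hM hP.isPolytope hS hx k

end Heights

end Envelope

/-! ### The cells of the cubification are cubes -/

section Cells

variable {E : Type*} [NormedAddCommGroup E] [NormedSpace ℝ E]
  {P : Set E} {S : Set (Set E)} {ψ : E → ℝ} {σ : E ≃ᵃ[ℝ] E} {u : E →ᵃ[ℝ] ℝ} {m e : E}

theorem linear_sub (g : E →ᵃ[ℝ] ℝ) (x y : E) : g.linear (x - y) = g x - g y := by
  have := g.linearMap_vsub x y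
  rwa [vsub_eq_sub, vsub_eq_sub] at this

/-- The chart of a boundary point itself. -/
theorem IsChart.boundary {x : E} (hx : x ∈ frontier P) (hux : 0 ≤ u x) :
    IsChart P u m e x 1 0 x :=
  ⟨hx, one_pos, le_rfl, by simp [planePoint], hux, by norm_num, by norm_num,
    Or.inl ⟨by norm_num, hux⟩⟩

namespace IsPlusCell

theorem mem {F : Set E} (hF : IsPlusCell P S u F) : F ∈ S := by
  obtain ⟨⟨_, _, h⟩, _⟩ := hF
  exact h.1

end IsPlusCell

namespace IsMirrorCell

theorem mem {G : Set E} (hG : IsMirrorCell P S u G) : G ∈ S := by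
  obtain ⟨_, _, h⟩ := hG
  exact h.1

theorem u_eq_zero {G : Set E} (hG : IsMirrorCell P S u G) {x : E} (hx : x ∈ G) : u x = 0 := by
  obtain ⟨_, _, h⟩ := hG
  exact (h.2.1 hx).2

end IsMirrorCell

theorem CellIndex.cell_mem (i : CellIndex P S u) : i.cell ∈ S := by
  rcases i with F | F | G
  exacts [F.2.mem, F.2.mem, G.2.mem]

variable [FiniteDimensional ℝ E]

namespace Heights

theorem mem_region_top_iff (D : Heights P S ψ u m e) (hM : IsMirror P S ψ σ u m e)
    (hP : IsFullDimPolytope P) (hS : IsLiftedCubicalBoundarySubdivision P S ψ)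
    (F : {F // IsPlusCell P S u F}) (x : E) :
    x ∈ region P (D.family σ) (.inl F, false) ↔
      ∃ a y, y ∈ F.1 ∧ 3 / 4 ≤ a ∧ a ≤ 1 ∧ x = planePoint m e a (1 - a) y := by
  have hPc := hP.isPolytope.convex
  constructor
  · intro hx
    have hux : 0 ≤ u x := D.nonneg_of_mem_region hM
      (show (D.base (.inl F)).linear e < 0 from
        hM.linear_neg hP.isPolytope hS F.2 (D.top_dominates F)) hx
    obtain ⟨a, b, y, hc⟩ := hM.exists_chart hPc hP.isPolytope.isCompact.isBounded
      hP.isPolytope.isCompact.isClosed hx.1 hux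
    obtain ⟨hab, hy⟩ := (D.mem_region_iff_of_chart hM hP hS hc hx.1 _).1 hx
    have hab' : a + b = 1 := hab
    have := hc.core_le
    exact ⟨a, y, hy, by linarith, hc.le_one, by rw [hc.eq]; congr 1; linarith⟩
  · rintro ⟨a, y, hy, ha, ha1, rfl⟩
    have huy := F.2.2.1 y hy
    have hyf := hS.subset_frontier F.2.mem hy
    have hyP := hS.subset_polytope hP F.2.mem hy
    have hchart : IsChart P u m e (planePoint m e a (1 - a) y) a (1 - a) y :=
      ⟨hyf, by linarith, ha1, rfl, by
        rw [hM.u_planePoint]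
        have := mul_nonneg (show 0 ≤ a by linarith) huy
        linarith, by linarith, by linarith, Or.inl ⟨by ring, huy⟩⟩
    refine (D.mem_region_iff_of_chart hM hP hS hchart ?_ _).2
      ⟨show a + (1 - a) = 1 by ring, hy⟩
    have := hPc hyP (interior_subset hM.top_mem) (a := a) (b := 1 - a) (by linarith)
      (by linarith) (by ring)
    convert this using 1
    rw [planePoint]; module

theorem mem_region_bot_iff (D : Heights P S ψ u m e) (hM : IsMirror P S ψ σ u m e)
    (hP : IsFullDimPolytope P) (hS : IsLiftedCubicalBoundarySubdivision P S ψ)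
    (F : {F // IsPlusCell P S u F}) (x : E) :
    x ∈ region P (D.family σ) (.inr (.inl F), false) ↔
      ∃ a y, y ∈ F.1 ∧ a ≤ 3 / 4 ∧ 0 ≤ u x ∧ x = planePoint m e a (a - 1 / 2) y := by
  have hPc := hP.isPolytope.convex
  constructor
  · intro hx
    have hux : 0 ≤ u x := D.nonneg_of_mem_region hM (i := .inr (.inl F)) (by
      simpa [base] using hM.linear_neg hP.isPolytope hS F.2 (D.bot_dominates F)) hx
    obtain ⟨a, b, y, hc⟩ := hM.exists_chart hPc hP.isPolytope.isCompact.isBounded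
      hP.isPolytope.isCompact.isClosed hx.1 hux
    obtain ⟨hab, hy⟩ := (D.mem_region_iff_of_chart hM hP hS hc hx.1 _).1 hx
    have hab' : b = a - 1 / 2 := hab
    have := hc.collar_le
    exact ⟨a, y, hy, by linarith, hux, by rw [hc.eq, hab']⟩
  · rintro ⟨a, y, hy, ha, hux, hx⟩
    have huy := F.2.2.1 y hy
    have hyf := hS.subset_frontier F.2.mem hy
    have hyP := hS.subset_polytope hP F.2.mem hy
    have ha0 : 0 < a := by
      rw [hx, hM.u_planePoint] at hux
      by_contra h
      push Not at h
      nlinarith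
    have hchart : IsChart P u m e x a (a - 1 / 2) y :=
      ⟨hyf, ha0, by linarith, hx, hux, by linarith, le_rfl, Or.inr (Or.inl ⟨rfl, huy⟩)⟩
    refine (D.mem_region_iff_of_chart hM hP hS hchart ?_ _).2
      ⟨show a - 1 / 2 = a - 1 / 2 from rfl, hy⟩
    have hmP := interior_subset (hM.center_mem hPc)
    rcases le_total (1 / 2) a with h | h
    · -- a convex combination of `y`, `m + e` and `m`
      have h1 := hPc.sum_mem (t := Finset.univ) (w := ![a, a - 1 / 2, 3 / 2 - 2 * a])
        (z := ![y, m + e, m]) (by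
          intro i _
          fin_cases i <;> simp <;> linarith) (by simp [Fin.sum_univ_three]; ring) (by
          intro i _
          fin_cases i
          exacts [hyP, interior_subset hM.top_mem, hmP])
      convert h1 using 1
      simp only [Fin.sum_univ_three, Matrix.cons_val_zero, Matrix.cons_val_one, Matrix.cons_val]
      rw [hx, planePoint]; module
    · -- a convex combination of `y`, `m - e` and `m`
      have h1 := hPc.sum_mem (t := Finset.univ) (w := ![a, 1 / 2 - a, 1 / 2])
        (z := ![y, m - e, m]) (by
          intro i _
          fin_cases i <;> simp <;> linarith) (by simp [Fin.sum_univ_three]; ring) (by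
          intro i _
          fin_cases i
          exacts [hyP, interior_subset hM.bot_mem, hmP])
      convert h1 using 1
      simp only [Fin.sum_univ_three, Matrix.cons_val_zero, Matrix.cons_val_one, Matrix.cons_val]
      rw [hx, planePoint]; module

theorem mem_region_mid_iff (D : Heights P S ψ u m e) (hM : IsMirror P S ψ σ u m e)
    (hP : IsFullDimPolytope P) (hS : IsLiftedCubicalBoundarySubdivision P S ψ)
    (G : {G // IsMirrorCell P S u G}) (x : E) :
    x ∈ region P (D.family σ) (.inr (.inr G), false) ↔
      ∃ a b y, y ∈ G.1 ∧ |b| ≤ 1 - a ∧ |b| ≤ a - 1 / 2 ∧ x = planePoint m e a b y := by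
  have hPc := hP.isPolytope.convex
  have hsymm : ∀ z, z ∈ region P (D.family σ) (.inr (.inr G), false) →
      σ z ∈ region P (D.family σ) (.inr (.inr G), false) := by
    intro z hz
    rw [D.mem_region_reflection_iff hM]
    refine ⟨hz.1, fun j => ?_⟩
    have h := hz.2 j
    change D.base _ z ≤ _ at h
    change D.base _ (σ z) ≤ _
    rwa [hM.map_reflection, show (D.base (.inr (.inr G))).linear e = 0 from D.mid_linear G,
      mul_zero, sub_zero]
  have hpos : ∀ z, z ∈ region P (D.family σ) (.inr (.inr G), false) → 0 ≤ u z →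
      ∃ a b y, y ∈ G.1 ∧ |b| ≤ 1 - a ∧ |b| ≤ a - 1 / 2 ∧ z = planePoint m e a b y := by
    intro z hz huz
    obtain ⟨a, b, y, hc⟩ := hM.exists_chart hPc hP.isPolytope.isCompact.isBounded
      hP.isPolytope.isCompact.isClosed hz.1 huz
    obtain ⟨-, hy⟩ := (D.mem_region_iff_of_chart hM hP hS hc hz.1 _).1 hz
    have hb : 0 ≤ b := by
      have := hc.nonneg
      rwa [hc.eq, hM.u_planePoint, G.2.u_eq_zero hy, mul_zero, zero_add] at this
    refine ⟨a, b, y, hy, ?_, ?_, hc.eq⟩ <;> rw [abs_of_nonneg hb]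
    · linarith [hc.collar_le]
    · exact hc.core_le
  have hneg : ∀ a b y, y ∈ G.1 → 0 ≤ b → b ≤ 1 - a → b ≤ a - 1 / 2 →
      planePoint m e a b y ∈ region P (D.family σ) (.inr (.inr G), false) := by
    intro a b y hy hb h1 h2
    have huy := G.2.u_eq_zero hy
    have hyP := hS.subset_polytope hP G.2.mem hy
    have hmP := interior_subset (hM.center_mem hPc)
    have hchart : IsChart P u m e (planePoint m e a b y) a b y :=
      ⟨hS.subset_frontier G.2.mem hy, by linarith, by linarith, rfl, by
        rw [hM.u_planePoint, huy]; linarith, by linarith, h2, Or.inr (Or.inr huy)⟩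
    refine (D.mem_region_iff_of_chart hM hP hS hchart ?_ _).2 ⟨trivial, hy⟩
    have h1 := hPc.sum_mem (t := Finset.univ) (w := ![a, b, 1 - a - b])
      (z := ![y, m + e, m]) (by
        intro i _
        fin_cases i <;> simp <;> linarith) (by simp [Fin.sum_univ_three]) (by
        intro i _
        fin_cases i
        exacts [hyP, interior_subset hM.top_mem, hmP])
    convert h1 using 1
    simp only [Fin.sum_univ_three, Matrix.cons_val_zero, Matrix.cons_val_one, Matrix.cons_val]
    rw [planePoint]; module
  constructor
  · intro hx
    rcases le_total 0 (u x) with h | h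
    · exact hpos x hx h
    · obtain ⟨a, b, y, hy, h1, h2, h3⟩ := hpos (σ x) (hsymm x hx)
        (by rw [hM.u_reflection]; linarith)
      refine ⟨a, -b, y, hy, by rwa [abs_neg], by rwa [abs_neg], ?_⟩
      rw [← hM.reflection_reflection x, h3, hM.reflection_planePoint,
        hM.reflection_eq_self (G.2.u_eq_zero hy)]
  · rintro ⟨a, b, y, hy, h1, h2, rfl⟩
    rcases le_total 0 b with hb | hb
    · rw [abs_of_nonneg hb] at h1 h2
      exact hneg a b y hy hb h1 h2
    · rw [abs_of_nonpos hb] at h1 h2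
      have := hsymm _ (hneg a (-b) y hy (by linarith) h1 h2)
      rwa [hM.reflection_planePoint, hM.reflection_eq_self (G.2.u_eq_zero hy), neg_neg] at this

/-- The collar cell over `F` is a cube: it is fibred over `F` by the central projection from
`m + e`, the fibre coordinate `a` running from `3 / 4` to `1`. -/
theorem hasCubeCoordinates_top (D : Heights P S ψ u m e) (hM : IsMirror P S ψ σ u m e)
    (hP : IsFullDimPolytope P) (hS : IsLiftedCubicalBoundarySubdivision P S ψ)
    (F : {F // IsPlusCell P S u F}) :
    HasCubeCoordinates (region P (D.family σ) (.inl F, false)) := by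
  obtain ⟨⟨Φ, hΦ, hF⟩, -, y₀, hy₀, -⟩ := F.2
  obtain ⟨τ, -, hτΦ, hτpos⟩ := hΦ.exists_slack ⟨y₀, hF.2.1 hy₀⟩
  have hτq := hτpos _ hM.top_mem
  have hcube := hS.cubical F.1 hF.1 ⟨y₀, hy₀⟩
  set w : E →ᵃ[ℝ] ℝ := AffineMap.const ℝ E 1 - (τ (m + e))⁻¹ • τ with hw
  have hwx : ∀ x, w x = 1 - (τ (m + e))⁻¹ * τ x := fun x => by simp [hw]
  set A : E →ᵃ[ℝ] E := AffineMap.id ℝ E -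
    (LinearMap.toSpanSingleton ℝ E (m + e)).toAffineMap.comp (AffineMap.const ℝ E 1 - w) with hA
  have hAx : ∀ x, A x = x - (1 - w x) • (m + e) := fun x => by
    simp [hA]; module
  have hpt : ∀ a y, planePoint m e a (1 - a) y = a • y + (1 - a) • (m + e) := fun a y => by
    rw [planePoint]; module
  have hwpt : ∀ a, ∀ y ∈ F.1, w (planePoint m e a (1 - a) y) = a := by
    intro a y hy
    have h0 := (hτΦ y (hS.subset_polytope hP hF.1 hy)).2 (hF.2.1 hy)
    rw [hpt, hwx, combo_apply τ _ _ (by ring), h0]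
    field_simp; ring
  have hApt : ∀ a, 0 < a → ∀ y ∈ F.1, (w (planePoint m e a (1 - a) y))⁻¹ •
      A (planePoint m e a (1 - a) y) = y := by
    intro a ha y hy
    rw [hAx, hwpt a y hy, hpt, add_sub_cancel_right, smul_smul, inv_mul_cancel₀ ha.ne', one_smul]
  refine hasCubeCoordinates_of_projective (n := 1) hcube.1.convex hcube.hasCubeCoordinates w A
    (fun _ => AffineMap.const ℝ E 1 - w) (fun _ => w - AffineMap.const ℝ E (3 / 4)) ?_ ?_ ?_
  · intro x
    simp only [AffineMap.coe_sub, Pi.sub_apply, AffineMap.const_apply, forall_const]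
    rw [D.mem_region_top_iff hM hP hS]
    constructor
    · rintro ⟨a, y, hy, ha, ha1, rfl⟩
      rw [hApt a (by linarith) y hy, hwpt a y hy]
      exact ⟨by linarith, hy, by linarith, by linarith⟩
    · rintro ⟨h0, hy, h1, h2⟩
      refine ⟨w x, _, hy, by linarith, by linarith, ?_⟩
      rw [hpt, smul_smul, mul_inv_cancel₀ h0.ne', one_smul, hAx]
      abel
  · intro x _ _
    simp only [AffineMap.coe_sub, Pi.sub_apply, AffineMap.const_apply]
    linarith
  · intro y hy t ht
    have h0 := (ht 0).1
    have h1 := (ht 0).2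
    refine ⟨planePoint m e (1 - t 0 / 4) (1 - (1 - t 0 / 4)) y,
      (D.mem_region_top_iff hM hP hS F _).2 ⟨_, y, hy, by linarith, by linarith, rfl⟩,
      hApt _ (by linarith) y hy, fun j => ?_⟩
    obtain rfl : j = 0 := Subsingleton.elim _ _
    simp only [AffineMap.coe_sub, Pi.sub_apply, AffineMap.const_apply]
    rw [hwpt _ y hy]
    constructor <;> constructor <;> intro h <;> linarith

/-- The core cell over `F` is a cube: it is fibred over `F` by the central projection from
`m - (1/2) e`, and its fibres run from the collar to the mirror. -/
theorem hasCubeCoordinates_bot (D : Heights P S ψ u m e) (hM : IsMirror P S ψ σ u m e)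
    (hP : IsFullDimPolytope P) (hS : IsLiftedCubicalBoundarySubdivision P S ψ)
    (F : {F // IsPlusCell P S u F}) :
    HasCubeCoordinates (region P (D.family σ) (.inr (.inl F), false)) := by
  obtain ⟨⟨Φ, hΦ, hF⟩, hFnn, y₀, hy₀, -⟩ := F.2
  obtain ⟨τ, -, hτΦ, hτpos⟩ := hΦ.exists_slack ⟨y₀, hF.2.1 hy₀⟩
  have hτq := hτpos _ hM.bot_mem
  have hcube := hS.cubical F.1 hF.1 ⟨y₀, hy₀⟩
  set p : E := m - (1 / 2 : ℝ) • e with hp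
  set w : E →ᵃ[ℝ] ℝ := (τ (m - e))⁻¹ • (AffineMap.const ℝ E (τ p) - τ) with hw
  have hwx : ∀ x, w x = (τ (m - e))⁻¹ * (τ p - τ x) := fun x => by simp [hw]
  set A : E →ᵃ[ℝ] E := AffineMap.id ℝ E - AffineMap.const ℝ E p +
    (LinearMap.toSpanSingleton ℝ E (m - e)).toAffineMap.comp w with hA
  have hAx : ∀ x, A x = x - p + w x • (m - e) := fun x => by simp [hA]
  have hpt : ∀ a y, planePoint m e a (a - 1 / 2) y = p + a • (y - (m - e)) := fun a y => by
    rw [planePoint, hp]; module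
  have hwpt : ∀ a, ∀ y ∈ F.1, w (planePoint m e a (a - 1 / 2) y) = a := by
    intro a y hy
    have h0 := (hτΦ y (hS.subset_polytope hP hF.1 hy)).2 (hF.2.1 hy)
    rw [hpt, hwx, map_add_smul, linear_sub, h0]
    field_simp; ring
  have hApt : ∀ a, 0 < a → ∀ y ∈ F.1, (w (planePoint m e a (a - 1 / 2) y))⁻¹ •
      A (planePoint m e a (a - 1 / 2) y) = y := by
    intro a ha y hy
    rw [hAx, hwpt a y hy, hpt, add_sub_cancel_left, ← smul_add, smul_smul,
      inv_mul_cancel₀ ha.ne', one_smul, sub_add_cancel]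
  have hu : ∀ a y, u (planePoint m e a (a - 1 / 2) y) = a * (u y + 1) - 1 / 2 := by
    intro a y
    rw [hM.u_planePoint]; ring
  refine hasCubeCoordinates_of_projective (n := 1) hcube.1.convex hcube.hasCubeCoordinates w A
    (fun _ => u) (fun _ => AffineMap.const ℝ E (3 / 4) - w) ?_ ?_ ?_
  · intro x
    simp only [AffineMap.coe_sub, Pi.sub_apply, AffineMap.const_apply, forall_const]
    rw [D.mem_region_bot_iff hM hP hS]
    constructor
    · rintro ⟨a, y, hy, ha, hux, rfl⟩
      have ha0 : 0 < a := by
        rw [hu] at hux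
        by_contra h
        push Not at h
        nlinarith [hFnn y hy]
      rw [hApt a ha0 y hy, hwpt a y hy]
      exact ⟨ha0, hy, hux, by linarith⟩
    · rintro ⟨h0, hy, h1, h2⟩
      refine ⟨w x, _, hy, by linarith, h1, ?_⟩
      rw [hpt, smul_sub, smul_smul, mul_inv_cancel₀ h0.ne', one_smul, hAx]
      abel
  · intro x hx _
    obtain ⟨a, y, hy, ha, hux, rfl⟩ := (D.mem_region_bot_iff hM hP hS F x).1 hx
    simp only [AffineMap.coe_sub, Pi.sub_apply, AffineMap.const_apply]
    rw [hwpt a y hy]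
    rcases ha.lt_or_eq with h | h
    · linarith
    · rw [hu, h]
      linarith [hFnn y hy]
  · intro y hy t ht
    have h0 := (ht 0).1
    have h1 := (ht 0).2
    have huy := hFnn y hy
    have hu1 : 0 < u y + 1 := by linarith
    -- the fibre meets the mirror at the parameter `a₀`
    set a₀ := (1 / 2) / (u y + 1) with ha₀
    have ha₀' : a₀ * (u y + 1) = 1 / 2 := by rw [ha₀]; field_simp
    have ha₀0 : 0 < a₀ := by positivity
    have ha₀1 : a₀ ≤ 1 / 2 := by rw [ha₀, div_le_iff₀ hu1]; linarith
    set a := a₀ + t 0 * (3 / 4 - a₀) with ha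
    have hpos : 0 < (3 / 4 - a₀) * (u y + 1) := mul_pos (by linarith) hu1
    have hua : u (planePoint m e a (a - 1 / 2) y) = t 0 * ((3 / 4 - a₀) * (u y + 1)) := by
      rw [hu, ha]; linear_combination ha₀'
    have ha34 : 3 / 4 - a = (1 - t 0) * (3 / 4 - a₀) := by rw [ha]; ring
    have hale : 0 ≤ 3 / 4 - a := by
      rw [ha34]; exact mul_nonneg (by linarith) (by linarith)
    have ha0 : 0 < a := by
      have := mul_nonneg h0 (show 0 ≤ 3 / 4 - a₀ by linarith)
      linarith
    refine ⟨planePoint m e a (a - 1 / 2) y,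
      (D.mem_region_bot_iff hM hP hS F _).2 ⟨_, y, hy, by linarith, ?_, rfl⟩,
      hApt _ ha0 y hy, fun j => ?_⟩
    · rw [hua]; exact mul_nonneg h0 hpos.le
    · obtain rfl : j = 0 := Subsingleton.elim _ _
      simp only [AffineMap.coe_sub, Pi.sub_apply, AffineMap.const_apply]
      have hne : 3 / 4 - a₀ ≠ 0 := (by linarith : 0 < 3 / 4 - a₀).ne'
      rw [hwpt _ y hy, hua, ha34]
      refine ⟨mul_eq_zero.trans (or_iff_left hpos.ne'),
        (mul_eq_zero.trans (or_iff_left hne)).trans ?_⟩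
      rw [sub_eq_zero, eq_comm]

/-- The cell over the mirror cell `G` is a cube: it is fibred over `G` with a square as fibre. -/
theorem hasCubeCoordinates_mid (D : Heights P S ψ u m e) (hM : IsMirror P S ψ σ u m e)
    (hP : IsFullDimPolytope P) (hS : IsLiftedCubicalBoundarySubdivision P S ψ)
    (G : {G // IsMirrorCell P S u G}) :
    HasCubeCoordinates (region P (D.family σ) (.inr (.inr G), false)) := by
  obtain ⟨Φ, hΦ, hG⟩ := G.2
  obtain ⟨y₀, hy₀, -⟩ := hG.2.2
  obtain ⟨τ, -, hτΦ, hτpos⟩ := hΦ.exists_slack ⟨y₀, (hG.2.1 hy₀).1⟩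
  have hτq := hτpos _ (hM.center_mem hP.isPolytope.convex)
  have hcube := hS.cubical G.1 hG.1 ⟨y₀, hy₀⟩
  let pr : E →ᵃ[ℝ] E := AffineMap.id ℝ E - (LinearMap.toSpanSingleton ℝ E e).toAffineMap.comp u
  have hpr : ∀ x, pr x = x - u x • e := fun x => by simp [pr]
  set w : E →ᵃ[ℝ] ℝ := AffineMap.const ℝ E 1 - (τ m)⁻¹ • τ.comp pr with hw
  have hwx : ∀ x, w x = 1 - (τ m)⁻¹ * τ (x - u x • e) := fun x => by simp [hw, hpr]
  set A : E →ᵃ[ℝ] E := pr -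
    (LinearMap.toSpanSingleton ℝ E m).toAffineMap.comp (AffineMap.const ℝ E 1 - w) with hA
  have hAx : ∀ x, A x = x - u x • e - (1 - w x) • m := fun x => by
    simp [hA, hpr]; module
  have hu : ∀ a b, ∀ y ∈ G.1, u (planePoint m e a b y) = b := by
    intro a b y hy
    rw [hM.u_planePoint, G.2.u_eq_zero hy]; ring
  have hpt : ∀ a b, ∀ y ∈ G.1, planePoint m e a b y - u (planePoint m e a b y) • e =
      a • y + (1 - a) • m := fun a b y hy => by
    rw [hu a b y hy, planePoint]; module
  have hwpt : ∀ a b, ∀ y ∈ G.1, w (planePoint m e a b y) = a := by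
    intro a b y hy
    have h0 := (hτΦ y (hS.subset_polytope hP hG.1 hy)).2 (hG.2.1 hy).1
    rw [hwx, hpt a b y hy, combo_apply τ _ _ (by ring), h0]
    field_simp; ring
  have hApt : ∀ a b, 0 < a → ∀ y ∈ G.1, (w (planePoint m e a b y))⁻¹ •
      A (planePoint m e a b y) = y := by
    intro a b ha y hy
    rw [hAx, hpt a b y hy, hwpt a b y hy, add_sub_cancel_right, smul_smul,
      inv_mul_cancel₀ ha.ne', one_smul]
  refine hasCubeCoordinates_of_projective (n := 2) hcube.1.convex hcube.hasCubeCoordinates w A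
    ![w + u - AffineMap.const ℝ E (1 / 2), w - u - AffineMap.const ℝ E (1 / 2)]
    ![AffineMap.const ℝ E 1 - (w + u), AffineMap.const ℝ E 1 - (w - u)] ?_ ?_ ?_
  · intro x
    simp only [Fin.forall_fin_two, Matrix.cons_val_zero, Matrix.cons_val_one, AffineMap.coe_sub,
      AffineMap.coe_add, Pi.sub_apply, Pi.add_apply, AffineMap.const_apply]
    rw [D.mem_region_mid_iff hM hP hS]
    constructor
    · rintro ⟨a, b, y, hy, h1, h2, rfl⟩
      rw [abs_le] at h1 h2
      rw [hApt a b (by linarith) y hy, hwpt a b y hy, hu a b y hy]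
      refine ⟨by linarith, hy, ⟨?_, ?_⟩, ?_, ?_⟩ <;> linarith
    · rintro ⟨h0, hy, ⟨h1, h2⟩, h3, h4⟩
      refine ⟨w x, u x, _, hy, ?_, ?_, ?_⟩
      · rw [abs_le]; constructor <;> linarith
      · rw [abs_le]; constructor <;> linarith
      · rw [planePoint, smul_sub, smul_smul, mul_inv_cancel₀ h0.ne', one_smul, hAx]
        module
  · intro x _
    simp only [Fin.forall_fin_two, Matrix.cons_val_zero, Matrix.cons_val_one, AffineMap.coe_sub,
      AffineMap.coe_add, Pi.sub_apply, Pi.add_apply, AffineMap.const_apply]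
    constructor <;> linarith
  · intro y hy t ht
    have h0 := ht 0
    have h1 := ht 1
    rw [Set.mem_Icc] at h0 h1
    refine ⟨planePoint m e (1 / 2 + (t 0 + t 1) / 4) ((t 0 - t 1) / 4) y,
      (D.mem_region_mid_iff hM hP hS G _).2 ⟨_, _, y, hy, ?_, ?_, rfl⟩,
      hApt _ _ (by linarith) y hy, ?_⟩
    · rw [abs_le]; constructor <;> linarith
    · rw [abs_le]; constructor <;> linarith
    · simp only [Fin.forall_fin_two, Matrix.cons_val_zero, Matrix.cons_val_one, AffineMap.coe_sub,
        AffineMap.coe_add, Pi.sub_apply, Pi.add_apply, AffineMap.const_apply]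
      rw [hwpt _ _ y hy, hu _ _ y hy]
      refine ⟨⟨⟨?_, ?_⟩, ?_, ?_⟩, ⟨?_, ?_⟩, ?_, ?_⟩ <;> intro h <;> linarith

theorem hasCubeCoordinates_region (D : Heights P S ψ u m e) (hM : IsMirror P S ψ σ u m e)
    (hP : IsFullDimPolytope P) (hS : IsLiftedCubicalBoundarySubdivision P S ψ)
    (j : CellIndex P S u × Bool) : HasCubeCoordinates (region P (D.family σ) j) := by
  have hpos : ∀ i, HasCubeCoordinates (region P (D.family σ) (i, false)) := by
    rintro (F | F | G)
    · exact D.hasCubeCoordinates_top hM hP hS F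
    · exact D.hasCubeCoordinates_bot hM hP hS F
    · exact D.hasCubeCoordinates_mid hM hP hS G
  obtain ⟨i, c⟩ := j
  cases c
  · exact hpos i
  · rw [D.region_true hM]
    exact (hpos i).image σ

end Heights

end Cells

/-! ### The boundary complex of the cubification -/

section Boundary

variable {E : Type*} [NormedAddCommGroup E] [NormedSpace ℝ E]
  {P : Set E} {S : Set (Set E)} {ψ : E → ℝ} {σ : E ≃ᵃ[ℝ] E} {u : E →ᵃ[ℝ] ℝ} {m e : E}

theorem CellIndex.nonneg_of_mem_cell (i : CellIndex P S u) {x : E} (hx : x ∈ i.cell) :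
    0 ≤ u x := by
  rcases i with F | F | G
  exacts [F.2.2.1 x hx, F.2.2.1 x hx, (G.2.u_eq_zero hx).ge]

theorem CellIndex.finite (hS : IsLiftedCubicalBoundarySubdivision P S ψ) :
    Finite (CellIndex P S u) := by
  have h1 : Finite {F // IsPlusCell P S u F} :=
    hS.subdivision.complex.finite.subset fun _ hF => IsPlusCell.mem hF
  have h2 : Finite {G // IsMirrorCell P S u G} :=
    hS.subdivision.complex.finite.subset fun _ hG => IsMirrorCell.mem hG
  exact inferInstance

theorem IsMirror.image_image (hM : IsMirror P S ψ σ u m e) (C : Set E) : σ '' (σ '' C) = C := by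
  rw [Set.image_image]
  simp only [hM.reflection_reflection, Set.image_id']

variable [FiniteDimensional ℝ E]

theorem CellIndex.nonempty (hM : IsMirror P S ψ σ u m e) (hP : IsFullDimPolytope P)
    (hS : IsLiftedCubicalBoundarySubdivision P S ψ) (D : Heights P S ψ u m e) :
    Nonempty (CellIndex P S u) := by
  have hPc := hP.isPolytope.convex
  obtain ⟨a, b, y, hc⟩ := hM.exists_chart hPc hP.isPolytope.isCompact.isBounded
    hP.isPolytope.isCompact.isClosed (interior_subset (hM.center_mem hPc)) hM.apply_center.ge
  obtain ⟨i, -⟩ := D.exists_base_chart hM hP hS hc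
  exact ⟨i⟩

theorem IsMirror.exists_heights (hM : IsMirror P S ψ σ u m e) (hP : IsFullDimPolytope P)
    (hS : IsLiftedCubicalBoundarySubdivision P S ψ) : Nonempty (Heights P S ψ u m e) := by
  obtain ⟨h, h1, h2, h3⟩ := hM.exists_height hP hS
  choose top htop htop' using h1
  choose bot hbot hbot' using h2
  choose mid hmid hmidl hmid' using h3
  exact ⟨⟨h, fun F => top _ F.2, fun F => bot _ F.2, fun G => mid _ G.2, fun F => htop _ F.2,
    fun F => hbot _ F.2, fun G => hmid _ G.2, fun G => hmidl _ G.2, fun F => htop' _ F.2,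
    fun F => hbot' _ F.2, fun G => hmid' _ G.2⟩⟩

namespace Heights

theorem mem_region_iff_of_mem_frontier_of_nonneg (D : Heights P S ψ u m e)
    (hM : IsMirror P S ψ σ u m e) (hP : IsFullDimPolytope P)
    (hS : IsLiftedCubicalBoundarySubdivision P S ψ) {x : E} (hx : x ∈ frontier P)
    (hux : 0 ≤ u x) (i : CellIndex P S u) :
    x ∈ region P (D.family σ) (i, false) ↔ i.Tight 1 0 ∧ x ∈ i.cell :=
  D.mem_region_iff_of_chart hM hP hS (IsChart.boundary hx hux)
    (hP.isPolytope.isCompact.isClosed.frontier_subset hx) i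

/-- A cell of the positive half meets the boundary in the boundary cell from which it is built,
or not at all. -/
theorem mem_region_iff_of_mem_frontier (D : Heights P S ψ u m e) (hM : IsMirror P S ψ σ u m e)
    (hP : IsFullDimPolytope P) (hS : IsLiftedCubicalBoundarySubdivision P S ψ) {x : E}
    (hx : x ∈ frontier P) (i : CellIndex P S u) :
    x ∈ region P (D.family σ) (i, false) ↔ i.Tight 1 0 ∧ x ∈ i.cell := by
  rcases le_or_gt 0 (u x) with hux | hux
  · exact D.mem_region_iff_of_mem_frontier_of_nonneg hM hP hS hx hux i
  refine iff_of_false (fun h => ?_) fun h => hux.not_ge (i.nonneg_of_mem_cell h.2)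
  rcases i with F | F | G
  · exact hux.not_ge (D.nonneg_of_mem_region hM (i := .inl F)
      (hM.linear_neg hP.isPolytope hS F.2 (D.top_dominates F)) h)
  · refine hux.not_ge (D.nonneg_of_mem_region hM (i := .inr (.inl F)) ?_ h)
    simpa [base] using hM.linear_neg hP.isPolytope hS F.2 (D.bot_dominates F)
  · -- the square over `G` is symmetric, so the mirror image of `x` lies in `G`
    obtain ⟨a, b, y, hy, h1, h2, rfl⟩ := (D.mem_region_mid_iff hM hP hS G x).1 h
    have hσ : σ (planePoint m e a b y) ∈ region P (D.family σ) (.inr (.inr G), false) := by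
      rw [D.mem_region_mid_iff hM hP hS, hM.reflection_planePoint,
        hM.reflection_eq_self (G.2.u_eq_zero hy)]
      exact ⟨a, -b, y, hy, by rwa [abs_neg], by rwa [abs_neg], rfl⟩
    have hu := hM.u_reflection (planePoint m e a b y)
    have hG := ((D.mem_region_iff_of_mem_frontier_of_nonneg hM hP hS
      (hM.reflection_mem_frontier hP.isPolytope hx) (by linarith) _).1 hσ).2
    have := G.2.u_eq_zero hG
    linarith

theorem isFace_image_reflection (D : Heights P S ψ u m e) (hM : IsMirror P S ψ σ u m e)
    (hP : IsPolytope P) [Finite (CellIndex P S u)] {i : CellIndex P S u} {b : Bool} {C : Set E}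
    (hC : IsFace (region P (D.family σ) (i, b)) C) :
    IsFace (region P (D.family σ) (i, !b)) (σ '' C) := by
  have hC' := (isPolytope_region hP _).isFace_iff.1 hC
  refine (isPolytope_region hP _).isFace_iff.2 ⟨hC'.1.affine_image (σ : E →ᵃ[ℝ] E), ?_, ?_⟩
  · rintro _ ⟨x, hx, rfl⟩
    rw [D.mem_region_reflection_iff hM, Bool.not_not]
    exact hC'.2.subset hx
  · rintro x hx y hy z ⟨c, hc, rfl⟩ hz
    refine ⟨σ x, hC'.2.left_mem_of_mem_openSegment ((D.mem_region_reflection_iff hM i b).2 hx)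
      ((D.mem_region_reflection_iff hM i b).2 hy) hc ?_, hM.reflection_reflection x⟩
    rw [← hM.reflection_reflection c]
    have := Set.mem_image_of_mem (σ : E →ᵃ[ℝ] E) hz
    rwa [image_openSegment] at this

/-- A face of a cell of the positive half that lies in the boundary belongs to the given
subdivision. -/
theorem mem_of_isFace_of_subset_frontier (D : Heights P S ψ u m e) (hM : IsMirror P S ψ σ u m e)
    (hP : IsFullDimPolytope P) (hS : IsLiftedCubicalBoundarySubdivision P S ψ)
    [Finite (CellIndex P S u)] {i : CellIndex P S u} {C : Set E}
    (hC : IsFace (region P (D.family σ) (i, false)) C) (hCf : C ⊆ frontier P) : C ∈ S := by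
  rcases C.eq_empty_or_nonempty with rfl | ⟨x, hx⟩
  · exact hS.subdivision.complex.empty_mem
  have hC' := (isPolytope_region hP.isPolytope _).isFace_iff.1 hC
  have hmem := fun y (hy : y ∈ C) =>
    (D.mem_region_iff_of_mem_frontier hM hP hS (hCf hy) i).1 (hC'.2.subset hy)
  have hcell : i.cell ⊆ region P (D.family σ) (i, false) := fun y hy =>
    (D.mem_region_iff_of_mem_frontier hM hP hS (hS.subset_frontier i.cell_mem hy) i).2
      ⟨(hmem x hx).1, hy⟩
  exact hS.subdivision.complex.face_mem _ i.cell_mem _ ((hS.isPolytope i.cell_mem).isFace_iff.2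
    ⟨hC'.1, hC'.2.mono hcell fun y hy => (hmem y hy).2⟩)

/-- The cells of the given subdivision on the positive side are faces of collar cells. -/
theorem exists_isFace_of_mem (D : Heights P S ψ u m e) (hM : IsMirror P S ψ σ u m e)
    (hP : IsFullDimPolytope P) (hS : IsLiftedCubicalBoundarySubdivision P S ψ)
    [Finite (CellIndex P S u)] {C : Set E} (hC : C ∈ S) {c : E} (hc : c ∈ C)
    (hgen : ∀ x ∈ C, Prec C x c) (huc : 0 ≤ u c) :
    ∃ i, IsFace (region P (D.family σ) (i, false)) C := by
  obtain ⟨F, hF, hcF⟩ := hM.exists_plusCell hP hS (hS.subset_frontier hC hc) huc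
  have hCF := hS.subset_of_generic hC hF.mem hc hcF hgen
  have hCF' := (hS.subdivision.complex.inter_face F hF.mem C hC).1
  rw [Set.inter_eq_self_of_subset_right hCF] at hCF'
  have hCe := (hS.isPolytope hF.mem).isFace_iff.1 hCF'
  refine ⟨.inl ⟨F, hF⟩, (isPolytope_region hP.isPolytope _).isFace_iff.2
    ⟨hCe.1, IsExtreme.trans ?_ hCe.2⟩⟩
  have hmem : ∀ x ∈ frontier P,
      x ∈ region P (D.family σ) (.inl ⟨F, hF⟩, false) ↔ x ∈ F := fun x hx => by
    rw [D.mem_region_iff_of_mem_frontier hM hP hS hx]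
    exact and_iff_right (show (1 : ℝ) + 0 = 1 by norm_num)
  obtain ⟨Φ, hΦ, hFΦ⟩ := hF.1
  have hΦe := (hP.isPolytope.isFace_iff.1 hΦ.1.1).2
  refine ⟨fun x hx => (hmem x (hS.subset_frontier hFΦ.1 hx)).2 hx, ?_⟩
  intro x hx y hy z hz hzs
  have hxΦ := hΦe.left_mem_of_mem_openSegment hx.1 hy.1 (hFΦ.2.1 hz) hzs
  exact (hmem x (hΦ.subset_frontier hxΦ)).1 hx

theorem isCubical_regionComplex (D : Heights P S ψ u m e) (hM : IsMirror P S ψ σ u m e)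
    (hP : IsFullDimPolytope P) (hS : IsLiftedCubicalBoundarySubdivision P S ψ)
    [Finite (CellIndex P S u)] : IsCubical (regionComplex P (D.family σ)) := by
  rintro C ⟨j, hC⟩ hne
  exact ((D.hasCubeCoordinates_region hM hP hS j).isCombinatorialCube
    (isPolytope_region hP.isPolytope j)).face hC hne

theorem boundaryComplex_regionComplex (D : Heights P S ψ u m e) (hM : IsMirror P S ψ σ u m e)
    (hP : IsFullDimPolytope P) (hS : IsLiftedCubicalBoundarySubdivision P S ψ)
    [Finite (CellIndex P S u)] [Nonempty (CellIndex P S u)] :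
    boundaryComplex (regionComplex P (D.family σ)) = S := by
  ext C
  rw [boundaryComplex, Set.mem_ofPred_eq,
    (isSubdivision_regionComplex (A := D.family σ) hP.isPolytope).support_eq]
  constructor
  · rintro ⟨⟨⟨i, b⟩, hC⟩, hCf⟩
    cases b
    · exact D.mem_of_isFace_of_subset_frontier hM hP hS hC hCf
    · rw [← hM.image_image C]
      refine hM.image_mem _ (D.mem_of_isFace_of_subset_frontier hM hP hS
        (D.isFace_image_reflection hM hP.isPolytope hC) ?_)
      rintro _ ⟨x, hx, rfl⟩
      exact hM.reflection_mem_frontier hP.isPolytope (hCf hx)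
  · intro hC
    refine ⟨?_, hS.subset_frontier hC⟩
    rcases C.eq_empty_or_nonempty with rfl | hne
    · exact (isSubdivision_regionComplex hP.isPolytope).complex.empty_mem
    obtain ⟨c, hc, hgen⟩ := (hS.isPolytope hC).exists_generic hne
    rcases le_or_gt 0 (u c) with huc | huc
    · obtain ⟨i, hi⟩ := D.exists_isFace_of_mem hM hP hS hC hc hgen huc
      exact ⟨_, hi⟩
    · have hσC := hM.image_mem C hC
      obtain ⟨c', hc', hgen'⟩ := (hS.isPolytope hσC).exists_generic (hne.image σ)
      have huc' : 0 ≤ u c' := hM.nonneg_of_pos hS hσC (Set.mem_image_of_mem σ hc)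
        (by rw [hM.u_reflection]; linarith) hc'
      obtain ⟨i, hi⟩ := D.exists_isFace_of_mem hM hP hS hσC hc' hgen' huc'
      rw [← hM.image_image C]
      exact ⟨_, D.isFace_image_reflection hM hP.isPolytope hi⟩

theorem eqOn_lowerEnvelope (D : Heights P S ψ u m e) (hM : IsMirror P S ψ σ u m e)
    (hP : IsFullDimPolytope P) (hS : IsLiftedCubicalBoundarySubdivision P S ψ)
    [Finite (CellIndex P S u)] : Set.EqOn (lowerEnvelope (D.family σ)) ψ (frontier P) := by
  have hpos : ∀ x ∈ frontier P, 0 ≤ u x → lowerEnvelope (D.family σ) x = ψ x := by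
    intro x hx hux
    rw [D.lowerEnvelope_chart hM hP hS (IsChart.boundary hx hux)]
    ring
  intro x hx
  rcases le_or_gt 0 (u x) with hux | hux
  · exact hpos x hx hux
  · rw [← D.lowerEnvelope_reflection hM, ← hM.lift_reflection x hx]
    exact hpos _ (hM.reflection_mem_frontier hP.isPolytope hx)
      (by rw [hM.u_reflection]; linarith)

end Heights

theorem IsMirror.exists_isLiftedCubification (hM : IsMirror P S ψ σ u m e)
    (hP : IsFullDimPolytope P) (hS : IsLiftedCubicalBoundarySubdivision P S ψ) :
    ∃ B φ, IsLiftedCubification P S ψ B φ := by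
  obtain ⟨D⟩ := hM.exists_heights hP hS
  have := CellIndex.finite (u := u) hS
  have := CellIndex.nonempty hM hP hS D
  exact ⟨regionComplex P (D.family σ), lowerEnvelope (D.family σ),
    isSubdivision_regionComplex hP.isPolytope, D.isCubical_regionComplex hM hP hS,
    isLiftingFunction_lowerEnvelope hP.isPolytope, D.boundaryComplex_regionComplex hM hP hS,
    D.eqOn_lowerEnvelope hM hP hS⟩

end Boundary

/-! ### Reflections in hyperplanes -/

section Reflection

variable {E : Type*} [NormedAddCommGroup E] [InnerProductSpace ℝ E] [FiniteDimensional ℝ E]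

/-- The orthogonal reflection in a hyperplane, expressed by an affine function vanishing on it and
a vector orthogonal to it, which may be chosen arbitrarily short. -/
theorem exists_reflection_eq (H : AffineSubspace ℝ E) [Nonempty H]
    (hH : Module.finrank ℝ H.direction + 1 = Module.finrank ℝ E) {m : E} (hm : m ∈ H) {r : ℝ}
    (hr : 0 < r) : ∃ (u : E →ᵃ[ℝ] ℝ) (e : E), ‖e‖ < r ∧ u m = 0 ∧ u.linear e = 1 ∧
      ∀ x, EuclideanGeometry.reflection H x = x - (2 * u x) • e := by
  obtain ⟨⟨v, hvH⟩, hv0, hv⟩ :=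
    finrank_eq_one_iff'.1 (Submodule.finrank_add_finrank_orthogonal' hH)
  have hv0' : v ≠ 0 := fun h => hv0 (Subtype.ext h)
  have hvn : 0 < ‖v‖ := norm_pos_iff.2 hv0'
  set t := r / (2 * ‖v‖) with ht
  have ht0 : 0 < t := by positivity
  set e := t • v with he
  have heH : e ∈ H.directionᗮ := Submodule.smul_mem _ _ hvH
  have he0 : e ≠ 0 := smul_ne_zero ht0.ne' hv0'
  have hee : inner ℝ e e ≠ (0 : ℝ) := inner_self_ne_zero.2 he0
  let u : E →ᵃ[ℝ] ℝ := (inner ℝ e e)⁻¹ • ((innerₛₗ ℝ e).toAffineMap -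
    AffineMap.const ℝ E (inner ℝ e m))
  have hu : ∀ x, u x = (inner ℝ e e)⁻¹ * inner ℝ e (x - m) := fun x => by
    simp [u, inner_sub_right]
  refine ⟨u, e, ?_, by simp [hu], ?_, fun x => ?_⟩
  · rw [he, norm_smul, Real.norm_of_nonneg ht0.le, ht]
    field_simp
    linarith
  · simp only [u]
    have := inv_mul_cancel₀ hee
    simpa using this
  · have hpH := EuclideanGeometry.orthogonalProjection_mem (s := H) x
    set p : E := ↑(EuclideanGeometry.orthogonalProjection H x)
    obtain ⟨c, hc⟩ := hv ⟨x - p,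
      EuclideanGeometry.vsub_orthogonalProjection_mem_direction_orthogonal H x⟩
    have hc' : x = (c / t) • e +ᵥ p := by
      have h1 : c • v = x - p := congrArg Subtype.val hc
      rw [he, smul_smul, div_mul_cancel₀ _ ht0.ne', h1, vadd_eq_add, sub_add_cancel]
    have hux : u x = c / t := by
      have h0 : inner ℝ e (p - m) = (0 : ℝ) :=
        Submodule.inner_left_of_mem_orthogonal (AffineSubspace.vsub_mem_direction hpH hm) heH
      rw [hu, hc', vadd_eq_add, add_sub_assoc, inner_add_right, h0,
        real_inner_smul_right e e, add_zero, mul_comm (c / t), inv_mul_cancel_left₀ hee]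
    rw [hux]
    conv_lhs => rw [hc']
    rw [EuclideanGeometry.reflection_orthogonal_vadd hpH (Submodule.smul_mem _ _ heH)]
    conv_rhs => rw [hc']
    simp only [vadd_eq_add]
    module

theorem exists_isMirror {P : Set E} {S : Set (Set E)} {ψ : E → ℝ} (hP : IsFullDimPolytope P)
    (H : AffineSubspace ℝ E) [Nonempty H]
    (hH : Module.finrank ℝ H.direction + 1 = Module.finrank ℝ E)
    (hPsymm : EuclideanGeometry.reflection H '' P = P)
    (hSsymm : (fun C => EuclideanGeometry.reflection H '' C) '' S = S)
    (hψsymm : ∀ x ∈ frontier P, ψ (EuclideanGeometry.reflection H x) = ψ x)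
    (hSH : IsSubcomplex (restrict S (H : Set E)) S) :
    ∃ u m e, IsMirror P S ψ (EuclideanGeometry.reflection H).toAffineEquiv u m e := by
  obtain ⟨a, ha⟩ := hP.interior_nonempty
  have hσa : EuclideanGeometry.reflection H a ∈ interior P := by
    have := (EuclideanGeometry.reflection H).toHomeomorph.image_interior P
    simp only [AffineIsometryEquiv.coe_toHomeomorph] at this
    rw [← hPsymm, ← this]
    exact Set.mem_image_of_mem _ ha
  have hm : midpoint ℝ a (EuclideanGeometry.reflection H a) ∈ interior P :=
    hP.isPolytope.convex.interior.midpoint_mem ha hσa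
  have hmH : midpoint ℝ a (EuclideanGeometry.reflection H a) ∈ H := by
    rw [← EuclideanGeometry.reflection_eq_self_iff]
    have := (EuclideanGeometry.reflection H).toAffineEquiv.map_midpoint a
      (EuclideanGeometry.reflection H a)
    simp only [AffineIsometryEquiv.coe_toAffineEquiv,
      EuclideanGeometry.reflection_reflection] at this
    rw [this, midpoint_comm]
  set m := midpoint ℝ a (EuclideanGeometry.reflection H a)
  obtain ⟨r, hr, hball⟩ := Metric.isOpen_iff.1 isOpen_interior m hm
  obtain ⟨u, e, her, hum, hue, hσ⟩ := exists_reflection_eq H hH hmH hr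
  have he0 : e ≠ 0 := by
    rintro rfl
    simp at hue
  have huH : {x | u x = 0} = (H : Set E) := by
    ext x
    rw [Set.mem_ofPred_eq, SetLike.mem_coe, ← EuclideanGeometry.reflection_eq_self_iff, hσ,
      sub_eq_self, smul_eq_zero, or_iff_left he0]
    simp
  refine ⟨u, m, e, hum, hue, hσ, hball (by simpa using her), hball (by simpa using her),
    fun x hx => ?_, hψsymm, fun C hC => ?_, fun C hC => ?_⟩
  · rw [← hPsymm]
    exact Set.mem_image_of_mem _ hx
  · rw [huH]
    exact hSH.1 ⟨C, hC, rfl⟩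
  · rw [← hSsymm]
    exact ⟨C, hC, rfl⟩

end Reflection

end LiftedCubification

theorem mainTheorem4 (d : ℕ)
    (P : Set (EuclideanSpace ℝ (Fin d)))
    (hP : LiftedCubification.IsFullDimPolytope P)
    (S : Set (Set (EuclideanSpace ℝ (Fin d))))
    (ψ : EuclideanSpace ℝ (Fin d) → ℝ)
    (hS : LiftedCubification.IsLiftedCubicalBoundarySubdivision P S ψ)
    (H : AffineSubspace ℝ (EuclideanSpace ℝ (Fin d))) [Nonempty H]
    (hH : Module.finrank ℝ H.direction + 1 = d)
    (hPsymm : EuclideanGeometry.reflection H '' P = P)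
    (hSsymm : (fun C => EuclideanGeometry.reflection H '' C) '' S = S)
    (hψsymm : ∀ x ∈ frontier P, ψ (EuclideanGeometry.reflection H x) = ψ x)
    (hSH : LiftedCubification.IsSubcomplex
      (LiftedCubification.restrict S (H : Set (EuclideanSpace ℝ (Fin d)))) S) :
    ∃ (B : Set (Set (EuclideanSpace ℝ (Fin d)))) (φ : EuclideanSpace ℝ (Fin d) → ℝ),
      LiftedCubification.IsLiftedCubification P S ψ B φ := by
  obtain ⟨u, m, e, hM⟩ := LiftedCubification.exists_isMirror (ψ := ψ) hP H (by simpa using hH)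
    hPsymm hSsymm hψsymm hSH
  exact hM.exists_isLiftedCubification hP hS
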